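/- **Setting (Distributed Measurement Calculus).** A *pattern* $P(V,I,O,\mathcal A)$ has finite qubit sets $I,O\subseteq V$ (input, output, computation space) and a finite sequence $\mathcal A$ of commands: entanglement $E_{ij}$ (controlled-$Z$), destructive measurement ${}^t[M_i^{\alpha}]^s$ in the basis $|\pm_\beta\rangle=(|0\rangle\pm e^{i\beta}|1\rangle)/\sqrt2$ with $\beta=(-1)^s\alpha+t\pi$, whose outcome is bound to the signal $s_i$, and corrections $X_i^s,Z_i^s$; here $s,t$ are sums modulo 2 of constants and classical names. The working qubits $V\setminus I$ are prepared in $(|0\rangle+|1\rangle)/\sqrt2$. An *agent* $\mathbf A(\mathbf i,\mathbf o):Q.\mathcal E$ has finite sets of classical inputs $\mathbf i$ and outputs $\mathbf o$, a finite set $Q$ of qubits it owns at the start, and a finite sequence $\mathcal E$ of events: patterns, classical sends $c!s$ and receptions $c?x$, and sends $qc!q$ and receptions $qc?q$ of a qubit $q$; each channel goes from one fixed agent to another, and sends and receptions synchronise. A *network* $N=\;|_a\,\mathbf A_a(\mathbf i_a,\mathbf o_a):Q_a.\mathcal E_a\,\|\,\sigma$ consists of finitely many agents and a shared resource, a density operator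 $\sigma$ on a set $R\subseteq\bigcup_aQ_a$ of qubits. It is *definite* if each qubit name is introduced only once (as an owned qubit or as a working qubit of a pattern), and there is an order of execution that runs all event sequences to their end without error on all inputs: patterns act only on qubits of their agent that are not yet measured, use only known classical values, and measure exactly the qubits in $V\setminus O$; only owned qubits and known values are sent; each communication event meets its dual; and all classical outputs have a value at the end. **Semantics.** The *type signature* of $N$ gives for each of its agents the classical inputs $\mathbf i_a$ and outputs $\mathbf o_a$, the quantum inputs $Q_a\setminus R$, and the quantum outputs (the qubits that it owns at the end). Run $N$ in an arbitrarily chosen order on classical inputs $u$ and on $\rho\otimes\sigma$, $\rho$ an operator on the input qubits; each measurement branches, states are not renormalised, and the probability of a path is the product of the probabilities of its steps. The *denotational semantics* is the type signature together with the completely positive maps $\mathcal L_{u,w}(\rho)=\sum_k L_k\rho L_k^\dagger$, where $k$ runs over the computation paths that end with classical outputs $w$. The *operational semantics* is the type signature together with the probabilistic transition system $(u,\rho)\Rightarrow_\lambda(w,\rho')$ on density operators $\rho$, where $\lambda>0$ is the total probability and $\rho'$ the sum of the final states of the paths that end with classical outputs $w$. $N_1\equiv N_2$ means that the semantics are equal.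 **Contexts.** In the sequential composition $N_2\circ N_1$ (the outputs of $N_1$ being, agent by agent, the inputs of $N_2$) each agent runs its events of $N_1$, then those of $N_2$; in the parallel composition $N_1\otimes N_2$ agents of the same name are merged, their events being concatenated. In both, the resource is the tensor product of the two resources. A *network context* is built from a hole by the grammar $$C[\cdot]::=[\cdot]\;\mid\;C[\cdot]\otimes M\;\mid\;M\otimes C[\cdot]\;\mid\;M\circ C[\cdot]\;\mid\;C[\cdot]\circ M,$$ with arbitrary networks $M$; $C[N]$ is the network obtained by putting $N$ in the hole. Thus the quantum inputs of $N$ in $C[N]$ may be entangled with qubits of the context. **Corollary.** Let $N_1,N_2$ be definite networks and let $C[\cdot]$ be a network context whose component networks are definite and in which the inputs and outputs of $N_1$ match in all sequential compositions. Assume that there are no clashes of names in $C[N_1]$ and in $C[N_2]$ (in a parallel composition no common qubit names, and no common classical names at any agent; in a sequential composition no common qubit names except outputs of the first network). If $N_1\equiv N_2$, then $C[N_1]$ and $C[N_2]$ are definite networks and $C[N_1]\equiv C[N_2]$. This holds both when $\equiv$ is denotational equivalence throughout and when it is operational equivalence throughout. -/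

import Mathlib

open scoped ComplexOrder

namespace DMC

section

/- Names: `Q` qubit references, `X` names for received classical messages,
`K` channel labels, `A` agent names. -/
variable {Q X K A : Type*}

/-! ### Quantum states -/

/-- Operators on registers of qubits. The computational basis of the register `S : Finset Q` is
indexed by the subsets `a ⊆ S`: the basis vector `a` is the one in which exactly the qubits in `a`
have the value 1. An operator on the register `S` is a matrix that vanishes outside the
subsets of `S`. -/
abbrev State (Q : Type*) := Matrix (Finset Q) (Finset Q) ℂ

/-- `ρ` is an operator on the register `S`. -/
def SupportedOn (S : Finset Q) (ρ : State Q) : Prop :=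
  ∀ a b, ρ a b ≠ 0 → a ⊆ S ∧ b ⊆ S

/-- The trace (the sum is finite for operators on a register). -/
noncomputable def tr (ρ : State Q) : ℂ := ∑ᶠ a, ρ a a

/-- `ρ` is a density operator (positive semidefinite, trace one) on the register `S`. -/
structure IsDensityOn (S : Finset Q) (ρ : State Q) : Prop where
  supported : SupportedOn S ρ
  posSemidef : ρ.PosSemidef
  trace_one : tr ρ = 1

variable [DecidableEq Q] [DecidableEq X] [DecidableEq A]

/-- `ρ ⊗ σ`, where `σ` is an operator on the register `R` and `ρ` one on a register disjoint
from `R`. -/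
def tensor (ρ : State Q) (R : Finset Q) (σ : State Q) : State Q :=
  fun a b => ρ (a \ R) (b \ R) * σ (a ∩ R) (b ∩ R)

/-- Adds the qubits in `W` (not in the register of `ρ`) to the register, each in the normalised
state `(|0⟩ + |1⟩)/√2`. -/
noncomputable def prep (W : Finset Q) (ρ : State Q) : State Q :=
  fun a b => (1 / 2 : ℂ) ^ W.card * ρ (a \ W) (b \ W)

/-- Conjugation by the controlled-`Z` on qubits `i`, `j`. -/
def applyCZ (i j : Q) (ρ : State Q) : State Q :=
  fun a b => (if i ∈ a ∧ j ∈ a then -1 else 1) * ρ a b * (if i ∈ b ∧ j ∈ b then -1 else 1)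

/-- Conjugation by Pauli `X` on qubit `i`. -/
def applyX (i : Q) (ρ : State Q) : State Q :=
  fun a b => ρ (symmDiff a {i}) (symmDiff b {i})

/-- Conjugation by Pauli `Z` on qubit `i`. -/
def applyZ (i : Q) (ρ : State Q) : State Q :=
  fun a b => (if i ∈ a then -1 else 1) * ρ a b * (if i ∈ b then -1 else 1)

/-- The amplitude `⟨±_β | x⟩`, where `|±_β⟩ = (|0⟩ ± e^{iβ} |1⟩)/√2`; the outcome `v = false`
(that is, 0) stands for `+` and `v = true` (that is, 1) for `-`. -/
noncomputable def bra (β : ℝ) (v x : Bool) : ℂ :=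
  if x then (if v then -1 else 1) * Complex.exp (-(β * Complex.I)) / (Real.sqrt 2 : ℂ)
  else 1 / (Real.sqrt 2 : ℂ)

/-- The basis label `a` (with `i ∉ a`) with the value of qubit `i` set to `x`. -/
def setBit (i : Q) (x : Bool) (a : Finset Q) : Finset Q := if x then insert i a else a

/-- The destructive projection `⟨±_β|_i ρ |±_β⟩_i`: not renormalised, and qubit `i` is removed
from the register. -/
noncomputable def project (i : Q) (β : ℝ) (v : Bool) (ρ : State Q) : State Q :=
  fun a b => if i ∈ a ∨ i ∈ b then 0 else
    ∑ x : Bool, ∑ y : Bool,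
      bra β v x * ρ (setBit i x a) (setBit i y b) * (starRingEnd ℂ) (bra β v y)

/-! ### Measurement patterns -/

/-- Classical names: `Sum.inl i` is the signal `s_i` of the measurement of qubit `i`; `Sum.inr x`
is any other name. Any classical name can be bound by a classical reception. -/
abbrev CName (Q X : Type*) := Q ⊕ X

/-- A classical memory (outcome map): a partial assignment of bits to classical names. -/
abbrev Mem (Q X : Type*) := CName Q X → Option Bool

/-- Signal expressions: constants, names, and sums modulo 2. -/
inductive Signal (Q X : Type*) where
  | const (v : Bool)
  | name (x : CName Q X)
  | add (s t : Signal Q X)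

/-- The value of a signal. (An unbound name reads as 0; this never happens in a definite network,
see `Signal.Known`.) -/
def Signal.eval (Γ : Mem Q X) : Signal Q X → Bool
  | .const v => v
  | .name x => (Γ x).getD false
  | .add s t => xor (s.eval Γ) (t.eval Γ)

/-- All names of the signal are among the known names. -/
def Signal.Known (known : Set (CName Q X)) : Signal Q X → Prop
  | .const _ => True
  | .name x => x ∈ known
  | .add s t => s.Known known ∧ t.Known known

/-- The names in a signal. -/
def Signal.names : Signal Q X → Finset (CName Q X)
  | .const _ => ∅
  | .name x => {x}
  | .add s t => s.names ∪ t.names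

/-- The commands of the measurement calculus: entanglement `E_ij`, measurement `^t[M_i^α]^s`, and
corrections `X_i^s`, `Z_i^s`. -/
inductive Cmd (Q X : Type*) where
  | entangle (i j : Q)
  | measure (i : Q) (α : ℝ) (s t : Signal Q X)
  | corrX (i : Q) (s : Signal Q X)
  | corrZ (i : Q) (s : Signal Q X)

/-- The classical names that occur in a command, including the signal that it produces. -/
def Cmd.cnames : Cmd Q X → Finset (CName Q X)
  | .entangle _ _ => ∅
  | .measure i _ s t => {Sum.inl i} ∪ s.names ∪ t.names
  | .corrX _ s => s.names
  | .corrZ _ s => s.names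

/-- The actual measurement angle `(-1)^s α + t π`. -/
noncomputable def angle (α : ℝ) (s t : Bool) : ℝ :=
  (if s then -α else α) + (if t then Real.pi else 0)

/-- The possible results of a command on a memory and a state, with their probabilities.
A measurement has two results. -/
noncomputable def Cmd.exec : Cmd Q X → Mem Q X × State Q → List (ℝ × (Mem Q X × State Q))
  | .entangle i j, (Γ, ρ) => [(1, (Γ, applyCZ i j ρ))]
  | .corrX i s, (Γ, ρ) => [(1, (Γ, if s.eval Γ then applyX i ρ else ρ))]
  | .corrZ i s, (Γ, ρ) => [(1, (Γ, if s.eval Γ then applyZ i ρ else ρ))]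
  | .measure i α s t, (Γ, ρ) =>
      [false, true].map fun v =>
        let ρ' := project i (angle α (s.eval Γ) (t.eval Γ)) v ρ
        ((tr ρ').re / (tr ρ).re, (Function.update Γ (Sum.inl i) (some v), ρ'))

/-- Executes a sequence of commands, the head of the list first. The results list all computation
paths; the probability of a path is the product of the probabilities of its steps. -/
noncomputable def execCmds : List (Cmd Q X) → Mem Q X × State Q →
    List (ℝ × (Mem Q X × State Q))
  | [], c => [(1, c)]
  | C :: cs, c =>
      (C.exec c).flatMap fun b => (execCmds cs b.2).map fun d => (b.1 * d.1, d.2)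

/-- A pattern `P(V, I, O, cmds)`: computation space, inputs, outputs, command sequence. The
sequence is in execution order. -/
structure Pattern (Q X : Type*) where
  V : Finset Q
  I : Finset Q
  O : Finset Q
  cmds : List (Cmd Q X)

/-- Definiteness of a command sequence, given the qubits not yet measured and the known classical
names: commands act on qubits of the computation space that have not been measured, depend only on
known names, and at the end exactly the output qubits `O` have not been measured. -/
def CmdsDefinite (O : Finset Q) :
    List (Cmd Q X) → Finset Q → Set (CName Q X) → Prop
  | [], live, _ => live = O
  | .entangle i j :: cs, live, known =>
      i ∈ live ∧ j ∈ live ∧ i ≠ j ∧ CmdsDefinite O cs live known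
  | .corrX i s :: cs, live, known =>
      i ∈ live ∧ s.Known known ∧ CmdsDefinite O cs live known
  | .corrZ i s :: cs, live, known =>
      i ∈ live ∧ s.Known known ∧ CmdsDefinite O cs live known
  | .measure i _ s t :: cs, live, known =>
      i ∈ live ∧ s.Known known ∧ t.Known known ∧
        CmdsDefinite O cs (live.erase i) (insert (Sum.inl i) known)

/-- A pattern is definite in an environment in which the given classical names are known. -/
def Pattern.Definite (P : Pattern Q X) (known : Set (CName Q X)) : Prop :=
  P.I ⊆ P.V ∧ CmdsDefinite P.O P.cmds P.V known

/-! ### Agents and networks -/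

/-- The instructions of an agent. Channels connect two agents: a send names the receiving agent
`dst`, a reception the sending agent `src`, together with a channel label. -/
inductive Event (Q X K A : Type*) where
  /-- a local pattern -/
  | pat (P : Pattern Q X)
  /-- classical send `c!s` -/
  | csend (dst : A) (ch : K) (s : Signal Q X)
  /-- classical reception `c?x` -/
  | crecv (src : A) (ch : K) (x : CName Q X)
  /-- quantum send `qc!q` -/
  | qsend (dst : A) (ch : K) (q : Q)
  /-- quantum reception `qc?q` -/
  | qrecv (src : A) (ch : K) (q : Q)

/-- How an event changes the set of qubits that its agent owns. -/
def Event.own : Event Q X K A → Finset Q → Finset Q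
  | .pat P, S => (S \ P.I) ∪ P.O
  | .csend _ _ _, S => S
  | .crecv _ _ _, S => S
  | .qsend _ _ q, S => S \ {q}
  | .qrecv _ _ q, S => S ∪ {q}

/-- The qubit references of an event. -/
def Event.qnames : Event Q X K A → Finset Q
  | .pat P => P.V ∪ P.I ∪ P.O
  | .csend _ _ _ => ∅
  | .crecv _ _ _ => ∅
  | .qsend _ _ q => {q}
  | .qrecv _ _ q => {q}

/-- The classical names of an event. -/
def Event.cnames : Event Q X K A → Finset (CName Q X)
  | .pat P => P.cmds.foldr (fun C S => C.cnames ∪ S) ∅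
  | .csend _ _ s => s.names
  | .crecv _ _ x => {x}
  | .qsend _ _ _ => ∅
  | .qrecv _ _ _ => ∅

/-- The working qubits that an event introduces. -/
def Event.working : Event Q X K A → Multiset Q
  | .pat P => (P.V \ P.I).val
  | _ => 0

/-- An agent `a(cin, cout) : own . prog`, with its classical inputs and outputs, its type (the
qubits it owns at the start) and its event sequence, in execution order. -/
structure Agent (Q X K A : Type*) where
  cin : Finset (CName Q X)
  cout : Finset (CName Q X)
  own : Finset Q
  prog : List (Event Q X K A)

/-- The agent that owns nothing and does nothing. -/
def Agent.idle : Agent Q X K A := ⟨∅, ∅, ∅, []⟩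

/-- The qubits that the agent owns after its event sequence. -/
def Agent.out (g : Agent Q X K A) : Finset Q := g.prog.foldl (fun S e => e.own S) g.own

/-- All qubit references of the agent. -/
def Agent.qnames (g : Agent Q X K A) : Finset Q :=
  g.prog.foldr (fun e S => e.qnames ∪ S) g.own

/-- All classical names of the agent. -/
def Agent.cnames (g : Agent Q X K A) : Finset (CName Q X) :=
  g.prog.foldr (fun e S => e.cnames ∪ S) (g.cin ∪ g.cout)

/-- The qubits introduced by the agent, with multiplicity: the ones it owns at the start and the
working qubits of its patterns. -/
def Agent.introduced (g : Agent Q X K A) : Multiset Q :=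
  g.own.val + (g.prog.map Event.working).sum

/-- A network `|_a agent a ‖ σ`: finitely many agents and a shared entanglement resource, which is
a state `σ` of the qubits in `res`. -/
structure Network (Q X K A : Type*) where
  names : Finset A
  agent : A → Agent Q X K A
  res : Finset Q
  σ : State Q

/-- The quantum inputs of an agent: the qubits it owns, without its share of the resource. -/
def Network.qin (N : Network Q X K A) (a : A) : Finset Q := (N.agent a).own \ N.res

/-- The quantum outputs of an agent. -/
def Network.qout (N : Network Q X K A) (a : A) : Finset Q := (N.agent a).out

/-- All quantum inputs of the network. -/
def Network.inputs (N : Network Q X K A) : Finset Q := N.names.biUnion N.qin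

/-- All quantum outputs of the network. -/
def Network.outputs (N : Network Q X K A) : Finset Q := N.names.biUnion N.qout

/-- All qubit references of the network. -/
def Network.qnames (N : Network Q X K A) : Finset Q :=
  N.names.biUnion fun a => (N.agent a).qnames

/-! ### Small-step operational semantics -/

/-- The state of an agent: owned qubits, local memory, remaining events. -/
structure AgentState (Q X K A : Type*) where
  own : Finset Q
  mem : Mem Q X
  prog : List (Event Q X K A)

/-- A configuration: the agents' states and the global quantum state. -/
structure Config (Q X K A : Type*) where
  agent : A → AgentState Q X K A
  state : State Q

/-- What can fire: a local pattern of an agent, or a rendezvous of a sender and a receiver. -/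
inductive Action (A : Type*) where
  | loc (a : A)
  | comm (a b : A)

/-- The names bound in a memory. -/
def bound (Γ : Mem Q X) : Set (CName Q X) := {x | (Γ x).isSome}

/-- The action can fire. A pattern must be definite and its inputs must belong to the agent; a send
needs the dual reception at the other agent, the value sent must be defined, and a
qubit sent must belong to the sender. -/
def Enabled (c : Config Q X K A) : Action A → Prop
  | .loc a => ∃ P r, (c.agent a).prog = .pat P :: r ∧ P.I ⊆ (c.agent a).own ∧
      P.Definite (bound (c.agent a).mem)
  | .comm a b =>
      (∃ k s x r r', (c.agent a).prog = .csend b k s :: r ∧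
        (c.agent b).prog = .crecv a k x :: r' ∧ s.Known (bound (c.agent a).mem)) ∨
      (∃ k q r r', (c.agent a).prog = .qsend b k q :: r ∧
        (c.agent b).prog = .qrecv a k q :: r' ∧ q ∈ (c.agent a).own)

/-- The possible results of an action, with their probabilities. A pattern first prepares its
working qubits. (The value for actions that are not enabled is irrelevant.) -/
noncomputable def fire (c : Config Q X K A) : Action A → List (ℝ × Config Q X K A)
  | .loc a =>
      match (c.agent a).prog with
      | .pat P :: r =>
          (execCmds P.cmds ((c.agent a).mem, prep (P.V \ P.I) c.state)).map fun b =>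
            (b.1, ⟨Function.update c.agent a
              ⟨Event.own (.pat P : Event Q X K A) (c.agent a).own, b.2.1, r⟩, b.2.2⟩)
      | _ => []
  | .comm a b =>
      match (c.agent a).prog, (c.agent b).prog with
      | .csend _ _ s :: r, .crecv _ _ x :: r' =>
          [(1, ⟨Function.update (Function.update c.agent
              a ⟨(c.agent a).own, (c.agent a).mem, r⟩)
              b ⟨(c.agent b).own,
                Function.update (c.agent b).mem x (some (s.eval (c.agent a).mem)), r'⟩,
            c.state⟩)]
      | .qsend _ _ q :: r, .qrecv _ _ _ :: r' =>
          [(1, ⟨Function.update (Function.update c.agent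
              a ⟨(c.agent a).own \ {q}, (c.agent a).mem, r⟩)
              b ⟨(c.agent b).own ∪ {q}, (c.agent b).mem, r'⟩,
            c.state⟩)]
      | _, _ => []

/-- All computation paths that follow a schedule, with their probabilities and final
configurations. -/
noncomputable def run : List (Action A) → Config Q X K A → List (ℝ × Config Q X K A)
  | [], c => [(1, c)]
  | α :: l, c => (fire c α).flatMap fun b => (run l b.2).map fun d => (b.1 * d.1, d.2)

/-- Classical inputs and outputs: bits for the classical names of each agent. -/
abbrev Val (Q X A : Type*) := A → Mem Q X

/-- `u` assigns bits to exactly the classical inputs of the network. -/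
def Network.IsInput (N : Network Q X K A) (u : Val Q X A) : Prop :=
  ∀ a, bound (u a) = ↑(N.agent a).cin

/-- The initial configuration for classical inputs `u` and quantum input `ρ`. -/
def Network.init (N : Network Q X K A) (u : Val Q X A) (ρ : State Q) : Config Q X K A where
  agent a := ⟨(N.agent a).own, u a, (N.agent a).prog⟩
  state := tensor ρ N.res N.σ

/-- The classical outputs found in a final configuration. -/
def Network.result (N : Network Q X K A) (c : Config Q X K A) : Val Q X A :=
  fun a x => if x ∈ (N.agent a).cout then (c.agent a).mem x else none

/-- All computation paths from `c` along the schedule are free of errors, and at the end all event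
sequences are empty and all classical outputs have a value. -/
def Network.Completes (N : Network Q X K A) : List (Action A) → Config Q X K A → Prop
  | [], c => ∀ a, (c.agent a).prog = [] ∧ ↑(N.agent a).cout ⊆ bound (c.agent a).mem
  | α :: l, c => Enabled c α ∧ ∀ b ∈ fire c α, N.Completes l b.2

/-- The schedule runs the whole network, on all inputs. (Event sequences have no branching: which
actions can fire does not depend on inputs or on measurement outcomes.) -/
def Network.IsSchedule (N : Network Q X K A) (l : List (Action A)) : Prop :=
  ∀ u ρ, N.IsInput u → N.Completes l (N.init u ρ)

/-- The definiteness conditions under which a network is a well-defined program. -/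
structure Network.Definite (N : Network Q X K A) : Prop where
  /-- only the listed agents are present -/
  idle : ∀ a, a ∉ N.names → N.agent a = Agent.idle
  /-- qubits are uniquely identified: each qubit name is introduced once -/
  nodup : (∑ a ∈ N.names, (N.agent a).introduced).Nodup
  /-- the qubits of the shared resource are distributed over the agents -/
  res_subset : N.res ⊆ N.names.biUnion fun a => (N.agent a).own
  /-- the shared resource is a quantum state -/
  density : IsDensityOn N.res N.σ
  /-- agents operate only on qubits that they own, use only values that they know, and every
  communication event finds its dual event, so that the execution runs to its end -/
  schedulable : ∃ l, N.IsSchedule l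

/-! ### Semantics of networks -/

open Classical in
/-- An arbitrarily chosen order of execution. -/
noncomputable def Network.schedule (N : Network Q X K A) : List (Action A) :=
  if h : ∃ l, N.IsSchedule l then h.choose else []

open Classical in
/-- The computation paths of the network that end with the classical outputs `w`. -/
noncomputable def Network.paths (N : Network Q X K A) (u : Val Q X A) (ρ : State Q)
    (w : Val Q X A) : List (ℝ × Config Q X K A) :=
  (run N.schedule (N.init u ρ)).filter fun p => decide (N.result p.2 = w)

/-- The denotation: the family, indexed by classical inputs `u` and classical outputs `w`, of the
completely positive maps `ρ ↦ ∑ L_k ρ L_k†` from the input to the output register, where `k` runs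
over the computation paths (combinations of measurement outcomes) with outputs `w`. -/
noncomputable def Network.den (N : Network Q X K A) (u w : Val Q X A) (ρ : State Q) : State Q :=
  ((N.paths u ρ w).map fun p => p.2.state).sum

/-- The big-step probabilistic transition system: from classical inputs `u` and density operator `ρ`
the network moves with probability `l > 0` to classical outputs `w` and the (not renormalised) quantum
state `ρ'`. The computation paths that agree on the classical outputs are gathered in
one transition. -/
def Network.BigStep (N : Network Q X K A) (u : Val Q X A) (ρ : State Q) (l : ℝ)
    (w : Val Q X A) (ρ' : State Q) : Prop :=
  N.IsInput u ∧ IsDensityOn N.inputs ρ ∧ 0 < l ∧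
    l = ((N.paths u ρ w).map fun p => p.1).sum ∧
    ρ' = ((N.paths u ρ w).map fun p => p.2.state).sum

/-- The networks have the same agents, and these have the same type signature: the same
classical and quantum inputs and outputs. -/
structure Network.SameType (N₁ N₂ : Network Q X K A) : Prop where
  names : N₁.names = N₂.names
  cin : ∀ a, (N₁.agent a).cin = (N₂.agent a).cin
  cout : ∀ a, (N₁.agent a).cout = (N₂.agent a).cout
  qin : ∀ a, N₁.qin a = N₂.qin a
  qout : ∀ a, N₁.qout a = N₂.qout a

/-- Denotational equivalence: the same type signature and the same completely positive maps. -/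
def Network.DenEquiv (N₁ N₂ : Network Q X K A) : Prop :=
  N₁.SameType N₂ ∧
    ∀ u w ρ, N₁.IsInput u → SupportedOn N₁.inputs ρ → N₁.den u w ρ = N₂.den u w ρ

/-- Operational equivalence: the same type signature and the same probabilistic
transition system. -/
def Network.OpEquiv (N₁ N₂ : Network Q X K A) : Prop :=
  N₁.SameType N₂ ∧ ∀ u ρ l w ρ', N₁.BigStep u ρ l w ρ' ↔ N₂.BigStep u ρ l w ρ'

/-! ### Composition and contexts -/

/-- Sequential composition `N₂ ∘ N₁`: each agent first runs its events of `N₁`, then those of `N₂`.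
Its qubits for `N₂` are its outputs of `N₁` and its share of the resource of `N₂`. -/
def Network.comp (N₂ N₁ : Network Q X K A) : Network Q X K A where
  names := N₁.names ∪ N₂.names
  agent a :=
    { cin := (N₁.agent a).cin
      cout := (N₂.agent a).cout
      own := (N₁.agent a).own ∪ ((N₂.agent a).own ∩ N₂.res)
      prog := (N₁.agent a).prog ++ (N₂.agent a).prog }
  res := N₁.res ∪ N₂.res
  σ := tensor N₁.σ N₂.res N₂.σ

/-- Parallel composition `N₁ ⊗ N₂`; agents of the same name are merged. -/
def Network.par (N₁ N₂ : Network Q X K A) : Network Q X K A where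
  names := N₁.names ∪ N₂.names
  agent a :=
    { cin := (N₁.agent a).cin ∪ (N₂.agent a).cin
      cout := (N₁.agent a).cout ∪ (N₂.agent a).cout
      own := (N₁.agent a).own ∪ (N₂.agent a).own
      prog := (N₁.agent a).prog ++ (N₂.agent a).prog }
  res := N₁.res ∪ N₂.res
  σ := tensor N₁.σ N₂.res N₂.σ

/-- The outputs of `N₁` are, agent by agent, the inputs of `N₂`. -/
def Network.Connects (N₁ N₂ : Network Q X K A) : Prop :=
  ∀ a, N₁.qout a = N₂.qin a ∧ (N₁.agent a).cout = (N₂.agent a).cin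

/-- The only qubit names that `N₁` shares with its successor `N₂` are outputs of `N₁`. -/
def Network.SeqApart (N₁ N₂ : Network Q X K A) : Prop :=
  N₁.qnames ∩ N₂.qnames ⊆ N₁.outputs

/-- The networks share no qubit names, and no classical names at any agent. -/
def Network.ParApart (N₁ N₂ : Network Q X K A) : Prop :=
  Disjoint N₁.qnames N₂.qnames ∧ ∀ a, Disjoint (N₁.agent a).cnames (N₂.agent a).cnames

/-- Network contexts `C[·]`: arbitrary network compositions with one hole. -/
inductive Context (Q X K A : Type*) where
  /-- `[·]` -/
  | hole
  /-- `C[·] ⊗ M` -/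
  | parLeft (C : Context Q X K A) (M : Network Q X K A)
  /-- `M ⊗ C[·]` -/
  | parRight (M : Network Q X K A) (C : Context Q X K A)
  /-- `M ∘ C[·]` -/
  | before (M : Network Q X K A) (C : Context Q X K A)
  /-- `C[·] ∘ M` -/
  | after (C : Context Q X K A) (M : Network Q X K A)

/-- The network `C[N]`. -/
def Context.fill : Context Q X K A → Network Q X K A → Network Q X K A
  | .hole, N => N
  | .parLeft C M, N => (C.fill N).par M
  | .parRight M C, N => M.par (C.fill N)
  | .before M C, N => M.comp (C.fill N)
  | .after C M, N => (C.fill N).comp M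

/-- The components of the context are definite networks, and the inputs and outputs match in each
sequential composition when `N` is in the hole. (This depends only on the type
signature of `N`.) -/
def Context.Connects : Context Q X K A → Network Q X K A → Prop
  | .hole, _ => True
  | .parLeft C M, N => C.Connects N ∧ M.Definite
  | .parRight M C, N => C.Connects N ∧ M.Definite
  | .before M C, N => C.Connects N ∧ M.Definite ∧ (C.fill N).Connects M
  | .after C M, N => C.Connects N ∧ M.Definite ∧ M.Connects (C.fill N)

/-- There are no accidental clashes of names in `C[N]`. -/
def Context.NamesApart : Context Q X K A → Network Q X K A → Prop
  | .hole, _ => True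
  | .parLeft C M, N => C.NamesApart N ∧ (C.fill N).ParApart M
  | .parRight M C, N => C.NamesApart N ∧ M.ParApart (C.fill N)
  | .before M C, N => C.NamesApart N ∧ (C.fill N).SeqApart M
  | .after C M, N => C.NamesApart N ∧ M.SeqApart (C.fill N)

end

end DMC

/-! Which actions can fire, and how the classical memories branch, never depends on the quantum
state; along a fixed path the state undergoes a fixed linear map of the form ρ ↦ LρL†. For given
classical inputs a run is therefore a multiset of pairs (final agents, linear map), and
probabilities can be forgotten until the end (`map_run`).

The order of execution is irrelevant. Two different actions that are both ready involve disjoint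
sets of agents, hence, since no qubit name is introduced twice, disjoint sets of qubits, and
operators on disjoint registers commute (`LocalOn.commute`). A ready action can thus be pulled to
the front of any complete schedule, and all complete schedules have the same computation paths
(`branches_eq`). So a composite network may be evaluated by running all of its first component and
then all of its second. The frame lemmas show that each component, inside the composite, behaves as
it does alone, and `two_stage` turns this into the formulas `Network.den_par` and
`Network.den_comp`.

Entanglement with the context costs nothing. The denotation of a network commutes with taking the
block of the state at fixed basis values of foreign qubits (`Network.Definite.den_slice`), so maps
that agree on the input register also agree in the presence of an arbitrary ancilla
(`Network.DenEquiv.den_eq`). This gives the congruence for parallel composition. For sequential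
composition the paths are grouped by the classical values that are handed over (`sum_map_by_label`),
and linearity does the rest. Denotational equivalence then passes through contexts by structural
induction (`Context.fill_denEquiv`).

The operational statement reduces to the denotational one. The quotients of traces along a path
telescope (`run_prob`), so the probability of a transition is the trace of its final state. The
transition system can therefore hide the denotation only on inputs that are not density operators
and at outputs of probability zero. But density operators span (`linearMap_eq_of_density`), and a
positive operator of trace zero vanishes (`eq_zero_of_tr`); hence `Network.opEquiv_iff_denEquiv`. -/

set_option linter.unusedSectionVars false

/-! ### Operators on subregisters: composition, commutation, blocks, tensor products -/

namespace DMC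

section LocalOperators

variable {Q : Type*} [DecidableEq Q]

/-! ### Operators that act on a subregister -/

/-- The map `ρ ↦ M ρ M†`, where `M` is an operator on the register `V`. -/
noncomputable def krausMap (V : Finset Q) (M : Finset Q → Finset Q → ℂ) :
    Module.End ℂ (State Q) where
  toFun ρ := Matrix.of fun a b => ∑ p ∈ V.powerset ×ˢ V.powerset,
    M (a ∩ V) p.1 * ρ (a \ V ∪ p.1) (b \ V ∪ p.2) * (starRingEnd ℂ) (M (b ∩ V) p.2)
  map_add' ρ τ := by
    ext a b
    simp only [Matrix.of_apply, Matrix.add_apply, mul_add, add_mul, Finset.sum_add_distrib]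
  map_smul' c ρ := by
    ext a b
    simp only [Matrix.of_apply, Matrix.smul_apply, smul_eq_mul, RingHom.id_apply, Finset.mul_sum]
    exact Finset.sum_congr rfl fun _ _ => by ring

lemma krausMap_apply (V : Finset Q) (M : Finset Q → Finset Q → ℂ) (ρ : State Q) (a b : Finset Q) :
    krausMap V M ρ a b = ∑ p ∈ V.powerset ×ˢ V.powerset,
      M (a ∩ V) p.1 * ρ (a \ V ∪ p.1) (b \ V ∪ p.2) * (starRingEnd ℂ) (M (b ∩ V) p.2) := rfl

/-- The linear map `L` has the form `ρ ↦ M ρ M†` for an operator `M` on the register `V`. -/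
def LocalOn (V : Finset Q) (L : Module.End ℂ (State Q)) : Prop := ∃ M, L = krausMap V M

/-- A matrix with at most one nonzero entry per row leaves a single term of the double sum. The
identity, preparation, controlled-`Z` and the Pauli corrections all have this form. -/
lemma krausMap_single {V : Finset Q} (f : Finset Q → Finset Q) (c : Finset Q → ℂ)
    (hf : ∀ a, a ⊆ V → f a ⊆ V) (ρ : State Q) (a b : Finset Q) :
    krausMap V (fun a s => if s = f a then c a else 0) ρ a b =
      c (a ∩ V) * ρ (a \ V ∪ f (a ∩ V)) (b \ V ∪ f (b ∩ V)) * (starRingEnd ℂ) (c (b ∩ V)) := by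
  rw [krausMap_apply, Finset.sum_eq_single (f (a ∩ V), f (b ∩ V))]
  · simp
  · rintro ⟨s, t⟩ _ hne
    by_cases hs : s = f (a ∩ V)
    · by_cases ht : t = f (b ∩ V)
      · exact absurd (by rw [hs, ht]) hne
      · simp [ht]
    · simp [hs]
  · intro h
    exact absurd (by simp [hf _ (Finset.inter_subset_right)]) h

lemma LocalOn.one (V : Finset Q) : LocalOn V 1 := by
  refine ⟨fun a s => if s = id a then 1 else 0, LinearMap.ext fun ρ => ?_⟩
  ext a b
  rw [krausMap_single id (fun _ => 1) fun _ h => h]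
  simp [Finset.sdiff_union_inter]

lemma sdiff_union_inter_self {V a s : Finset Q} (h : s ⊆ V) : (a \ V ∪ s) ∩ V = s := by
  grind

lemma sdiff_union_sdiff_self {V a s : Finset Q} (h : s ⊆ V) : (a \ V ∪ s) \ V = a \ V := by
  grind

lemma LocalOn.mul {V : Finset Q} {L L' : Module.End ℂ (State Q)} (h : LocalOn V L)
    (h' : LocalOn V L') : LocalOn V (L * L') := by
  obtain ⟨M, rfl⟩ := h
  obtain ⟨N, rfl⟩ := h'
  refine ⟨fun a s => ∑ r ∈ V.powerset, M a r * N r s, LinearMap.ext fun ρ => ?_⟩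
  ext a b
  have h1 : (krausMap V M * krausMap V N) ρ a b =
      ∑ p ∈ V.powerset ×ˢ V.powerset, ∑ q ∈ V.powerset ×ˢ V.powerset,
        M (a ∩ V) p.1 * (N p.1 q.1 * ρ (a \ V ∪ q.1) (b \ V ∪ q.2) *
          (starRingEnd ℂ) (N p.2 q.2)) * (starRingEnd ℂ) (M (b ∩ V) p.2) := by
    change krausMap V M (krausMap V N ρ) a b = _
    rw [krausMap_apply]
    refine Finset.sum_congr rfl fun p hp => ?_
    simp only [Finset.mem_product, Finset.mem_powerset] at hp
    rw [krausMap_apply, Finset.mul_sum, Finset.sum_mul]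
    refine Finset.sum_congr rfl fun q _ => ?_
    rw [sdiff_union_inter_self hp.1, sdiff_union_inter_self hp.2, sdiff_union_sdiff_self hp.1,
      sdiff_union_sdiff_self hp.2]
  rw [h1, krausMap_apply, Finset.sum_comm]
  refine Finset.sum_congr rfl fun q _ => ?_
  rw [map_sum, Finset.sum_mul, Finset.sum_mul_sum, Finset.sum_product]
  refine Finset.sum_congr rfl fun r _ => Finset.sum_congr rfl fun r' _ => ?_
  simp only [map_mul]
  ring

/-- Operators on different tensor factors commute: `key` expands the product into an expression that
is symmetric in the two operators, up to the order of summation. -/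
lemma LocalOn.commute {V W : Finset Q} (hVW : Disjoint V W) {L L' : Module.End ℂ (State Q)}
    (h : LocalOn V L) (h' : LocalOn W L') : L * L' = L' * L := by
  obtain ⟨M, rfl⟩ := h
  obtain ⟨N, rfl⟩ := h'
  have key : ∀ {V W : Finset Q} (_ : Disjoint V W) (M N : Finset Q → Finset Q → ℂ) (ρ : State Q)
      (a b : Finset Q), (krausMap V M * krausMap W N) ρ a b =
      ∑ p ∈ V.powerset ×ˢ V.powerset, ∑ q ∈ W.powerset ×ˢ W.powerset,
        M (a ∩ V) p.1 * N (a ∩ W) q.1 * ρ (a \ (V ∪ W) ∪ p.1 ∪ q.1) (b \ (V ∪ W) ∪ p.2 ∪ q.2) *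
          ((starRingEnd ℂ) (M (b ∩ V) p.2) * (starRingEnd ℂ) (N (b ∩ W) q.2)) := by
    intro V W hVW M N ρ a b
    change krausMap V M (krausMap W N ρ) a b = _
    rw [krausMap_apply]
    refine Finset.sum_congr rfl fun p hp => ?_
    simp only [Finset.mem_product, Finset.mem_powerset] at hp
    rw [krausMap_apply, Finset.mul_sum, Finset.sum_mul]
    refine Finset.sum_congr rfl fun q _ => ?_
    have e1 : ∀ {a s : Finset Q}, s ⊆ V → (a \ V ∪ s) ∩ W = a ∩ W := by
      intro a s hs
      have := Finset.disjoint_left.1 hVW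
      grind
    have e2 : ∀ {a s : Finset Q}, s ⊆ V → (a \ V ∪ s) \ W = a \ (V ∪ W) ∪ s := by
      intro a s hs
      have := Finset.disjoint_left.1 hVW
      grind
    rw [e1 hp.1, e1 hp.2, e2 hp.1, e2 hp.2]
    ring
  refine LinearMap.ext fun ρ => ?_
  ext a b
  rw [key hVW, key hVW.symm, Finset.sum_comm]
  refine Finset.sum_congr rfl fun q _ => Finset.sum_congr rfl fun p _ => ?_
  rw [Finset.union_comm V W, Finset.union_right_comm, Finset.union_right_comm (b \ (W ∪ V))]
  ring

/-- On the larger register the operator is `M ⊗ 1`; the test `s \ V = a \ V` is the identity matrix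
of `W \ V`. The nonzero terms of the large sum correspond to those of the small one by restriction
to `V`, and the inverse refills the bits of `a` and `b` outside `V`. -/
lemma LocalOn.mono {V W : Finset Q} (hVW : V ⊆ W) {L : Module.End ℂ (State Q)}
    (h : LocalOn V L) : LocalOn W L := by
  obtain ⟨M, rfl⟩ := h
  refine ⟨fun a s => if s \ V = a \ V then M (a ∩ V) (s ∩ V) else 0, LinearMap.ext fun ρ => ?_⟩
  ext a b
  rw [krausMap_apply, krausMap_apply]
  have e : ∀ a : Finset Q, a ∩ W ∩ V = a ∩ V := by intro a; grind
  simp only [e]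
  symm
  refine Finset.sum_bij_ne_zero (fun p _ _ => (p.1 ∩ V, p.2 ∩ V)) ?_ ?_ ?_ ?_
  · intro p _ _
    simp
  · rintro ⟨s, t⟩ _ hs0 ⟨s', t'⟩ _ hs0' heq
    have h1 : s \ V = (a ∩ W) \ V := by by_contra hh; simp [hh] at hs0
    have h2 : t \ V = (b ∩ W) \ V := by by_contra hh; simp [hh] at hs0
    have h1' : s' \ V = (a ∩ W) \ V := by by_contra hh; simp [hh] at hs0'
    have h2' : t' \ V = (b ∩ W) \ V := by by_contra hh; simp [hh] at hs0'
    simp only [Prod.mk.injEq] at heq ⊢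
    rw [← Finset.sdiff_union_inter s V, ← Finset.sdiff_union_inter t V, h1, h2, heq.1, heq.2,
      ← h1', ← h2', Finset.sdiff_union_inter, Finset.sdiff_union_inter]
    exact ⟨rfl, rfl⟩
  · rintro ⟨s, t⟩ hst hne
    simp only [Finset.mem_product, Finset.mem_powerset] at hst
    have f1 : ((a ∩ W) \ V ∪ s) ∩ V = s := sdiff_union_inter_self hst.1
    have f2 : ((b ∩ W) \ V ∪ t) ∩ V = t := sdiff_union_inter_self hst.2
    have f3 : ((a ∩ W) \ V ∪ s) \ V = (a ∩ W) \ V := sdiff_union_sdiff_self hst.1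
    have f4 : ((b ∩ W) \ V ∪ t) \ V = (b ∩ W) \ V := sdiff_union_sdiff_self hst.2
    have g : ∀ (a s : Finset Q), a \ W ∪ ((a ∩ W) \ V ∪ s) = a \ V ∪ s := by
      intro a s; grind
    refine ⟨((a ∩ W) \ V ∪ s, (b ∩ W) \ V ∪ t), ?_, ?_, ?_⟩
    · simp only [Finset.mem_product, Finset.mem_powerset]
      exact ⟨by grind, by grind⟩
    · simpa only [f1, f2, f3, f4, g, if_true] using hne
    · simp only [f1, f2]
  · rintro ⟨s, t⟩ hst hs0
    have h1 : s \ V = (a ∩ W) \ V := by by_contra hh; simp [hh] at hs0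
    have h2 : t \ V = (b ∩ W) \ V := by by_contra hh; simp [hh] at hs0
    simp only [h1, h2, if_true]
    have g : ∀ (a s : Finset Q), s \ V = (a ∩ W) \ V → a \ W ∪ s = a \ V ∪ s ∩ V := by
      intro a s h
      rw [Finset.ext_iff] at h
      ext x
      have := h x
      have := @hVW x
      simp only [Finset.mem_union, Finset.mem_sdiff, Finset.mem_inter] at *
      tauto
    rw [g a s h1, g b t h2]

/-! ### Maps with which local operators commute -/

/-- A common form for blocks and tensor products: `τ` arises from `ρ` by relabelling rows and
columns and by scaling entries. If neither operation looks at the bits in `V` or changes them,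
conjugation on `V` passes through. -/
lemma krausMap_frame {V : Finset Q} (M : Finset Q → Finset Q → ℂ) (ρ τ : State Q)
    {m : Finset Q → Finset Q → ℂ} {f g : Finset Q → Finset Q}
    (hf : ∀ a s, s ⊆ V → f (a \ V ∪ s) = f a \ V ∪ s) (hfV : ∀ a, f a ∩ V = a ∩ V)
    (hg : ∀ a s, s ⊆ V → g (a \ V ∪ s) = g a \ V ∪ s) (hgV : ∀ a, g a ∩ V = a ∩ V)
    (hm : ∀ a b s t, s ⊆ V → t ⊆ V → m (a \ V ∪ s) (b \ V ∪ t) = m a b)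
    (hτ : ∀ a b, τ a b = m a b * ρ (f a) (g b)) (a b : Finset Q) :
    krausMap V M τ a b = m a b * krausMap V M ρ (f a) (g b) := by
  rw [krausMap_apply, krausMap_apply, Finset.mul_sum]
  refine Finset.sum_congr rfl fun p hp => ?_
  simp only [Finset.mem_product, Finset.mem_powerset] at hp
  rw [hτ, hf _ _ hp.1, hg _ _ hp.2, hfV, hgV, hm _ _ _ _ hp.1 hp.2]
  ring

/-- The block of `ρ` in which the qubits of `T` have the values `x` (rows) and `y` (columns). -/
def slice (T x y : Finset Q) (ρ : State Q) : State Q :=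
  fun a b => (if Disjoint a T ∧ Disjoint b T then 1 else 0) * ρ (a ∪ x) (b ∪ y)

lemma eq_slice (T : Finset Q) (ρ : State Q) (a b : Finset Q) :
    ρ a b = slice T (a ∩ T) (b ∩ T) ρ (a \ T) (b \ T) := by
  simp [slice, Finset.sdiff_disjoint, Finset.sdiff_union_inter]

lemma LocalOn.slice {V T x y : Finset Q} (hVT : Disjoint V T) (hx : x ⊆ T) (hy : y ⊆ T)
    {L : Module.End ℂ (State Q)} (h : LocalOn V L) (ρ : State Q) :
    L (slice T x y ρ) = slice T x y (L ρ) := by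
  obtain ⟨M, rfl⟩ := h
  have hd := Finset.disjoint_left.1 hVT
  ext a b
  have e : ∀ a s : Finset Q, s ⊆ V → (Disjoint (a \ V ∪ s) T ↔ Disjoint a T) := by
    intro a s hs
    simp only [Finset.disjoint_left]
    grind
  refine krausMap_frame M ρ (DMC.slice T x y ρ) (f := fun a => a ∪ x) (g := fun b => b ∪ y)
    (m := fun a b => if Disjoint a T ∧ Disjoint b T then 1 else 0) ?_ ?_ ?_ ?_ ?_
    (fun _ _ => rfl) a b
  · intro a s hs; grind
  · intro a; grind
  · intro a s hs; grind
  · intro a; grind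
  · intro a b s t hs ht
    simp only [e a s hs, e b t ht]

lemma LocalOn.tensor {V R : Finset Q} (hVR : Disjoint V R) {L : Module.End ℂ (State Q)}
    (h : LocalOn V L) (ρ σ : State Q) : L (tensor ρ R σ) = tensor (L ρ) R σ := by
  obtain ⟨M, rfl⟩ := h
  have hd := Finset.disjoint_left.1 hVR
  have e : ∀ a s : Finset Q, s ⊆ V → (a \ V ∪ s) ∩ R = a ∩ R := by
    intro a s hs; grind
  ext a b
  refine (krausMap_frame M ρ (DMC.tensor ρ R σ) (f := fun a => a \ R) (g := fun a => a \ R)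
    (m := fun a b => σ (a ∩ R) (b ∩ R)) ?_ ?_ ?_ ?_ ?_
    (fun _ _ => mul_comm _ _) a b).trans (mul_comm _ _)
  · intro a s hs; grind
  · intro a; grind
  · intro a s hs; grind
  · intro a; grind
  · intro a b s t hs ht
    rw [e a s hs, e b t ht]

/-! ### Tensor products -/

/-- `ρ ↦ ρ ⊗ σ` as a linear map. -/
def tensorL (R : Finset Q) (σ : State Q) : Module.End ℂ (State Q) where
  toFun ρ := tensor ρ R σ
  map_add' ρ τ := by ext a b; simp [tensor, Matrix.add_apply, add_mul]
  map_smul' c ρ := by ext a b; simp [tensor, Matrix.smul_apply, mul_assoc]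

@[simp] lemma tensorL_apply (R : Finset Q) (ρ σ : State Q) : tensorL R σ ρ = tensor ρ R σ := rfl

/-- A composite network carries both resources as one tensor product. Regrouping lets the first
component consume its own resource while the other is still to be added. -/
lemma tensor_assoc {R₁ R₂ : Finset Q} (h : Disjoint R₁ R₂) (ρ σ₁ σ₂ : State Q) :
    tensor ρ (R₁ ∪ R₂) (tensor σ₁ R₂ σ₂) = tensor (tensor ρ R₁ σ₁) R₂ σ₂ := by
  have hd := Finset.disjoint_left.1 h
  ext a b
  have e1 : ∀ a : Finset Q, (a ∩ (R₁ ∪ R₂)) \ R₂ = (a \ R₂) ∩ R₁ := by intro a; grind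
  have e2 : ∀ a : Finset Q, a ∩ (R₁ ∪ R₂) ∩ R₂ = a ∩ R₂ := by intro a; grind
  have e3 : ∀ a : Finset Q, a \ (R₁ ∪ R₂) = (a \ R₂) \ R₁ := by intro a; grind
  simp only [tensor, e1, e2, e3]
  ring

lemma slice_tensor {T R x y : Finset Q} (h : Disjoint T R) (hx : x ⊆ T) (hy : y ⊆ T)
    (ρ σ : State Q) : slice T x y (tensor ρ R σ) = tensor (slice T x y ρ) R σ := by
  have hd := Finset.disjoint_left.1 h
  have e1 : ∀ a x : Finset Q, x ⊆ T → (a ∪ x) \ R = a \ R ∪ x := by intro a x hx; grind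
  have e2 : ∀ a x : Finset Q, x ⊆ T → (a ∪ x) ∩ R = a ∩ R := by intro a x hx; grind
  have e3 : ∀ a : Finset Q, Disjoint (a \ R) T ↔ Disjoint a T := by
    intro a
    simp only [Finset.disjoint_left]
    grind
  ext a b
  simp only [slice, tensor, e1 _ _ hx, e1 _ _ hy, e2 _ _ hx, e2 _ _ hy, e3]
  ring

/-! ### Supports -/

/-- `ρ` is an operator on the possibly infinite register `s`. -/
def SupportedIn (s : Set Q) (ρ : State Q) : Prop :=
  ∀ a b, ρ a b ≠ 0 → (a : Set Q) ⊆ s ∧ (b : Set Q) ⊆ s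

lemma supportedOn_iff {S : Finset Q} {ρ : State Q} :
    SupportedOn S ρ ↔ SupportedIn (S : Set Q) ρ := by
  simp [SupportedOn, SupportedIn]

lemma SupportedIn.mono {s t : Set Q} (h : s ⊆ t) {ρ : State Q} (hρ : SupportedIn s ρ) :
    SupportedIn t ρ := fun a b hab => ⟨(hρ a b hab).1.trans h, (hρ a b hab).2.trans h⟩

lemma SupportedOn.tensor {S R : Finset Q} {ρ : State Q} (hρ : SupportedOn S ρ)
    (σ : State Q) : SupportedOn (S ∪ R) (tensor ρ R σ) := by
  intro a b hab
  have h1 := hρ _ _ (left_ne_zero_of_mul hab)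
  constructor <;> grind

lemma SupportedOn.slice {S T x y : Finset Q} {ρ : State Q} (hρ : SupportedOn (S ∪ T) ρ) :
    SupportedOn S (slice T x y ρ) := by
  intro a b hab
  have h1 := hρ _ _ (right_ne_zero_of_mul hab)
  have h2 : Disjoint a T ∧ Disjoint b T := by
    by_contra hh
    simp [DMC.slice, hh] at hab
  have h3 : ∀ a x : Finset Q, a ∪ x ⊆ S ∪ T → Disjoint a T → a ⊆ S := by
    intro a x h h' q hq
    exact (Finset.mem_union.1 (h (Finset.mem_union_left x hq))).resolve_right
      (Finset.disjoint_left.1 h' hq)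
  exact ⟨h3 _ _ h1.1 h2.1, h3 _ _ h1.2 h2.2⟩

/-- Every entry of `ρ` is an entry of some block (`eq_slice`), so the blocks control the support. -/
lemma supportedOn_of_slice {S T : Finset Q} {ρ : State Q}
    (h : ∀ x y, x ⊆ T → y ⊆ T → SupportedOn S (slice T x y ρ)) : SupportedOn (S ∪ T) ρ := by
  intro a b hab
  rw [eq_slice T ρ a b] at hab
  have := h _ _ Finset.inter_subset_right Finset.inter_subset_right _ _ hab
  constructor <;> grind

lemma SupportedIn.zero (s : Set Q) : SupportedIn s (0 : State Q) := fun _ _ h => absurd rfl h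

lemma SupportedIn.add {s : Set Q} {ρ τ : State Q} (hρ : SupportedIn s ρ)
    (hτ : SupportedIn s τ) : SupportedIn s (ρ + τ) := by
  intro a b hab
  by_cases h : ρ a b = 0
  · exact hτ a b fun h' => hab (by simp [Matrix.add_apply, h, h'])
  · exact hρ a b h

end LocalOperators

end DMC

/-! ### Elementary operations: locality, positivity, trace; density operators span -/

namespace DMC

section Elementary

variable {Q : Type*} [DecidableEq Q]

/-! ### The elementary operations -/

/-- `prep` as a linear map. -/
noncomputable def prepL (W : Finset Q) : Module.End ℂ (State Q) where
  toFun := prep W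
  map_add' ρ τ := by ext a b; simp [prep, Matrix.add_apply, mul_add]
  map_smul' c ρ := by ext a b; simp [prep, Matrix.smul_apply, mul_left_comm]

/-- `applyCZ` as a linear map. -/
def czL (i j : Q) : Module.End ℂ (State Q) where
  toFun := applyCZ i j
  map_add' ρ τ := by ext a b; simp only [applyCZ, Matrix.add_apply]; ring
  map_smul' c ρ := by
    ext a b; simp only [applyCZ, Matrix.smul_apply, smul_eq_mul, RingHom.id_apply]; ring

/-- `applyX` as a linear map. -/
def pauliXL (i : Q) : Module.End ℂ (State Q) where
  toFun := applyX i
  map_add' ρ τ := by ext a b; simp [applyX, Matrix.add_apply]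
  map_smul' c ρ := by ext a b; simp [applyX, Matrix.smul_apply]

/-- `applyZ` as a linear map. -/
def pauliZL (i : Q) : Module.End ℂ (State Q) where
  toFun := applyZ i
  map_add' ρ τ := by ext a b; simp only [applyZ, Matrix.add_apply]; ring
  map_smul' c ρ := by
    ext a b; simp only [applyZ, Matrix.smul_apply, smul_eq_mul, RingHom.id_apply]; ring

/-- `project` as a linear map. -/
noncomputable def projectL (i : Q) (β : ℝ) (v : Bool) : Module.End ℂ (State Q) where
  toFun := project i β v
  map_add' ρ τ := by
    ext a b
    simp only [project, Matrix.add_apply]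
    split_ifs
    · simp
    · simp only [mul_add, add_mul, Finset.sum_add_distrib]
  map_smul' c ρ := by
    ext a b
    simp only [project, Matrix.smul_apply, smul_eq_mul, RingHom.id_apply]
    split_ifs
    · simp
    · simp only [Finset.mul_sum]
      exact Finset.sum_congr rfl fun _ _ => Finset.sum_congr rfl fun _ _ => by ring

@[simp] lemma prepL_apply (W : Finset Q) (ρ : State Q) : prepL W ρ = prep W ρ := rfl
@[simp] lemma czL_apply (i j : Q) (ρ : State Q) : czL i j ρ = applyCZ i j ρ := rfl
@[simp] lemma pauliXL_apply (i : Q) (ρ : State Q) : pauliXL i ρ = applyX i ρ := rfl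
@[simp] lemma pauliZL_apply (i : Q) (ρ : State Q) : pauliZL i ρ = applyZ i ρ := rfl
@[simp] lemma projectL_apply (i : Q) (β : ℝ) (v : Bool) (ρ : State Q) :
    projectL i β v ρ = project i β v ρ := rfl

lemma localOn_prepL (W : Finset Q) : LocalOn W (prepL W) := by
  -- A qubit outside the register reads as 0, so preparation maps the all-zero label of `W` to the
  -- uniform superposition. The amplitude `1/√2` occurs on both sides of `ρ`, which yields the
  -- factor `1/2` per qubit.
  refine ⟨fun a s => if s = (fun _ => ∅) a then (1 / (Real.sqrt 2 : ℂ)) ^ W.card else 0,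
    LinearMap.ext fun ρ => ?_⟩
  ext a b
  rw [krausMap_single (fun _ => ∅) _ fun _ _ => Finset.empty_subset _]
  have h : (Real.sqrt 2 : ℂ) * (Real.sqrt 2 : ℂ) = 2 := by
    rw [← Complex.ofReal_mul, Real.mul_self_sqrt (by norm_num)]; simp
  simp only [prepL_apply, prep, Finset.union_empty, map_pow, map_div₀, map_one, Complex.conj_ofReal]
  rw [mul_right_comm, ← mul_pow, div_mul_div_comm, h, one_mul]

lemma localOn_czL (i j : Q) : LocalOn {i, j} (czL i j) := by
  refine ⟨fun a s => if s = id a then (if i ∈ a ∧ j ∈ a then -1 else 1) else 0,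
    LinearMap.ext fun ρ => ?_⟩
  ext a b
  rw [krausMap_single id _ fun _ h => h]
  simp only [czL_apply, applyCZ, id_eq, Finset.sdiff_union_inter, Finset.mem_inter,
    Finset.mem_insert, Finset.mem_singleton, true_or, or_true, and_true]
  congr 1
  split_ifs <;> simp

lemma localOn_pauliXL (i : Q) : LocalOn {i} (pauliXL i) := by
  refine ⟨fun a s => if s = (fun a => symmDiff a {i}) a then (fun _ => 1) a else 0,
    LinearMap.ext fun ρ => ?_⟩
  ext a b
  rw [krausMap_single (fun a => symmDiff a {i}) _ fun a h => ?_]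
  · have e : ∀ a : Finset Q, a \ {i} ∪ symmDiff (a ∩ {i}) {i} = symmDiff a {i} := by
      intro a
      ext x
      simp only [Finset.mem_union, Finset.mem_sdiff, Finset.mem_symmDiff, Finset.mem_inter,
        Finset.mem_singleton]
      tauto
    simp [applyX, e]
  · intro x hx
    rcases Finset.mem_symmDiff.1 hx with h' | h'
    · exact h h'.1
    · exact h'.1

lemma localOn_pauliZL (i : Q) : LocalOn {i} (pauliZL i) := by
  refine ⟨fun a s => if s = id a then (if i ∈ a then -1 else 1) else 0, LinearMap.ext fun ρ => ?_⟩
  ext a b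
  rw [krausMap_single id _ fun _ h => h]
  simp only [pauliZL_apply, applyZ, id_eq, Finset.sdiff_union_inter, Finset.mem_inter,
    Finset.mem_singleton, and_true]
  congr 1
  split_ifs <;> simp

lemma localOn_projectL (i : Q) (β : ℝ) (v : Bool) : LocalOn {i} (projectL i β v) := by
  -- As a removed qubit reads as 0, the destructive projection is conjugation by `|0⟩⟨±_β|` on qubit
  -- `i`.
  refine ⟨fun a s => if i ∈ a then 0 else bra β v (decide (i ∈ s)), LinearMap.ext fun ρ => ?_⟩
  ext a b
  rw [krausMap_apply, projectL_apply]
  have hp : ({i} : Finset Q).powerset = {∅, {i}} := by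
    ext s; simp [Finset.subset_singleton_iff]
  have hne : (∅ : Finset Q) ≠ {i} := (Finset.singleton_ne_empty i).symm
  have e2 : ∀ a : Finset Q, a ∪ {i} = insert i a := fun a => by
    rw [Finset.union_comm, Finset.insert_eq]
  by_cases ha : i ∈ a
  · simp [project, ha]
  by_cases hb : i ∈ b
  · simp [project, hb]
  have e1 : ∀ a : Finset Q, i ∉ a → a \ {i} = a := fun a h => by
    rw [Finset.sdiff_singleton_eq_erase, Finset.erase_eq_of_notMem h]
  simp only [project, ha, hb, or_self, if_false, Finset.sum_product, hp,
    Finset.sum_pair hne, Fintype.sum_bool, setBit, Finset.mem_inter, false_and,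
    e1 a ha, e1 b hb, Finset.notMem_empty, decide_false, Finset.mem_singleton, decide_true,
    Finset.union_empty, Bool.false_eq_true, if_true, e2]
  ring

/-! ### Supports -/

lemma SupportedIn.prep {s : Set Q} {ρ : State Q} (h : SupportedIn s ρ) (W : Finset Q) :
    SupportedIn (s ∪ W) (prep W ρ) := by
  intro a b hab
  have h1 := h _ _ (right_ne_zero_of_mul hab)
  simp only [Finset.coe_sdiff, Set.sdiff_subset_iff] at h1
  rwa [Set.union_comm]

lemma SupportedIn.applyCZ {s : Set Q} {ρ : State Q} (h : SupportedIn s ρ) (i j : Q) :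
    SupportedIn s (applyCZ i j ρ) := fun _ _ hab =>
  h _ _ (right_ne_zero_of_mul (left_ne_zero_of_mul hab))

lemma SupportedIn.applyZ {s : Set Q} {ρ : State Q} (h : SupportedIn s ρ) (i : Q) :
    SupportedIn s (applyZ i ρ) := fun _ _ hab =>
  h _ _ (right_ne_zero_of_mul (left_ne_zero_of_mul hab))

lemma SupportedIn.applyX {s : Set Q} {ρ : State Q} (h : SupportedIn s ρ) {i : Q} (hi : i ∈ s) :
    SupportedIn s (applyX i ρ) := by
  intro a b hab
  have h1 := h _ _ hab
  have e : ∀ a : Finset Q, (↑(symmDiff a {i}) : Set Q) ⊆ s → (a : Set Q) ⊆ s := by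
    intro a ha x hx
    by_cases hxi : x = i
    · rwa [hxi]
    · exact ha (Finset.mem_coe.2 (Finset.mem_symmDiff.2
        (Or.inl ⟨hx, fun h => hxi (Finset.mem_singleton.1 h)⟩)))
  exact ⟨e a h1.1, e b h1.2⟩

lemma SupportedIn.project {s : Set Q} {ρ : State Q} (h : SupportedIn s ρ) (i : Q) (β : ℝ)
    (v : Bool) : SupportedIn (s \ {i}) (project i β v ρ) := by
  intro a b hab
  have hi : ¬(i ∈ a ∨ i ∈ b) := fun hi => hab (if_pos hi)
  have hab' : ∑ x : Bool, ∑ y : Bool,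
      bra β v x * ρ (setBit i x a) (setBit i y b) * (starRingEnd ℂ) (bra β v y) ≠ 0 := by
    rwa [DMC.project, if_neg hi] at hab
  obtain ⟨x, -, hx⟩ := Finset.exists_ne_zero_of_sum_ne_zero hab'
  obtain ⟨y, -, hy⟩ := Finset.exists_ne_zero_of_sum_ne_zero hx
  have h1 := h _ _ (right_ne_zero_of_mul (left_ne_zero_of_mul hy))
  have e : ∀ (x : Bool) (a : Finset Q), (↑(setBit i x a) : Set Q) ⊆ s → i ∉ a →
      (a : Set Q) ⊆ s \ {i} := by
    intro x a ha hia q hq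
    refine ⟨ha ?_, fun hqi => hia (by rwa [← Set.mem_singleton_iff.1 hqi])⟩
    cases x
    · exact hq
    · exact Finset.mem_coe.2 (Finset.mem_insert_of_mem hq)
  exact ⟨e x a h1.1 fun h => hi (Or.inl h), e y b h1.2 fun h => hi (Or.inr h)⟩

/-! ### Positivity -/

/-- Positivity over an infinite index type is tested on finitely supported vectors, and each of
these sees only a finite principal submatrix. -/
lemma posSemidef_of_submatrix {n : Type*} {M : Matrix n n ℂ}
    (h : ∀ F : Finset n, (M.submatrix ((↑) : F → n) ((↑) : F → n)).PosSemidef) :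
    M.PosSemidef := by
  classical
  refine ⟨?_, fun x => ?_⟩
  · ext i j
    have := (h {i, j}).1.apply ⟨i, by simp⟩ ⟨j, by simp⟩
    simpa using this
  · simpa [Finsupp.sum, ← Finset.sum_attach x.support, ← Finset.subtype_mem_eq_attach,
      ← Finsupp.subtypeDomain_apply, ← Finsupp.support_subtypeDomain] using (h x.support).2
        (x.subtypeDomain _)

/-- On finitely many rows `F`, the matrix `MρM†` equals `B ρ' B†`, where `ρ'` is `ρ` reindexed along
`e`. Repeated labels are harmless, since reindexing along any map keeps positivity. -/
lemma LocalOn.posSemidef {V : Finset Q} {L : Module.End ℂ (State Q)} (h : LocalOn V L)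
    {ρ : State Q} (hρ : ρ.PosSemidef) : (L ρ).PosSemidef := by
  obtain ⟨M, rfl⟩ := h
  refine posSemidef_of_submatrix fun F => ?_
  let e : F × V.powerset → Finset Q := fun p => p.1.1 \ V ∪ p.2.1
  let B : Matrix F (F × V.powerset) ℂ := Matrix.of fun a p => if p.1 = a then M (a.1 ∩ V) p.2.1 else 0
  have h1 := (hρ.submatrix e).mul_mul_conjTranspose_same B
  convert h1 using 1
  ext a b
  rw [Matrix.submatrix_apply, krausMap_apply, Finset.sum_product, Finset.sum_comm]
  simp only [Matrix.mul_apply, Fintype.sum_prod_type, Matrix.conjTranspose_apply, B, e,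
    Matrix.submatrix_apply, Matrix.of_apply, ite_mul, zero_mul, apply_ite star, star_zero,
    mul_ite, mul_zero, RCLike.star_def]
  simp only [Finset.sum_comm (t := (Finset.univ : Finset V.powerset)) (s := (Finset.univ : Finset F)),
    Finset.sum_ite_eq', Finset.mem_univ, if_true]
  rw [← Finset.sum_coe_sort V.powerset]
  refine Finset.sum_congr rfl fun t _ => ?_
  rw [Finset.sum_mul, ← Finset.sum_coe_sort V.powerset]

/-- In this encoding the tensor product is the entrywise product of two reindexed matrices, so the
Schur product theorem applies. -/
lemma posSemidef_tensor {ρ σ : State Q} (hρ : ρ.PosSemidef) (hσ : σ.PosSemidef) (R : Finset Q) :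
    (tensor ρ R σ).PosSemidef :=
  (hρ.submatrix fun a => a \ R).hadamard (hσ.submatrix fun a => a ∩ R)

/-! ### Traces -/

lemma tr_eq_sum {S : Finset Q} {ρ : State Q} (h : SupportedOn S ρ) :
    tr ρ = ∑ a ∈ S.powerset, ρ a a :=
  finsum_eq_sum_of_support_subset _ fun a ha => by
    simpa using (h a a ha).1

lemma tr_add {S : Finset Q} {ρ τ : State Q} (hρ : SupportedOn S ρ) (hτ : SupportedOn S τ) :
    tr (ρ + τ) = tr ρ + tr τ := by
  have := (supportedOn_iff.1 hρ).add (supportedOn_iff.1 hτ)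
  rw [tr_eq_sum hρ, tr_eq_sum hτ, tr_eq_sum (supportedOn_iff.2 this), ← Finset.sum_add_distrib]
  rfl

lemma tr_zero : tr (0 : State Q) = 0 := finsum_zero

lemma tr_smul {S : Finset Q} {ρ : State Q} (hρ : SupportedOn S ρ) (c : ℂ) :
    tr (c • ρ) = c * tr ρ := by
  have : SupportedOn S (c • ρ) := fun a b h => hρ a b (right_ne_zero_of_mul h)
  rw [tr_eq_sum hρ, tr_eq_sum this, Finset.mul_sum]
  rfl

lemma tr_nonneg {ρ : State Q} (h : ρ.PosSemidef) : 0 ≤ tr ρ :=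
  finsum_nonneg fun _ => h.diag_nonneg

lemma eq_zero_of_tr {S : Finset Q} {ρ : State Q} (hS : SupportedOn S ρ) (h : ρ.PosSemidef)
    (h0 : tr ρ = 0) : ρ = 0 := by
  have h1 := h.submatrix ((↑) : S.powerset → Finset Q)
  have h2 : (ρ.submatrix ((↑) : S.powerset → Finset Q) (↑)).trace = 0 := by
    rw [← h0, tr_eq_sum hS, ← Finset.sum_coe_sort]
    rfl
  rw [h1.trace_eq_zero_iff] at h2
  ext a b
  by_contra hab
  obtain ⟨ha, hb⟩ := hS a b hab
  exact hab (congrFun (congrFun h2 ⟨a, Finset.mem_powerset.2 ha⟩) ⟨b, Finset.mem_powerset.2 hb⟩)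

lemma tr_applyCZ (i j : Q) (ρ : State Q) : tr (applyCZ i j ρ) = tr ρ := by
  refine finsum_congr fun a => ?_
  simp only [applyCZ]
  split_ifs <;> simp

lemma tr_applyZ (i : Q) (ρ : State Q) : tr (applyZ i ρ) = tr ρ := by
  refine finsum_congr fun a => ?_
  simp only [applyZ]
  split_ifs <;> simp

lemma tr_applyX (i : Q) (ρ : State Q) : tr (applyX i ρ) = tr ρ :=
  finsum_comp_equiv (f := fun a => ρ a a)
    (Function.Involutive.toPerm (fun a : Finset Q => symmDiff a {i}) fun _ => symmDiff_symmDiff_cancel_right _ _)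

lemma sum_powerset_union {M : Type*} [AddCommMonoid M] {S R : Finset Q} (h : Disjoint S R)
    (f : Finset Q → M) : ∑ a ∈ (S ∪ R).powerset, f a =
      ∑ s ∈ S.powerset, ∑ r ∈ R.powerset, f (s ∪ r) := by
  have hd := Finset.disjoint_left.1 h
  rw [← Finset.sum_product']
  symm
  refine Finset.sum_bij' (fun p _ => p.1 ∪ p.2) (fun a _ => (a ∩ S, a ∩ R)) ?_ ?_ ?_ ?_ ?_
  · intro p hp
    simp only [Finset.mem_product, Finset.mem_powerset] at hp ⊢
    exact Finset.union_subset_union hp.1 hp.2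
  · intro a _
    simp
  · rintro ⟨s, r⟩ hp
    simp only [Finset.mem_product, Finset.mem_powerset] at hp
    simp only [Prod.mk.injEq]
    constructor <;> grind
  · intro a ha
    rw [Finset.mem_powerset] at ha
    rw [← Finset.inter_union_distrib_left, Finset.inter_eq_left.2 ha]
  · intro _ _; rfl

lemma tr_tensor {S R : Finset Q} (h : Disjoint S R) {ρ σ : State Q} (hρ : SupportedOn S ρ)
    (hσ : SupportedOn R σ) : tr (tensor ρ R σ) = tr ρ * tr σ := by
  have hd := Finset.disjoint_left.1 h
  rw [tr_eq_sum (hρ.tensor σ), tr_eq_sum hρ, tr_eq_sum hσ, sum_powerset_union h,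
    Finset.sum_mul_sum]
  refine Finset.sum_congr rfl fun s hs => Finset.sum_congr rfl fun r hr => ?_
  rw [Finset.mem_powerset] at hs hr
  have e1 : (s ∪ r) \ R = s := by grind
  have e2 : (s ∪ r) ∩ R = r := by grind
  simp only [tensor, e1, e2]

lemma tr_prep {S W : Finset Q} (h : Disjoint S W) {ρ : State Q} (hρ : SupportedOn S ρ) :
    tr (prep W ρ) = tr ρ := by
  have hd := Finset.disjoint_left.1 h
  have h1 : SupportedOn (S ∪ W) (prep W ρ) := by
    rw [supportedOn_iff, Finset.coe_union]
    exact (supportedOn_iff.1 hρ).prep W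
  rw [tr_eq_sum h1, tr_eq_sum hρ, sum_powerset_union h]
  refine Finset.sum_congr rfl fun s hs => ?_
  rw [Finset.mem_powerset] at hs
  have : ∀ r ∈ W.powerset, prep W ρ (s ∪ r) (s ∪ r) = (1 / 2 : ℂ) ^ W.card * ρ s s := by
    intro r hr
    rw [Finset.mem_powerset] at hr
    have e1 : (s ∪ r) \ W = s := by grind
    simp only [prep, e1]
  rw [Finset.sum_congr rfl this, Finset.sum_const, Finset.card_powerset, nsmul_eq_mul, ← mul_assoc]
  rw [Nat.cast_pow, ← mul_pow]
  simp

lemma IsDensityOn.tensor {S R : Finset Q} (h : Disjoint S R) {ρ σ : State Q}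
    (hρ : IsDensityOn S ρ) (hσ : IsDensityOn R σ) : IsDensityOn (S ∪ R) (tensor ρ R σ) where
  supported := hρ.supported.tensor σ
  posSemidef := posSemidef_tensor hρ.posSemidef hσ.posSemidef R
  trace_one := by rw [tr_tensor h hρ.supported hσ.supported, hρ.trace_one, hσ.trace_one, one_mul]

/-! ### Density operators span -/

/-- The operator `|ψ⟩⟨ψ|`. -/
def rankOne (ψ : Finset Q → ℂ) : State Q := fun a b => ψ a * (starRingEnd ℂ) (ψ b)

lemma posSemidef_rankOne (ψ : Finset Q → ℂ) : (rankOne ψ).PosSemidef :=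
  posSemidef_of_submatrix fun F => Matrix.posSemidef_vecMulVec_self_star fun a : F => ψ a

lemma rankOne_single_add (a b : Finset Q) (c : ℂ) :
    rankOne (Pi.single a 1 + c • Pi.single b 1) =
      Matrix.single a a 1 + (starRingEnd ℂ) c • Matrix.single a b 1 + c • Matrix.single b a 1 +
        (c * (starRingEnd ℂ) c) • Matrix.single b b (1 : ℂ) := by
  have e : ∀ x y u v : Finset Q, Matrix.single x y (1 : ℂ) u v =
      (Pi.single x 1 : Finset Q → ℂ) u * (Pi.single y 1 : Finset Q → ℂ) v := by
    intro x y u v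
    simp only [Matrix.single_apply, Pi.single_apply]
    split_ifs <;> simp_all
  have e2 : ∀ x u : Finset Q, (starRingEnd ℂ) ((Pi.single x 1 : Finset Q → ℂ) u) =
      (Pi.single x 1 : Finset Q → ℂ) u := by
    intro x u
    simp only [Pi.single_apply]
    split_ifs <;> simp
  ext u v
  simp only [rankOne, Matrix.add_apply, Matrix.smul_apply, e, Pi.add_apply, Pi.smul_apply,
    smul_eq_mul, map_add, map_mul, e2]
  ring

/-- Density operators span the operators on `S`. After normalisation the two maps agree on all
`|ψ⟩⟨ψ|`, and polarisation along `e_a + c e_b` reaches every matrix unit. -/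
lemma linearMap_eq_of_density {S : Finset Q} {f g : Module.End ℂ (State Q)}
    (h : ∀ ρ, IsDensityOn S ρ → f ρ = g ρ) {ρ : State Q} (hρ : SupportedOn S ρ) : f ρ = g ρ := by
  have h1 : ∀ ψ : Finset Q → ℂ, (∀ a, ψ a ≠ 0 → a ⊆ S) → (f - g) (rankOne ψ) = 0 := by
    intro ψ hψ
    have hs : SupportedOn S (rankOne ψ) := fun a b hab =>
      ⟨hψ a (left_ne_zero_of_mul hab), hψ b fun h0 => hab (by simp [rankOne, h0])⟩
    have hp := posSemidef_rankOne ψ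
    by_cases h0 : tr (rankOne ψ) = 0
    · rw [eq_zero_of_tr hs hp h0, map_zero]
    · have hd : IsDensityOn S ((tr (rankOne ψ))⁻¹ • rankOne ψ) :=
        ⟨fun a b hab => hs a b (right_ne_zero_of_mul hab),
          hp.smul (inv_nonneg_of_nonneg (tr_nonneg hp)),
          by rw [tr_smul hs, inv_mul_cancel₀ h0]⟩
      have := h _ hd
      rw [map_smul, map_smul] at this
      rw [LinearMap.sub_apply, sub_eq_zero]
      exact smul_right_injective _ (inv_ne_zero h0) this
  have h2 : ∀ a b, a ⊆ S → b ⊆ S → ∀ c : ℂ,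
      (f - g) (Matrix.single a a 1) + (starRingEnd ℂ) c • (f - g) (Matrix.single a b 1) +
        c • (f - g) (Matrix.single b a 1) +
        (c * (starRingEnd ℂ) c) • (f - g) (Matrix.single b b (1 : ℂ)) = 0 := by
    intro a b ha hb c
    rw [← h1 (Pi.single a 1 + c • Pi.single b 1), rankOne_single_add]
    · simp only [map_add, map_smul]
    · intro x hx
      by_cases hxa : x = a
      · rwa [hxa]
      · by_cases hxb : x = b
        · rwa [hxb]
        · simp [hxa, hxb] at hx
  have h3 : ∀ a, a ⊆ S → (f - g) (Matrix.single a a 1) = 0 := fun a ha => by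
    simpa using h2 a a ha ha 0
  have h4 : ∀ a b, a ⊆ S → b ⊆ S → (f - g) (Matrix.single a b 1) = 0 := by
    intro a b ha hb
    -- With the diagonal units gone, `c = 1` makes the images of the units `(a,b)` and `(b,a)`
    -- opposite and `c = i` makes them equal.
    have i1 := h2 a b ha hb 1
    have i2 := h2 a b ha hb Complex.I
    simp only [h3 a ha, h3 b hb, map_one, one_smul, Complex.conj_I, smul_zero, add_zero, zero_add,
      neg_smul] at i1 i2
    rw [neg_add_eq_zero] at i2
    have i3 := smul_right_injective _ Complex.I_ne_zero i2
    rw [← i3, ← two_smul ℂ] at i1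
    exact (smul_eq_zero.1 i1).resolve_left two_ne_zero
  have h5 : ρ = ∑ a ∈ S.powerset, ∑ b ∈ S.powerset, ρ a b • Matrix.single a b (1 : ℂ) := by
    ext u v
    simp only [Matrix.sum_apply, Matrix.smul_apply, Matrix.single_apply, smul_eq_mul, mul_ite,
      mul_one, mul_zero, ite_and, Finset.sum_ite_irrel, Finset.sum_const_zero, Finset.sum_ite_eq',
      Finset.mem_powerset]
    by_cases h0 : ρ u v = 0
    · simp [h0]
    · simp [(hρ u v h0).1, (hρ u v h0).2]
  rw [← sub_eq_zero, ← LinearMap.sub_apply, h5, map_sum]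
  refine Finset.sum_eq_zero fun a ha => ?_
  rw [map_sum]
  refine Finset.sum_eq_zero fun b hb => ?_
  rw [map_smul, h4 a b (Finset.mem_powerset.1 ha) (Finset.mem_powerset.1 hb), smul_zero]

end Elementary

end DMC

/-! ### Symbolic execution: separating the classical branching from the quantum state -/

namespace DMC

section Symbolic

variable {Q X K A : Type*} [DecidableEq Q] [DecidableEq X] [DecidableEq A]

/-! ### Executions that do not depend on the quantum state -/

/-- The results of a command on a memory, with the linear maps that they apply to the state. -/
noncomputable def Cmd.ops : Cmd Q X → Mem Q X → List (Mem Q X × Module.End ℂ (State Q))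
  | .entangle i j, Γ => [(Γ, czL i j)]
  | .corrX i s, Γ => [(Γ, if s.eval Γ then pauliXL i else 1)]
  | .corrZ i s, Γ => [(Γ, if s.eval Γ then pauliZL i else 1)]
  | .measure i α s t, Γ =>
      [false, true].map fun v =>
        (Function.update Γ (Sum.inl i) (some v), projectL i (angle α (s.eval Γ) (t.eval Γ)) v)

/-- The results of a command sequence on a memory, with the linear maps that they apply. -/
noncomputable def cmdsOps : List (Cmd Q X) → Mem Q X → List (Mem Q X × Module.End ℂ (State Q))
  | [], Γ => [(Γ, 1)]
  | C :: cs, Γ => (C.ops Γ).flatMap fun b => (cmdsOps cs b.1).map fun d => (d.1, d.2 * b.2)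

/-- Of the data of a result only the probability, a quotient of traces, depends nonlinearly on the
state. Dropping it leaves new memories and linear maps that are fixed by the old memory alone. -/
lemma Cmd.map_exec (C : Cmd Q X) (Γ : Mem Q X) (ρ : State Q) :
    (C.exec (Γ, ρ)).map Prod.snd = (C.ops Γ).map fun b => (b.1, b.2 ρ) := by
  cases C <;> simp [Cmd.exec, Cmd.ops, apply_ite (fun L : Module.End ℂ (State Q) => L ρ)]

lemma map_execCmds (cs : List (Cmd Q X)) (Γ : Mem Q X) (ρ : State Q) :
    (execCmds cs (Γ, ρ)).map Prod.snd = (cmdsOps cs Γ).map fun b => (b.1, b.2 ρ) := by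
  induction cs generalizing Γ ρ with
  | nil => simp [execCmds, cmdsOps]
  | cons C cs ih =>
    simp only [execCmds, cmdsOps, List.map_flatMap, List.map_map, Function.comp_def]
    have h : ∀ b : ℝ × (Mem Q X × State Q), (execCmds cs b.2).map (fun d => d.2) =
        (cmdsOps cs b.2.1).map fun d => (d.1, d.2 b.2.2) := fun b => ih b.2.1 b.2.2
    simp only [h]
    rw [← List.flatMap_map Prod.snd
      (fun c : Mem Q X × State Q => (cmdsOps cs c.1).map fun d => (d.1, d.2 c.2)),
      Cmd.map_exec, List.flatMap_map]
    rfl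

/-- The classical part of a configuration. -/
abbrev Sys (Q X K A : Type*) := A → AgentState Q X K A

/-- The action can fire; this does not depend on the quantum state. -/
def Ready (g : Sys Q X K A) (α : Action A) : Prop := Enabled ⟨g, 0⟩ α

lemma enabled_iff (c : Config Q X K A) (α : Action A) : Enabled c α ↔ Ready c.agent α := by
  cases α <;> rfl

/-- The results of an action, with the linear maps that they apply to the state. -/
noncomputable def steps (g : Sys Q X K A) :
    Action A → Multiset (Sys Q X K A × Module.End ℂ (State Q))
  | .loc a =>
      match (g a).prog with
      | .pat P :: r => ↑((cmdsOps P.cmds (g a).mem).map fun b =>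
          (Function.update g a ⟨Event.own (.pat P : Event Q X K A) (g a).own, b.1, r⟩,
            b.2 * prepL (P.V \ P.I)))
      | _ => 0
  | .comm a b =>
      match (g a).prog, (g b).prog with
      | .csend _ _ s :: r, .crecv _ _ x :: r' =>
          {(Function.update (Function.update g a ⟨(g a).own, (g a).mem, r⟩)
              b ⟨(g b).own, Function.update (g b).mem x (some (s.eval (g a).mem)), r'⟩, 1)}
      | .qsend _ _ q :: r, .qrecv _ _ _ :: r' =>
          {(Function.update (Function.update g a ⟨(g a).own \ {q}, (g a).mem, r⟩)
              b ⟨(g b).own ∪ {q}, (g b).mem, r'⟩, 1)}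
      | _, _ => 0

/-- The computation paths along a schedule, each with the linear map that it applies. -/
noncomputable def branches :
    List (Action A) → Sys Q X K A → Multiset (Sys Q X K A × Module.End ℂ (State Q))
  | [], g => {(g, 1)}
  | α :: l, g => (steps g α).bind fun b => (branches l b.1).map fun d => (d.1, d.2 * b.2)

lemma map_fire (c : Config Q X K A) (α : Action A) :
    (((fire c α).map Prod.snd : List _) : Multiset (Config Q X K A)) =
      (steps c.agent α).map fun b => ⟨b.1, b.2 c.state⟩ := by
  cases α with
  | loc a =>
    rcases h : (c.agent a).prog with _ | ⟨P | _ | _ | _ | _, r⟩ <;> simp only [fire, steps, h]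
    case cons.pat =>
      have h := congrArg (List.map fun d : Mem Q X × State Q =>
        (⟨Function.update c.agent a
          ⟨Event.own (.pat P : Event Q X K A) (c.agent a).own, d.1, r⟩, d.2⟩ : Config Q X K A))
        (map_execCmds P.cmds (c.agent a).mem (prep (P.V \ P.I) c.state))
      simp only [List.map_map, Function.comp_def] at h
      simp only [List.map_map, Multiset.map_coe, Function.comp_def]
      rw [h]
      rfl
    all_goals rfl
  | comm a b =>
    rcases h : (c.agent a).prog with _ | ⟨_ | _ | _ | _ | _, r⟩ <;>
      rcases h' : (c.agent b).prog with _ | ⟨_ | _ | _ | _ | _, r'⟩ <;>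
      simp only [fire, steps, h, h'] <;> rfl

/-- Multisets replace lists because reordering a schedule permutes its computation paths. -/
lemma map_run (l : List (Action A)) (c : Config Q X K A) :
    (((run l c).map Prod.snd : List _) : Multiset (Config Q X K A)) =
      (branches l c.agent).map fun b => ⟨b.1, b.2 c.state⟩ := by
  induction l generalizing c with
  | nil => simp [run, branches]
  | cons α l ih =>
    simp only [run, branches, List.map_flatMap, List.map_map, Function.comp_def, Multiset.map_bind,
      Multiset.map_map]
    rw [← List.flatMap_map Prod.snd (fun c : Config Q X K A => (run l c).map fun d => d.2),
      ← Multiset.coe_bind, map_fire, Multiset.bind_map]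
    refine Multiset.bind_congr fun b _ => ?_
    exact ih _

/-- All computation paths from `g` along the schedule are free of errors and end in a state with
the property `fin`. -/
def Compl (fin : Sys Q X K A → Prop) : List (Action A) → Sys Q X K A → Prop
  | [], g => fin g
  | α :: l, g => Ready g α ∧ ∀ b ∈ steps g α, Compl fin l b.1

/-- All event sequences are empty and all classical outputs have a value. -/
def Network.Final (N : Network Q X K A) (g : Sys Q X K A) : Prop :=
  ∀ a, (g a).prog = [] ∧ ↑(N.agent a).cout ⊆ bound (g a).mem

/-- Freedom from errors is a purely classical property, so schedulability need only be checked for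
each classical input. -/
lemma Network.completes_iff (N : Network Q X K A) (l : List (Action A)) (c : Config Q X K A) :
    N.Completes l c ↔ Compl N.Final l c.agent := by
  induction l generalizing c with
  | nil => rfl
  | cons α l ih =>
    have h : (∀ b ∈ fire c α, N.Completes l b.2) ↔ ∀ b ∈ steps c.agent α, Compl N.Final l b.1 := by
      have h1 : (∀ b ∈ fire c α, N.Completes l b.2) ↔
          ∀ d ∈ (((fire c α).map Prod.snd : List _) : Multiset (Config Q X K A)),
            N.Completes l d := by
        simp only [Multiset.mem_coe, List.mem_map, forall_exists_index, and_imp,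
          forall_apply_eq_imp_iff₂]
      rw [h1, map_fire]
      simp only [Multiset.mem_map, forall_exists_index, and_imp, forall_apply_eq_imp_iff₂, ih]
    rw [Network.Completes, Compl, enabled_iff, h]

/-- The initial state of the agents. -/
def Network.sys (N : Network Q X K A) (u : Val Q X A) : Sys Q X K A :=
  fun a => ⟨(N.agent a).own, u a, (N.agent a).prog⟩

lemma Network.isSchedule_iff (N : Network Q X K A) (l : List (Action A)) :
    N.IsSchedule l ↔ ∀ u, N.IsInput u → Compl N.Final l (N.sys u) := by
  simp only [Network.IsSchedule, Network.completes_iff]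
  exact ⟨fun h u hu => h u 0 hu, fun h u _ hu => h u hu⟩

lemma Compl.mono {fin fin' : Sys Q X K A → Prop} (h : ∀ g, fin g → fin' g) {l : List (Action A)}
    {g : Sys Q X K A} (hg : Compl fin l g) : Compl fin' l g := by
  induction l generalizing g with
  | nil => exact h g hg
  | cons α l ih => exact ⟨hg.1, fun b hb => ih (hg.2 b hb)⟩

lemma compl_append (fin : Sys Q X K A → Prop) (l l' : List (Action A)) (g : Sys Q X K A) :
    Compl fin (l ++ l') g ↔ Compl (Compl fin l') l g := by
  induction l generalizing g with
  | nil => rfl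
  | cons α l ih => simp only [List.cons_append, Compl, ih]

lemma branches_append (l l' : List (Action A)) (g : Sys Q X K A) :
    branches (l ++ l') g =
      (branches l g).bind fun b => (branches l' b.1).map fun d => (d.1, d.2 * b.2) := by
  induction l generalizing g with
  | nil => simp [branches]
  | cons α l ih =>
    simp only [List.cons_append, branches, ih, Multiset.bind_assoc, Multiset.map_bind,
      Multiset.map_map, Multiset.bind_map, Function.comp_def, mul_assoc]

lemma Compl.final {fin : Sys Q X K A → Prop} {l : List (Action A)} {g : Sys Q X K A}
    (h : Compl fin l g) {b : Sys Q X K A × Module.End ℂ (State Q)} (hb : b ∈ branches l g) :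
    fin b.1 := by
  induction l generalizing g b with
  | nil =>
    rw [branches, Multiset.mem_singleton] at hb
    rw [hb]
    exact h
  | cons α l ih =>
    simp only [branches, Multiset.mem_bind, Multiset.mem_map] at hb
    obtain ⟨p, hp, d, hd, rfl⟩ := hb
    exact ih (b := d) (h.2 p hp) hd

/-- Invariants of steps are invariants of complete runs. -/
lemma Compl.invariant {fin : Sys Q X K A → Prop} (I : Sys Q X K A → Module.End ℂ (State Q) → Prop)
    (hI : ∀ g L α, Ready g α → I g L → ∀ b ∈ steps g α, I b.1 (b.2 * L))
    {l : List (Action A)} {g : Sys Q X K A} {L : Module.End ℂ (State Q)} (h : Compl fin l g)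
    (hg : I g L) {b : Sys Q X K A × Module.End ℂ (State Q)} (hb : b ∈ branches l g) :
    I b.1 (b.2 * L) := by
  induction l generalizing g b L with
  | nil =>
    rw [branches, Multiset.mem_singleton] at hb
    rw [hb]
    simpa using hg
  | cons α l ih =>
    simp only [branches, Multiset.mem_bind, Multiset.mem_map] at hb
    obtain ⟨p, hp, d, hd, rfl⟩ := hb
    rw [mul_assoc]
    exact ih (b := d) (h.2 p hp) (hI g L α h.1 hg p hp) hd

end Symbolic

end DMC

/-! ### Single actions, their invariants, and independence of the schedule -/

namespace DMC

section Steps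

variable {Q X K A : Type*} [DecidableEq Q] [DecidableEq X] [DecidableEq A]

/-! ### Command sequences -/

lemma Signal.Known.mono {s : Signal Q X} {k k' : Set (CName Q X)} (h : k ⊆ k') (hs : s.Known k) :
    s.Known k' := by
  induction s with
  | const v => trivial
  | name x => exact h hs
  | add s t ihs iht => exact ⟨ihs hs.1, iht hs.2⟩

lemma CmdsDefinite.mono {O : Finset Q} {cs : List (Cmd Q X)} {live : Finset Q}
    {k k' : Set (CName Q X)} (hk : k ⊆ k') (h : CmdsDefinite O cs live k) :
    CmdsDefinite O cs live k' := by
  induction cs generalizing live k k' with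
  | nil => exact h
  | cons C cs ih =>
    cases C with
    | entangle i j => exact ⟨h.1, h.2.1, h.2.2.1, ih hk h.2.2.2⟩
    | measure i α s t =>
      exact ⟨h.1, h.2.1.mono hk, h.2.2.1.mono hk, ih (Set.insert_subset_insert hk) h.2.2.2⟩
    | corrX i s => exact ⟨h.1, h.2.1.mono hk, ih hk h.2.2⟩
    | corrZ i s => exact ⟨h.1, h.2.1.mono hk, ih hk h.2.2⟩

lemma CmdsDefinite.subset {O : Finset Q} {cs : List (Cmd Q X)} {live : Finset Q}
    {k : Set (CName Q X)} (h : CmdsDefinite O cs live k) : O ⊆ live := by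
  induction cs generalizing live k with
  | nil => exact h.symm.subset
  | cons C cs ih =>
    cases C with
    | entangle i j => exact ih h.2.2.2
    | measure i α s t => exact (ih h.2.2.2).trans (Finset.erase_subset _ _)
    | corrX i s => exact ih h.2.2
    | corrZ i s => exact ih h.2.2

lemma cmdsOps_localOn {O : Finset Q} {cs : List (Cmd Q X)} {live : Finset Q}
    {k : Set (CName Q X)} (h : CmdsDefinite O cs live k) {Γ : Mem Q X}
    {b : Mem Q X × Module.End ℂ (State Q)} (hb : b ∈ cmdsOps cs Γ) : LocalOn live b.2 := by
  induction cs generalizing live k Γ b with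
  | nil =>
    rw [cmdsOps, List.mem_singleton] at hb
    rw [hb]
    exact LocalOn.one _
  | cons C cs ih =>
    simp only [cmdsOps, List.mem_flatMap, List.mem_map] at hb
    obtain ⟨c, hc, d, hd, rfl⟩ := hb
    cases C with
    | entangle i j =>
      rw [Cmd.ops, List.mem_singleton] at hc
      subst hc
      exact (ih h.2.2.2 hd).mul ((localOn_czL i j).mono (by
        intro x hx
        rcases Finset.mem_insert.1 hx with rfl | hx
        · exact h.1
        · rw [Finset.mem_singleton.1 hx]; exact h.2.1))
    | measure i α s t =>
      simp only [Cmd.ops, List.mem_map] at hc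
      obtain ⟨v, _, rfl⟩ := hc
      exact ((ih h.2.2.2 hd).mono (Finset.erase_subset _ _)).mul
        ((localOn_projectL i _ v).mono (Finset.singleton_subset_iff.2 h.1))
    | corrX i s =>
      rw [Cmd.ops, List.mem_singleton] at hc
      subst hc
      refine (ih h.2.2 hd).mul ?_
      dsimp only
      split_ifs
      · exact (localOn_pauliXL i).mono (Finset.singleton_subset_iff.2 h.1)
      · exact LocalOn.one _
    | corrZ i s =>
      rw [Cmd.ops, List.mem_singleton] at hc
      subst hc
      refine (ih h.2.2 hd).mul ?_
      dsimp only
      split_ifs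
      · exact (localOn_pauliZL i).mono (Finset.singleton_subset_iff.2 h.1)
      · exact LocalOn.one _

/-- A measurement removes its qubit from the support just as it removes it from `live`, which ends
as `O`. The set `s` stands for the qubits in the rest of the system. -/
lemma cmdsOps_supportedIn {O : Finset Q} {cs : List (Cmd Q X)} {live : Finset Q}
    {k : Set (CName Q X)} (h : CmdsDefinite O cs live k) {Γ : Mem Q X}
    {b : Mem Q X × Module.End ℂ (State Q)} (hb : b ∈ cmdsOps cs Γ) {s : Set Q} {ρ : State Q}
    (hρ : SupportedIn (s ∪ live) ρ) : SupportedIn (s ∪ O) (b.2 ρ) := by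
  induction cs generalizing live k Γ b ρ with
  | nil =>
    rw [cmdsOps, List.mem_singleton] at hb
    rw [hb, ← show live = O from h]
    exact hρ
  | cons C cs ih =>
    simp only [cmdsOps, List.mem_flatMap, List.mem_map] at hb
    obtain ⟨c, hc, d, hd, rfl⟩ := hb
    rw [Module.End.mul_apply]
    cases C with
    | entangle i j =>
      rw [Cmd.ops, List.mem_singleton] at hc
      subst hc
      exact ih (b := d) h.2.2.2 hd (hρ.applyCZ i j)
    | measure i α s' t =>
      simp only [Cmd.ops, List.mem_map] at hc
      obtain ⟨v, _, rfl⟩ := hc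
      refine ih (b := d) h.2.2.2 hd ((hρ.project i _ v).mono ?_)
      rintro q ⟨hq, hqi⟩
      rcases hq with hq | hq
      · exact Or.inl hq
      · exact Or.inr (Finset.mem_coe.2 (Finset.mem_erase.2 ⟨hqi, hq⟩))
    | corrX i s' =>
      rw [Cmd.ops, List.mem_singleton] at hc
      subst hc
      refine ih (b := d) h.2.2 hd ?_
      dsimp only
      split_ifs
      · exact hρ.applyX (Or.inr h.1)
      · exact hρ
    | corrZ i s' =>
      rw [Cmd.ops, List.mem_singleton] at hc
      subst hc
      refine ih (b := d) h.2.2 hd ?_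
      dsimp only
      split_ifs
      · exact hρ.applyZ i
      · exact hρ

/-! ### Actions -/

/-- The agents that take part in an action. -/
def Action.agents : Action A → Finset A
  | .loc a => {a}
  | .comm a b => {a, b}

/-- The action that executes an event of the agent `a`. -/
def Event.action (a : A) : Event Q X K A → Action A
  | .pat _ => .loc a
  | .csend b _ _ => .comm a b
  | .crecv b _ _ => .comm b a
  | .qsend b _ _ => .comm a b
  | .qrecv b _ _ => .comm b a

/-- The three kinds of actions that can fire. -/
lemma Ready.elim {g : Sys Q X K A} {α : Action A} (h : Ready g α) {motive : Prop}
    (hpat : ∀ a P r, α = .loc a → (g a).prog = .pat P :: r → P.I ⊆ (g a).own →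
      P.Definite (bound (g a).mem) →
      steps g α = ↑((cmdsOps P.cmds (g a).mem).map fun b =>
          (Function.update g a ⟨((g a).own \ P.I) ∪ P.O, b.1, r⟩,
            b.2 * prepL (P.V \ P.I))) → motive)
    (hc : ∀ a b k s x r r', α = .comm a b → a ≠ b → (g a).prog = .csend b k s :: r →
      (g b).prog = .crecv a k x :: r' → s.Known (bound (g a).mem) →
      steps g α = {(Function.update (Function.update g a ⟨(g a).own, (g a).mem, r⟩)
              b ⟨(g b).own, Function.update (g b).mem x (some (s.eval (g a).mem)), r'⟩, 1)} →
      motive)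
    (hq : ∀ a b k q r r', α = .comm a b → a ≠ b → (g a).prog = .qsend b k q :: r →
      (g b).prog = .qrecv a k q :: r' → q ∈ (g a).own →
      steps g α = {(Function.update (Function.update g a ⟨(g a).own \ {q}, (g a).mem, r⟩)
              b ⟨(g b).own ∪ {q}, (g b).mem, r'⟩, 1)} → motive) : motive := by
  cases α with
  | loc a =>
    obtain ⟨P, r, h1, h2, h3⟩ := h
    refine hpat a P r rfl h1 h2 h3 ?_
    simp only [steps]
    rw [show (g a).prog = _ from h1]
    rfl
  | comm a b =>
    rcases h with ⟨k, s, x, r, r', h1, h2, h3⟩ | ⟨k, q, r, r', h1, h2, h3⟩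
    · refine hc a b k s x r r' rfl ?_ h1 h2 h3 ?_
      · rintro rfl
        simp [show (g a).prog = _ from h1] at h2
      · simp only [steps]
        rw [show (g a).prog = _ from h1, show (g b).prog = _ from h2]
    · refine hq a b k q r r' rfl ?_ h1 h2 h3 ?_
      · rintro rfl
        simp [show (g a).prog = _ from h1] at h2
      · simp only [steps]
        rw [show (g a).prog = _ from h1, show (g b).prog = _ from h2]

/-- A communication event names its partner, so the next event of any one participant determines the
whole action. This is why different ready actions cannot share an agent. -/
lemma Ready.head {g : Sys Q X K A} {α : Action A} (h : Ready g α) {a : A} (ha : a ∈ α.agents) :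
    ∃ e r, (g a).prog = e :: r ∧ e.action a = α := by
  refine h.elim ?_ ?_ ?_
  · rintro b P r rfl h1 - - -
    rw [Finset.mem_singleton.1 ha]
    exact ⟨_, _, h1, rfl⟩
  · rintro b c k s x r r' rfl - h1 h2 - -
    rcases Finset.mem_insert.1 ha with rfl | ha
    · exact ⟨_, _, h1, rfl⟩
    · rw [Finset.mem_singleton.1 ha]
      exact ⟨_, _, h2, rfl⟩
  · rintro b c k q r r' rfl - h1 h2 - -
    rcases Finset.mem_insert.1 ha with rfl | ha
    · exact ⟨_, _, h1, rfl⟩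
    · rw [Finset.mem_singleton.1 ha]
      exact ⟨_, _, h2, rfl⟩

lemma Action.agents_nonempty (α : Action A) : α.agents.Nonempty := by
  cases α <;> simp [Action.agents]

lemma Ready.disjoint {g : Sys Q X K A} {α β : Action A} (h : Ready g α) (h' : Ready g β)
    (hne : α ≠ β) : Disjoint α.agents β.agents := by
  rw [Finset.disjoint_left]
  intro a ha hb
  obtain ⟨e, r, h1, rfl⟩ := h.head ha
  obtain ⟨e', r', h2, rfl⟩ := h'.head hb
  rw [h1, List.cons.injEq] at h2
  exact hne (by rw [h2.1])

lemma Ready.congr {g g' : Sys Q X K A} {α : Action A} (h : Ready g α)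
    (hg : ∀ a ∈ α.agents, g' a = g a) : Ready g' α := by
  cases α with
  | loc a =>
    have := hg a (by simp [Action.agents])
    simpa only [Ready, Enabled, this] using h
  | comm a b =>
    have h1 := hg a (by simp [Action.agents])
    have h2 := hg b (by simp [Action.agents])
    simpa only [Ready, Enabled, h1, h2] using h

/-- An action reads and changes only its participants: its results in another system that agrees
there are obtained by grafting. -/
lemma steps_congr {g g' : Sys Q X K A} {α : Action A} (hg : ∀ a ∈ α.agents, g' a = g a) :
    steps g' α = (steps g α).map fun p => (fun x => if x ∈ α.agents then p.1 x else g' x, p.2) := by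
  cases α with
  | loc a =>
    have h1 := hg a (by simp [Action.agents])
    simp only [steps, h1]
    rcases h : (g a).prog with _ | ⟨P | _ | _ | _ | _, r⟩
    case cons.pat =>
      simp only [Multiset.map_coe, List.map_map, Function.comp_def]
      congr 1
      refine List.map_congr_left fun b _ => ?_
      congr 1
      ext1 x
      by_cases hx : x = a
      · subst hx; simp [Action.agents]
      · simp [hx, Action.agents]
    all_goals rfl
  | comm a b =>
    have h1 := hg a (by simp [Action.agents])
    have h2 := hg b (by simp [Action.agents])
    have key : ∀ s t : AgentState Q X K A, Function.update (Function.update g' a s) b t =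
        fun x => if x ∈ (Action.comm a b).agents then
          (Function.update (Function.update g a s) b t) x else g' x := by
      intro s t
      ext1 x
      by_cases hx : x = b
      · subst hx; simp [Action.agents]
      · by_cases hx' : x = a
        · subst hx'; simp [Action.agents, Function.update_of_ne hx]
        · simp [hx, hx', Action.agents]
    simp only [steps, h1, h2]
    rcases h : (g a).prog with _ | ⟨_ | _ | _ | _ | _, r⟩ <;>
      rcases h' : (g b).prog with _ | ⟨_ | _ | _ | _ | _, r'⟩ <;>
      first
      | rfl
      | (simp only [key, Multiset.map_singleton])

lemma steps_of_notMem {g : Sys Q X K A} {α : Action A} {p : Sys Q X K A × Module.End ℂ (State Q)}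
    (hp : p ∈ steps g α) {x : A} (hx : x ∉ α.agents) : p.1 x = g x := by
  rw [steps_congr (g := g) (g' := g) fun _ _ => rfl, Multiset.mem_map] at hp
  obtain ⟨q, _, rfl⟩ := hp
  simp [hx]

/-! ### Invariants -/

/-- The qubits that an agent owns or will introduce. -/
def ledger (s : AgentState Q X K A) : Multiset Q := s.own.val + (s.prog.map Event.working).sum

/-- No qubit is owned or introduced twice. -/
def Unique (g : Sys Q X K A) : Prop :=
  (∀ a, (ledger (g a)).Nodup) ∧ ∀ a b q, a ≠ b → q ∈ ledger (g a) → q ∉ ledger (g b)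

lemma mem_ledger {s : AgentState Q X K A} {q : Q} :
    q ∈ ledger s ↔ q ∈ s.own ∨ q ∈ (s.prog.map Event.working).sum := by
  simp [ledger]

lemma nodup_ledger {s : AgentState Q X K A} : (ledger s).Nodup ↔
    (s.prog.map Event.working).sum.Nodup ∧ ∀ q ∈ s.own, q ∉ (s.prog.map Event.working).sum := by
  rw [ledger, Multiset.nodup_add, Multiset.disjoint_left]
  simp [s.own.nodup]

/-- The ledger counts present and future qubits together. A pattern moves working qubits from the
future to the present and drops measured ones; a transfer moves one qubit from one ledger to
another. Nothing is ever duplicated. -/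
lemma Unique.step {g : Sys Q X K A} (hg : Unique g) {α : Action A} (h : Ready g α)
    {p : Sys Q X K A × Module.End ℂ (State Q)} (hp : p ∈ steps g α) : Unique p.1 := by
  refine h.elim ?_ ?_ ?_
  · rintro a P r rfl h1 h2 h3 h4
    rw [h4] at hp
    simp only [Multiset.mem_coe, List.mem_map] at hp
    obtain ⟨b, _, rfl⟩ := hp
    have hO := h3.2.subset
    have hn := nodup_ledger.1 (hg.1 a)
    simp only [h1, List.map_cons, List.sum_cons, Event.working, Multiset.nodup_add,
      Multiset.disjoint_left, Multiset.mem_add, Finset.mem_val, Finset.mem_sdiff] at hn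
    have hsub : ∀ q, q ∈ ledger (⟨((g a).own \ P.I) ∪ P.O, b.1, r⟩ : AgentState Q X K A) →
        q ∈ ledger (g a) := by
      intro q hq
      simp only [mem_ledger, h1, List.map_cons, List.sum_cons, Event.working, Multiset.mem_add,
        Finset.mem_val, Finset.mem_sdiff, Finset.mem_union] at hq ⊢
      have := @hO q
      have := @h2 q
      tauto
    refine ⟨fun c => ?_, fun c d q hcd hc hd => ?_⟩
    · by_cases hc : c = a
      · subst hc
        simp only [Function.update_self]
        rw [nodup_ledger]
        refine ⟨hn.1.2.1, fun q hq hq' => ?_⟩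
        simp only [Finset.mem_union, Finset.mem_sdiff] at hq
        rcases hq with hq | hq
        · exact hn.2 q hq.1 (Or.inr hq')
        · by_cases hI : q ∈ P.I
          · exact hn.2 q (h2 hI) (Or.inr hq')
          · exact hn.1.2.2 ⟨hO hq, hI⟩ hq'
      · simpa only [Function.update_of_ne hc] using hg.1 c
    · refine hg.2 c d q hcd ?_ ?_
      · by_cases h : c = a
        · subst h; simp only [Function.update_self] at hc; exact hsub q hc
        · simpa only [Function.update_of_ne h] using hc
      · by_cases h : d = a
        · subst h; simp only [Function.update_self] at hd; exact hsub q hd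
        · simpa only [Function.update_of_ne h] using hd
  · rintro a b k s x r r' rfl hab h1 h2 - h4
    rw [h4, Multiset.mem_singleton] at hp
    subst hp
    have key : ∀ c, ledger (Function.update (Function.update g a ⟨(g a).own, (g a).mem, r⟩)
        b ⟨(g b).own, Function.update (g b).mem x (some (s.eval (g a).mem)), r'⟩ c) =
        ledger (g c) := by
      intro c
      by_cases hcb : c = b
      · subst hcb; simp [ledger, h2, Event.working]
      · rw [Function.update_of_ne hcb]
        by_cases hca : c = a
        · subst hca; simp [ledger, h1, Event.working]
        · rw [Function.update_of_ne hca]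
    simpa only [Unique, key] using hg
  · rintro a b k q r r' rfl hab h1 h2 h3 h4
    rw [h4, Multiset.mem_singleton] at hp
    subst hp
    have hqa : q ∈ ledger (g a) := mem_ledger.2 (Or.inl h3)
    have hqb := hg.2 a b q hab hqa
    have hna := nodup_ledger.1 (hg.1 a)
    have hnb := nodup_ledger.1 (hg.1 b)
    simp only [h1, List.map_cons, List.sum_cons, Event.working, zero_add] at hna
    simp only [h2, List.map_cons, List.sum_cons, Event.working, zero_add] at hnb
    simp only [mem_ledger, h2, List.map_cons, List.sum_cons, Event.working, zero_add,
      not_or] at hqb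
    have mem_a : ∀ x, x ∈ ledger (⟨(g a).own \ {q}, (g a).mem, r⟩ : AgentState Q X K A) →
        x ∈ ledger (g a) ∧ x ≠ q := by
      intro x hx
      simp only [mem_ledger, h1, List.map_cons, List.sum_cons, Event.working, zero_add,
        Finset.mem_sdiff, Finset.mem_singleton] at hx ⊢
      refine ⟨hx.imp_left And.left, ?_⟩
      rintro rfl
      exact hx.elim (fun h => h.2 rfl) fun h => hna.2 _ h3 h
    have mem_b : ∀ x, x ∈ ledger (⟨(g b).own ∪ {q}, (g b).mem, r'⟩ : AgentState Q X K A) →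
        x ∈ ledger (g b) ∨ x = q := by
      intro x hx
      simp only [mem_ledger, h2, List.map_cons, List.sum_cons, Event.working, zero_add,
        Finset.mem_union, Finset.mem_singleton] at hx ⊢
      tauto
    -- After the transfer `q` occurs in the ledger of the receiver only, and no other entry is new.
    have key : ∀ c x, x ∈ ledger (Function.update (Function.update g a
        ⟨(g a).own \ {q}, (g a).mem, r⟩) b ⟨(g b).own ∪ {q}, (g b).mem, r'⟩ c) →
        (x ∈ ledger (g c) ∧ x ≠ q) ∨ (c = b ∧ x = q) := by
      intro c x hx
      by_cases hcb : c = b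
      · subst hcb
        rw [Function.update_self] at hx
        by_cases hxq : x = q
        · exact Or.inr ⟨rfl, hxq⟩
        · exact Or.inl ⟨(mem_b x hx).resolve_right hxq, hxq⟩
      · rw [Function.update_of_ne hcb] at hx
        by_cases hca : c = a
        · subst hca
          rw [Function.update_self] at hx
          exact Or.inl (mem_a x hx)
        · rw [Function.update_of_ne hca] at hx
          exact Or.inl ⟨hx, fun h => hg.2 a c q (Ne.symm hca) hqa (h ▸ hx)⟩
    refine ⟨fun c => ?_, fun c d x hcd hc hd => ?_⟩
    · by_cases hcb : c = b
      · subst hcb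
        simp only [Function.update_self]
        rw [nodup_ledger]
        refine ⟨hnb.1, fun x hx => ?_⟩
        rcases Finset.mem_union.1 hx with hx | hx
        · exact hnb.2 x hx
        · rw [Finset.mem_singleton.1 hx]
          exact hqb.2
      · simp only [Function.update_of_ne hcb]
        by_cases hca : c = a
        · subst hca
          simp only [Function.update_self]
          rw [nodup_ledger]
          exact ⟨hna.1, fun x hx => hna.2 x (Finset.mem_sdiff.1 hx).1⟩
        · simpa only [Function.update_of_ne hca] using hg.1 c
    · rcases key c x hc with ⟨hc, hxq⟩ | ⟨rfl, rfl⟩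
      · rcases key d x hd with ⟨hd, -⟩ | ⟨-, h⟩
        · exact hg.2 c d x hcd hc hd
        · exact hxq h
      · rcases key d x hd with ⟨-, h⟩ | ⟨h, -⟩
        · exact h rfl
        · exact hcd h.symm

/-- The register is located in two ways: through the ledgers, which makes concurrent actions act on
disjoint qubits, and through the event names, which confines a whole run to the names of the
network. -/
lemma steps_localOn {g : Sys Q X K A} {α : Action A} (h : Ready g α)
    {p : Sys Q X K A × Module.End ℂ (State Q)} (hp : p ∈ steps g α) :
    ∃ V, LocalOn V p.2 ∧ ∀ q ∈ V, ∃ a ∈ α.agents, q ∈ ledger (g a) ∧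
      ∃ e ∈ (g a).prog, q ∈ e.qnames := by
  refine h.elim ?_ ?_ ?_
  · rintro a P r rfl h1 h2 h3 h4
    rw [h4] at hp
    simp only [Multiset.mem_coe, List.mem_map] at hp
    obtain ⟨b, hb, rfl⟩ := hp
    refine ⟨P.V, (cmdsOps_localOn h3.2 hb).mul ((localOn_prepL _).mono Finset.sdiff_subset),
      fun q hq => ⟨a, by simp [Action.agents], ?_, .pat P, by simp [h1], by simp [Event.qnames, hq]⟩⟩
    simp only [mem_ledger, h1, List.map_cons, List.sum_cons, Event.working, Multiset.mem_add,
      Finset.mem_val, Finset.mem_sdiff]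
    by_cases hI : q ∈ P.I
    · exact Or.inl (h2 hI)
    · exact Or.inr (Or.inl ⟨hq, hI⟩)
  · rintro a b k s x r r' rfl - - - - h4
    rw [h4, Multiset.mem_singleton] at hp
    subst hp
    exact ⟨∅, LocalOn.one _, by simp⟩
  · rintro a b k q r r' rfl - - - - h4
    rw [h4, Multiset.mem_singleton] at hp
    subst hp
    exact ⟨∅, LocalOn.one _, by simp⟩

/-- The qubits that are owned by some agent. -/
def owned (g : Sys Q X K A) : Set Q := {q | ∃ a, q ∈ (g a).own}

lemma steps_supportedIn {g : Sys Q X K A} {α : Action A} (h : Ready g α)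
    {p : Sys Q X K A × Module.End ℂ (State Q)} (hp : p ∈ steps g α) {ρ : State Q}
    (hρ : SupportedIn (owned g) ρ) : SupportedIn (owned p.1) (p.2 ρ) := by
  refine h.elim ?_ ?_ ?_
  · rintro a P r rfl h1 h2 h3 h4
    rw [h4] at hp
    simp only [Multiset.mem_coe, List.mem_map] at hp
    obtain ⟨b, hb, rfl⟩ := hp
    -- All of `P.V` is split off from the bystanders, so that measured qubits really leave the
    -- support.
    have h5 : SupportedIn (owned g \ ↑P.V ∪ ↑P.V) (prep (P.V \ P.I) ρ) := by
      refine (hρ.prep _).mono ?_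
      rintro q (hq | hq)
      · by_cases hV : q ∈ P.V
        · exact Or.inr hV
        · exact Or.inl ⟨hq, hV⟩
      · exact Or.inr (Finset.mem_sdiff.1 hq).1
    refine (cmdsOps_supportedIn h3.2 hb h5).mono ?_
    rintro q (⟨⟨c, hc⟩, hV⟩ | hq)
    · by_cases hca : c = a
      · subst hca
        refine ⟨c, ?_⟩
        simp only [Function.update_self, Finset.mem_union, Finset.mem_sdiff]
        exact Or.inl ⟨hc, fun hI => hV (h3.1 hI)⟩
      · refine ⟨c, ?_⟩
        simpa only [Function.update_of_ne hca] using hc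
    · refine ⟨a, ?_⟩
      simp only [Function.update_self, Finset.mem_union]
      exact Or.inr hq
  · rintro a b k s x r r' rfl hab - - - h4
    rw [h4, Multiset.mem_singleton] at hp
    subst hp
    refine hρ.mono ?_
    rintro q ⟨c, hc⟩
    refine ⟨c, ?_⟩
    by_cases hcb : c = b
    · subst hcb; simpa using hc
    · by_cases hca : c = a
      · subst hca; simpa [Function.update_of_ne hcb] using hc
      · simpa [Function.update_of_ne hcb, Function.update_of_ne hca] using hc
  · rintro a b k q r r' rfl hab - - - h4
    rw [h4, Multiset.mem_singleton] at hp
    subst hp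
    refine hρ.mono ?_
    rintro x ⟨c, hc⟩
    by_cases hxq : x = q
    · exact ⟨b, by simp [hxq]⟩
    · refine ⟨c, ?_⟩
      by_cases hcb : c = b
      · subst hcb; simp [hc]
      · by_cases hca : c = a
        · subst hca; simpa [Function.update_of_ne hcb, hxq] using hc
        · simpa [Function.update_of_ne hcb, Function.update_of_ne hca] using hc

/-- The qubits that an agent will own at the end. -/
def finalOwn (s : AgentState Q X K A) : Finset Q := s.prog.foldl (fun S e => e.own S) s.own

/-- Executing an event performs the first step of the fold that predicts the final ownership. Hence
the qubits owned at the end of a run are the quantum outputs in the static signature. -/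
lemma steps_finalOwn {g : Sys Q X K A} {α : Action A} (h : Ready g α)
    {p : Sys Q X K A × Module.End ℂ (State Q)} (hp : p ∈ steps g α) (c : A) :
    finalOwn (p.1 c) = finalOwn (g c) := by
  refine h.elim ?_ ?_ ?_
  · rintro a P r rfl h1 h2 h3 h4
    rw [h4] at hp
    simp only [Multiset.mem_coe, List.mem_map] at hp
    obtain ⟨b, hb, rfl⟩ := hp
    by_cases hca : c = a
    · subst hca; simp [finalOwn, h1, Event.own]
    · simp only [Function.update_of_ne hca]
  · rintro a b k s x r r' rfl hab h1 h2 - h4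
    rw [h4, Multiset.mem_singleton] at hp
    subst hp
    by_cases hcb : c = b
    · subst hcb; simp [finalOwn, h2, Event.own]
    · by_cases hca : c = a
      · subst hca; simp [Function.update_of_ne hcb, finalOwn, h1, Event.own]
      · simp only [Function.update_of_ne hcb, Function.update_of_ne hca]
  · rintro a b k q r r' rfl hab h1 h2 - h4
    rw [h4, Multiset.mem_singleton] at hp
    subst hp
    by_cases hcb : c = b
    · subst hcb; simp [finalOwn, h2, Event.own]
    · by_cases hca : c = a
      · subst hca; simp [Function.update_of_ne hcb, finalOwn, h1, Event.own]
      · simp only [Function.update_of_ne hcb, Function.update_of_ne hca]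

lemma steps_prog {g : Sys Q X K A} {α : Action A} (h : Ready g α)
    {p : Sys Q X K A × Module.End ℂ (State Q)} (hp : p ∈ steps g α) (c : A) :
    (p.1 c).prog ⊆ (g c).prog := by
  refine h.elim ?_ ?_ ?_
  · rintro a P r rfl h1 h2 h3 h4
    rw [h4] at hp
    simp only [Multiset.mem_coe, List.mem_map] at hp
    obtain ⟨b, hb, rfl⟩ := hp
    by_cases hca : c = a
    · subst hca; simp [h1]
    · simp [Function.update_of_ne hca]
  · rintro a b k s x r r' rfl hab h1 h2 - h4
    rw [h4, Multiset.mem_singleton] at hp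
    subst hp
    by_cases hcb : c = b
    · subst hcb; simp [h2]
    · by_cases hca : c = a
      · subst hca; simp [Function.update_of_ne hcb, h1]
      · simp [Function.update_of_ne hcb, Function.update_of_ne hca]
  · rintro a b k q r r' rfl hab h1 h2 - h4
    rw [h4, Multiset.mem_singleton] at hp
    subst hp
    by_cases hcb : c = b
    · subst hcb; simp [h2]
    · by_cases hca : c = a
      · subst hca; simp [Function.update_of_ne hcb, h1]
      · simp [Function.update_of_ne hcb, Function.update_of_ne hca]

/-! ### Confluence -/

/-- Two actions in a row. -/
lemma branches_cons_cons (α β : Action A) (l : List (Action A)) (g : Sys Q X K A) :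
    branches (α :: β :: l) g =
      ((steps g α).bind fun p => (steps p.1 β).map fun q => (q.1, q.2 * p.2)).bind
        fun b => (branches l b.1).map fun d => (d.1, d.2 * b.2) := by
  simp only [branches, Multiset.bind_assoc, Multiset.map_bind, Multiset.map_map, Multiset.bind_map,
    Function.comp_def, mul_assoc]

/-- The classical updates concern disjoint agents and the operators act on disjoint registers, by
`Unique`. Both orders are thus one double family, summed in two orders. -/
lemma steps_comm {g : Sys Q X K A} (hg : Unique g) {α β : Action A} (hα : Ready g α)
    (hβ : Ready g β) (hne : α ≠ β) :
    ((steps g α).bind fun p => (steps p.1 β).map fun q => (q.1, q.2 * p.2)) =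
      (steps g β).bind fun p => (steps p.1 α).map fun q => (q.1, q.2 * p.2) := by
  have hd := hα.disjoint hβ hne
  have hdl := Finset.disjoint_left.1 hd
  have key : ∀ {α β : Action A}, Disjoint α.agents β.agents → ∀ p ∈ steps g α,
      steps p.1 β = (steps g β).map
        fun q => (fun x => if x ∈ β.agents then q.1 x else p.1 x, q.2) := by
    intro α β hd p hp
    exact steps_congr fun a ha => steps_of_notMem hp (Finset.disjoint_right.1 hd ha)
  have h1 : ((steps g α).bind fun p => (steps p.1 β).map fun q => (q.1, q.2 * p.2)) =
      (steps g α).bind fun p => (steps g β).map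
        fun q => (fun x => if x ∈ β.agents then q.1 x else p.1 x, q.2 * p.2) := by
    refine Multiset.bind_congr fun p hp => ?_
    rw [key hd p hp, Multiset.map_map]
    rfl
  have h2 : ((steps g β).bind fun p => (steps p.1 α).map fun q => (q.1, q.2 * p.2)) =
      (steps g β).bind fun p => (steps g α).map
        fun q => (fun x => if x ∈ α.agents then q.1 x else p.1 x, q.2 * p.2) := by
    refine Multiset.bind_congr fun p hp => ?_
    rw [key hd.symm p hp, Multiset.map_map]
    rfl
  rw [h1, h2, Multiset.bind_map_comm]
  refine Multiset.bind_congr fun q hq => Multiset.map_congr rfl fun p hp => ?_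
  obtain ⟨V, hV, hV'⟩ := steps_localOn hα hp
  obtain ⟨W, hW, hW'⟩ := steps_localOn hβ hq
  have hVW : Disjoint V W := by
    rw [Finset.disjoint_left]
    intro x hx hx'
    obtain ⟨a, ha, hxa, -⟩ := hV' x hx
    obtain ⟨b, hb, hxb, -⟩ := hW' x hx'
    exact hg.2 a b x (fun h => hdl ha (h ▸ hb)) hxa hxb
  rw [hV.commute hVW hW]
  congr 1
  ext1 x
  by_cases hx : x ∈ α.agents
  · simp [hx, hdl hx]
  · by_cases hx' : x ∈ β.agents
    · simp [hx, hx']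
    · simp [hx, hx', steps_of_notMem hp hx, steps_of_notMem hq hx']

lemma Compl.swap {fin : Sys Q X K A → Prop} {g : Sys Q X K A} (hg : Unique g) {α β : Action A}
    (hα : Ready g α) (hne : α ≠ β) {l : List (Action A)} (h : Compl fin (β :: α :: l) g) :
    Compl fin (α :: β :: l) g := by
  have hβ := h.1
  have hd := hα.disjoint hβ hne
  refine ⟨hα, fun p hp => ⟨hβ.congr fun a ha =>
    steps_of_notMem hp (Finset.disjoint_right.1 hd ha), fun q hq => ?_⟩⟩
  have hm : (q.1, q.2 * p.2) ∈
      (steps g α).bind fun p => (steps p.1 β).map fun q => (q.1, q.2 * p.2) :=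
    Multiset.mem_bind.2 ⟨p, hp, Multiset.mem_map.2 ⟨q, hq, rfl⟩⟩
  rw [steps_comm hg hα hβ hne, Multiset.mem_bind] at hm
  obtain ⟨p', hp', hm⟩ := hm
  obtain ⟨q', hq', h'⟩ := Multiset.mem_map.1 hm
  rw [Prod.mk.injEq] at h'
  rw [← h'.1]
  exact (h.2 p' hp').2 q' hq'

/-- A ready action stays ready until it fires, so it must occur in any complete schedule, and its
first occurrence can be commuted to the front. The schedule `l'` is chosen before `g`: measurements
branch, and a single rearranged schedule has to serve all branches. -/
lemma exists_pull {fin : Sys Q X K A → Prop} (hfin : ∀ g, fin g → ∀ a, (g a).prog = [])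
    (α : Action A) (l : List (Action A)) :
    ∃ l', ∀ g : Sys Q X K A, Unique g → Ready g α → Compl fin l g →
      Compl fin (α :: l') g ∧ branches l g = branches (α :: l') g := by
  induction l with
  | nil =>
    refine ⟨[], fun g _ hα h => ?_⟩
    obtain ⟨a, ha⟩ := α.agents_nonempty
    obtain ⟨e, r, h1, -⟩ := hα.head ha
    simp [hfin g h a] at h1
  | cons β m ih =>
    by_cases hne : α = β
    · exact ⟨m, fun g _ _ h => by rw [hne]; exact ⟨h, rfl⟩⟩
    · obtain ⟨l', hl'⟩ := ih
      refine ⟨β :: l', fun g hg hα h => ?_⟩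
      have hd := hα.disjoint h.1 hne
      have hb : ∀ b ∈ steps g β, Compl fin (α :: l') b.1 ∧ branches m b.1 = branches (α :: l') b.1 :=
        fun b hb => hl' b.1 (hg.step h.1 hb)
          (hα.congr fun a ha => steps_of_notMem hb (Finset.disjoint_left.1 hd ha)) (h.2 b hb)
      refine ⟨Compl.swap hg hα hne ⟨h.1, fun b hb' => (hb b hb').1⟩, ?_⟩
      rw [branches_cons_cons, steps_comm hg hα h.1 hne, ← branches_cons_cons]
      rw [branches, branches]
      exact Multiset.bind_congr fun b hb' => by rw [(hb b hb').2]

/-- All complete runs from the same state have the same computation paths. -/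
theorem branches_eq {fin : Sys Q X K A → Prop} (hfin : ∀ g, fin g → ∀ a, (g a).prog = [])
    {l l' : List (Action A)} {g : Sys Q X K A} (hg : Unique g) (h : Compl fin l g)
    (h' : Compl fin l' g) : branches l g = branches l' g := by
  induction l generalizing l' g with
  | nil =>
    cases l' with
    | nil => rfl
    | cons β m =>
      obtain ⟨a, ha⟩ := β.agents_nonempty
      obtain ⟨e, r, h1, -⟩ := h'.1.head ha
      simp [hfin g h a] at h1
  | cons α l ih =>
    -- The first action of `l` is ready, so it can be made the first action of `l'` too; the tails
    -- are then compared on each branch.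
    obtain ⟨m, hm⟩ := exists_pull hfin α l'
    obtain ⟨h1, h2⟩ := hm g hg h.1 h'
    rw [h2, branches, branches]
    exact Multiset.bind_congr fun b hb => by rw [ih (hg.step h.1 hb) (h.2 b hb) (h1.2 b hb)]

end Steps

end DMC

/-! ### Frames: running a system as the first part of a larger one -/

namespace DMC

section Frames

variable {Q X K A : Type*} [DecidableEq Q] [DecidableEq X] [DecidableEq A]

/-! ### Runs inside larger systems -/

/-- The memory `Γ'` extends the memory `Γ`. -/
def Extends (Γ Γ' : Mem Q X) : Prop := ∀ x v, Γ x = some v → Γ' x = some v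

lemma Extends.update {Γ Γ' : Mem Q X} (h : Extends Γ Γ') (x : CName Q X) (v : Option Bool) :
    Extends (Function.update Γ x v) (Function.update Γ' x v) := by
  intro y w hy
  by_cases hyx : y = x
  · subst hyx
    simpa using hy
  · rw [Function.update_of_ne hyx] at hy ⊢
    exact h y w hy

lemma Extends.bound_subset {Γ Γ' : Mem Q X} (h : Extends Γ Γ') : bound Γ ⊆ bound Γ' := by
  intro x hx
  obtain ⟨v, hv⟩ := Option.isSome_iff_exists.1 hx
  exact Option.isSome_iff_exists.2 ⟨v, h x v hv⟩

lemma Extends.eq_of_mem {Γ Γ' : Mem Q X} (h : Extends Γ Γ') {x : CName Q X} (hx : x ∈ bound Γ) :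
    Γ' x = Γ x := by
  obtain ⟨v, hv⟩ := Option.isSome_iff_exists.1 hx
  rw [hv, h x v hv]

lemma Extends.eval {Γ Γ' : Mem Q X} (h : Extends Γ Γ') {s : Signal Q X}
    (hs : s.Known (bound Γ)) : s.eval Γ' = s.eval Γ := by
  induction s with
  | const v => rfl
  | name x => simp only [Signal.eval, h.eq_of_mem hs]
  | add s t ihs iht => simp only [Signal.eval, ihs hs.1, iht hs.2]

lemma rel_singleton {α β : Type*} {r : α → β → Prop} {a : α} {b : β} (h : r a b) :
    Multiset.Rel r {a} {b} :=
  Multiset.rel_cons_left.2 ⟨b, 0, h, Multiset.rel_zero_left.2 rfl, rfl⟩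

/-- Definiteness lets signals read only bound names, where the larger memory agrees. All angles and
corrections therefore coincide, and the operators on matching paths are equal. -/
lemma cmdsOps_frame {O : Finset Q} {cs : List (Cmd Q X)} {live : Finset Q}
    {k : Set (CName Q X)} (hd : CmdsDefinite O cs live k) {Γ Γ' : Mem Q X} (hk : k ⊆ bound Γ)
    (h : Extends Γ Γ') {Y : Set (CName Q X)} {F : Mem Q X} (hF : ∀ x ∈ Y, Γ' x = F x)
    (hY : ∀ C ∈ cs, ∀ x ∈ C.cnames, x ∉ Y) :
    Multiset.Rel (fun p q => Extends p.1 q.1 ∧ (∀ x ∈ Y, q.1 x = F x) ∧ p.2 = q.2)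
      (cmdsOps cs Γ : Multiset (Mem Q X × Module.End ℂ (State Q)))
      (cmdsOps cs Γ' : Multiset (Mem Q X × Module.End ℂ (State Q))) := by
  induction cs generalizing live k Γ Γ' with
  | nil =>
    simp only [cmdsOps, Multiset.coe_singleton]
    exact rel_singleton ⟨h, hF, rfl⟩
  | cons C cs ih =>
    simp only [cmdsOps, ← Multiset.coe_bind]
    refine Multiset.rel_bind (r := fun p q => p.2 = q.2 ∧ Multiset.Rel
      (fun p q => Extends p.1 q.1 ∧ (∀ x ∈ Y, q.1 x = F x) ∧ p.2 = q.2)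
      (cmdsOps cs p.1 : Multiset (Mem Q X × Module.End ℂ (State Q)))
      (cmdsOps cs q.1 : Multiset (Mem Q X × Module.End ℂ (State Q)))) ?_ ?_
    · rintro ⟨Δ, L⟩ ⟨Δ', L'⟩ ⟨h1, h2⟩
      dsimp only at h1 h2 ⊢
      subst h1
      rw [← Multiset.map_coe, ← Multiset.map_coe, Multiset.rel_map]
      exact h2.mono fun p _ q _ hpq => ⟨hpq.1, hpq.2.1, by rw [hpq.2.2]⟩
    · have hY' : ∀ C ∈ cs, ∀ x ∈ C.cnames, x ∉ Y := fun C hC => hY C (List.mem_cons_of_mem _ hC)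
      cases C with
      | entangle i j =>
        exact rel_singleton ⟨rfl, ih hd.2.2.2 hk h hF hY'⟩
      | corrX i s =>
        exact rel_singleton ⟨by simp only [h.eval (hd.2.1.mono hk)], ih hd.2.2 hk h hF hY'⟩
      | corrZ i s =>
        exact rel_singleton ⟨by simp only [h.eval (hd.2.1.mono hk)], ih hd.2.2 hk h hF hY'⟩
      | measure i α s t =>
        simp only [Cmd.ops, ← Multiset.map_coe, Multiset.rel_map]
        refine Multiset.rel_refl_of_refl_on fun v _ => ⟨?_, ?_⟩
        · simp only [h.eval (hd.2.1.mono hk), h.eval (hd.2.2.1.mono hk)]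
        · refine ih hd.2.2.2 ?_ (h.update _ _) ?_ hY'
          · intro x hx
            by_cases hxi : x = Sum.inl i
            · simp [bound, hxi]
            · simp only [bound, Set.mem_ofPred_eq, Function.update_of_ne hxi]
              exact hk (hx.resolve_left hxi)
          · intro x hx
            have hxi : x ≠ Sum.inl i := by
              rintro rfl
              exact hY _ List.mem_cons_self (Sum.inl i) (by simp [Cmd.cnames]) hx
            rw [Function.update_of_ne hxi]
            exact hF x hx

/-- The agent state `s'` runs `s` as its first part: after the events of `s` it has the events `t`,
it owns the additional qubits `E`, and its memory extends that of `s` and takes the values `F`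
at the names `Y`; the events of `s` do not refer to `E` or `Y`. -/
structure FrameAt (t : List (Event Q X K A)) (E : Finset Q) (Y : Set (CName Q X)) (F : Mem Q X)
    (s s' : AgentState Q X K A) : Prop where
  prog : s'.prog = s.prog ++ t
  own : s'.own = s.own ∪ E
  mem : Extends s.mem s'.mem
  keep : ∀ x ∈ Y, s'.mem x = F x
  qapart : ∀ e ∈ s.prog, Disjoint e.qnames E
  capart : ∀ e ∈ s.prog, ∀ x ∈ e.cnames, x ∉ Y

/-- The system `h` runs `g` as its first part. -/
def Frame (T : A → List (Event Q X K A)) (E : A → Finset Q) (Y : A → Set (CName Q X))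
    (F : A → Mem Q X) (g h : Sys Q X K A) : Prop :=
  ∀ a, FrameAt (T a) (E a) (Y a) (F a) (g a) (h a)

variable {T : A → List (Event Q X K A)} {E : A → Finset Q} {Y : A → Set (CName Q X)}
  {F : A → Mem Q X} {g h : Sys Q X K A}

lemma Frame.update (hf : Frame T E Y F g h) {a : A} {s s' : AgentState Q X K A}
    (hs : FrameAt (T a) (E a) (Y a) (F a) s s') :
    Frame T E Y F (Function.update g a s) (Function.update h a s') := by
  intro b
  by_cases hb : b = a
  · subst hb; simpa using hs
  · simpa only [Function.update_of_ne hb] using hf b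

lemma Frame.ready (hf : Frame T E Y F g h) {α : Action A} (hα : Ready g α) : Ready h α := by
  refine hα.elim ?_ ?_ ?_
  · rintro a P r rfl h1 h2 h3 -
    refine ⟨P, r ++ T a, by rw [(hf a).prog, h1, List.cons_append], ?_, h3.1,
      h3.2.mono (hf a).mem.bound_subset⟩
    rw [(hf a).own]
    exact h2.trans Finset.subset_union_left
  · rintro a b k s x r r' rfl hab h1 h2 h3 -
    exact Or.inl ⟨k, s, x, r ++ T a, r' ++ T b, by rw [(hf a).prog, h1, List.cons_append],
      by rw [(hf b).prog, h2, List.cons_append], h3.mono (hf a).mem.bound_subset⟩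
  · rintro a b k q r r' rfl hab h1 h2 h3 -
    exact Or.inr ⟨k, q, r ++ T a, r' ++ T b, by rw [(hf a).prog, h1, List.cons_append],
      by rw [(hf b).prog, h2, List.cons_append], by
        rw [(hf a).own]
        exact Finset.mem_union_left _ h3⟩

lemma mem_cnames_pat {P : Pattern Q X} {C : Cmd Q X} (hC : C ∈ P.cmds) {x : CName Q X}
    (hx : x ∈ C.cnames) : x ∈ (Event.pat P : Event Q X K A).cnames := by
  simp only [Event.cnames]
  generalize P.cmds = cs at hC
  induction cs with
  | nil => simp at hC
  | cons D cs ih =>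
    rw [List.foldr_cons, Finset.mem_union]
    rcases List.mem_cons.1 hC with rfl | hC
    · exact Or.inl hx
    · exact Or.inr (ih hC)

/-- The larger system takes the same step with the same operator, and the frame survives it: what
the step binds or consumes is disjoint from `Y` and `E`. -/
lemma Frame.steps (hf : Frame T E Y F g h) {α : Action A} (hα : Ready g α) :
    Multiset.Rel (fun p q => Frame T E Y F p.1 q.1 ∧ p.2 = q.2) (steps g α) (steps h α) := by
  refine hα.elim ?_ ?_ ?_
  · rintro a P r rfl h1 h2 h3 h4
    have hprog := (hf a).prog
    rw [h1, List.cons_append] at hprog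
    have hmem := (hf a).mem
    have hq := (hf a).qapart
    have hc := (hf a).capart
    simp only [h1, List.mem_cons, forall_eq_or_imp] at hq hc
    have h5 := cmdsOps_frame h3.2 subset_rfl hmem (hf a).keep
      fun C hC x hx => hc.1 x (mem_cnames_pat hC hx)
    rw [h4]
    simp only [DMC.steps]
    rw [hprog]
    simp only [← Multiset.map_coe, Multiset.rel_map]
    refine h5.mono fun p _ q _ hpq => ⟨hf.update ?_, by rw [hpq.2.2]⟩
    refine ⟨rfl, ?_, hpq.1, hpq.2.1, hq.2, hc.2⟩
    simp only [Event.own, (hf a).own]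
    have hq1 := hq.1
    simp only [Event.qnames, Finset.disjoint_union_left] at hq1
    -- The inputs of the pattern avoid `E`; otherwise the update of the ownership could remove
    -- additional qubits.
    have := Finset.disjoint_right.1 hq1.1.2
    ext x
    have := @this x
    simp only [Finset.mem_union, Finset.mem_sdiff]
    tauto
  · rintro a b k s x r r' rfl hab h1 h2 h3 h4
    have hprog := (hf a).prog
    have hprog' := (hf b).prog
    rw [h1, List.cons_append] at hprog
    rw [h2, List.cons_append] at hprog'
    have hq := (hf a).qapart
    have hc := (hf a).capart
    have hq' := (hf b).qapart
    have hc' := (hf b).capart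
    simp only [h1, List.mem_cons, forall_eq_or_imp] at hq hc
    simp only [h2, List.mem_cons, forall_eq_or_imp] at hq' hc'
    rw [h4]
    simp only [DMC.steps]
    rw [hprog, hprog']
    refine rel_singleton ⟨?_, rfl⟩
    refine Frame.update (Frame.update hf ?_) ?_
    · exact ⟨rfl, (hf a).own, (hf a).mem, (hf a).keep, hq.2, hc.2⟩
    refine ⟨rfl, (hf b).own, ?_, ?_, hq'.2, hc'.2⟩
    · simp only [(hf a).mem.eval h3]
      exact (hf b).mem.update _ _
    · intro y hy
      have hyx : y ≠ x := by
        rintro rfl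
        exact hc'.1 y (by simp [Event.cnames]) hy
      simp only [Function.update_of_ne hyx]
      exact (hf b).keep y hy
  · rintro a b k q r r' rfl hab h1 h2 h3 h4
    have hprog := (hf a).prog
    have hprog' := (hf b).prog
    rw [h1, List.cons_append] at hprog
    rw [h2, List.cons_append] at hprog'
    have hq := (hf a).qapart
    have hc := (hf a).capart
    have hq' := (hf b).qapart
    have hc' := (hf b).capart
    simp only [h1, List.mem_cons, forall_eq_or_imp] at hq hc
    simp only [h2, List.mem_cons, forall_eq_or_imp] at hq' hc'
    rw [h4]
    simp only [DMC.steps]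
    rw [hprog, hprog']
    refine rel_singleton ⟨?_, rfl⟩
    refine Frame.update (Frame.update hf ?_) ?_
    · refine ⟨rfl, ?_, (hf a).mem, (hf a).keep, hq.2, hc.2⟩
      have hqE : q ∉ E a := Finset.disjoint_left.1 hq.1 (by simp [Event.qnames])
      simp only [(hf a).own]
      rw [Finset.union_sdiff_distrib, Finset.sdiff_singleton_eq_erase q (E a),
        Finset.erase_eq_of_notMem hqE]
    · refine ⟨rfl, ?_, (hf b).mem, (hf b).keep, hq'.2, hc'.2⟩
      simp only [(hf b).own]
      rw [Finset.union_right_comm]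

lemma Frame.compl (hf : Frame T E Y F g h) {fin : Sys Q X K A → Prop} {l : List (Action A)}
    (hc : Compl fin l g) : Compl (fun h' => ∃ g', fin g' ∧ Frame T E Y F g' h') l h := by
  induction l generalizing g h with
  | nil => exact ⟨g, hc, hf⟩
  | cons α l ih =>
    refine ⟨hf.ready hc.1, fun q hq => ?_⟩
    obtain ⟨p, hp, hpq⟩ := Multiset.exists_mem_of_rel_of_mem (Multiset.rel_flip.2 (hf.steps hc.1)) hq
    exact ih hpq.1 (hc.2 p hp)

/-- Paths are paired off with multiplicity, and each end of the larger run is still framed by an end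
of the smaller one. This is the starting point for the events `T` that remain. -/
lemma Frame.branches (hf : Frame T E Y F g h) {fin : Sys Q X K A → Prop} {l : List (Action A)}
    (hc : Compl fin l g) :
    Multiset.Rel (fun p q => Frame T E Y F p.1 q.1 ∧ p.2 = q.2 ∧ fin p.1)
      (branches l g) (branches l h) := by
  induction l generalizing g h with
  | nil =>
    exact rel_singleton ⟨hf, rfl, hc⟩
  | cons α l ih =>
    refine Multiset.rel_bind (r := fun p q => (Frame T E Y F p.1 q.1 ∧ p.2 = q.2) ∧
      Compl fin l p.1) ?_ ((hf.steps hc.1).mono fun p hp q _ hpq => ⟨hpq, hc.2 p hp⟩)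
    rintro ⟨p, L⟩ ⟨q, L'⟩ ⟨⟨h1, h2⟩, h3⟩
    dsimp only at h1 h2 h3 ⊢
    subst h2
    rw [Multiset.rel_map]
    exact (ih h1 h3).mono fun d _ d' _ hd => ⟨hd.1, by rw [hd.2.1], hd.2.2⟩

lemma Compl.and_invariant {fin I : Sys Q X K A → Prop}
    (hI : ∀ g α, Ready g α → I g → ∀ b ∈ DMC.steps g α, I b.1)
    {l : List (Action A)} {g : Sys Q X K A} (h : Compl fin l g)
    (hg : I g) : Compl (fun g => fin g ∧ I g) l g := by
  induction l generalizing g with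
  | nil => exact ⟨h, hg⟩
  | cons α l ih => exact ⟨h.1, fun b hb => ih (h.2 b hb) (hI g α h.1 hg b hb)⟩

lemma sum_map_eq_of_rel {α β M : Type*} [AddCommMonoid M] {r : α → β → Prop} {s : Multiset α}
    {t : Multiset β} (h : Multiset.Rel r s t) {f : α → M} {f' : β → M}
    (hf : ∀ a ∈ s, ∀ b ∈ t, r a b → f a = f' b) : (s.map f).sum = (t.map f').sum := by
  have : Multiset.Rel (fun x y : M => x = y) (s.map f) (t.map f') := by
    rw [Multiset.rel_map]
    exact h.mono hf
  rw [Multiset.rel_eq.1 this]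

end Frames

end DMC

/-! ### Definite networks: names, denotation, supports, and spectator qubits -/

namespace DMC

section Networks

variable {Q X K A : Type*} [DecidableEq Q] [DecidableEq X] [DecidableEq A]

/-! ### Names -/

lemma Agent.own_subset_qnames (g : Agent Q X K A) : g.own ⊆ g.qnames := by
  unfold Agent.qnames
  induction g.prog with
  | nil => exact subset_rfl
  | cons e l ih => exact ih.trans Finset.subset_union_right

lemma Agent.event_subset_qnames (g : Agent Q X K A) {e : Event Q X K A} (he : e ∈ g.prog) :
    e.qnames ⊆ g.qnames := by
  unfold Agent.qnames
  revert he
  induction g.prog with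
  | nil => intro he; simp at he
  | cons e' l ih =>
    intro he
    rcases List.mem_cons.1 he with rfl | he
    · exact Finset.subset_union_left
    · exact (ih he).trans Finset.subset_union_right

lemma Agent.event_subset_cnames (g : Agent Q X K A) {e : Event Q X K A} (he : e ∈ g.prog) :
    e.cnames ⊆ g.cnames := by
  unfold Agent.cnames
  revert he
  induction g.prog with
  | nil => intro he; simp at he
  | cons e' l ih =>
    intro he
    rcases List.mem_cons.1 he with rfl | he
    · exact Finset.subset_union_left
    · exact (ih he).trans Finset.subset_union_right

lemma Agent.cin_cout_subset_cnames (g : Agent Q X K A) : g.cin ∪ g.cout ⊆ g.cnames := by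
  unfold Agent.cnames
  induction g.prog with
  | nil => exact subset_rfl
  | cons e l ih => exact ih.trans Finset.subset_union_right

lemma Event.own_subset (e : Event Q X K A) (S : Finset Q) : e.own S ⊆ S ∪ e.qnames := by
  intro q hq
  cases e <;> simp only [Event.own, Event.qnames, Finset.mem_union, Finset.mem_sdiff,
    Finset.notMem_empty, or_false] at hq ⊢ <;> tauto

lemma Agent.out_subset_qnames (g : Agent Q X K A) : g.out ⊆ g.qnames := by
  have key : ∀ (l : List (Event Q X K A)) (S U : Finset Q), S ⊆ U → (∀ e ∈ l, e.qnames ⊆ U) →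
      l.foldl (fun S e => e.own S) S ⊆ U := by
    intro l
    induction l with
    | nil => intro S U h _; exact h
    | cons e l ih =>
      intro S U h h'
      exact ih _ _ ((e.own_subset S).trans (Finset.union_subset h (h' e List.mem_cons_self)))
        fun e' he' => h' e' (List.mem_cons_of_mem _ he')
  exact key _ _ _ g.own_subset_qnames fun e he => g.event_subset_qnames he

lemma Agent.mem_introduced {g : Agent Q X K A} {q : Q} :
    q ∈ g.introduced ↔ q ∈ g.own ∨ ∃ e ∈ g.prog, q ∈ e.working := by
  have key : ∀ l : List (Event Q X K A), q ∈ (l.map Event.working).sum ↔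
      ∃ e ∈ l, q ∈ e.working := by
    intro l
    induction l with
    | nil => simp
    | cons e l ih => simp [ih]
  rw [Agent.introduced, Multiset.mem_add, Finset.mem_val, key]

lemma Event.mem_qnames_of_working {e : Event Q X K A} {q : Q} (h : q ∈ e.working) :
    q ∈ e.qnames := by
  cases e
  case pat P =>
    simp only [Event.working, Finset.mem_val, Finset.mem_sdiff] at h
    simp [Event.qnames, h.1]
  all_goals simp [Event.working] at h

lemma Agent.mem_qnames_of_introduced {g : Agent Q X K A} {q : Q} (h : q ∈ g.introduced) :
    q ∈ g.qnames := by
  rcases Agent.mem_introduced.1 h with h | ⟨e, he, h⟩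
  · exact g.own_subset_qnames h
  · exact g.event_subset_qnames he (Event.mem_qnames_of_working h)

variable {N : Network Q X K A}

lemma Network.mem_qnames (hidle : ∀ a, a ∉ N.names → N.agent a = Agent.idle) {a : A} {q : Q}
    (h : q ∈ (N.agent a).qnames) : q ∈ N.qnames := by
  by_cases ha : a ∈ N.names
  · exact Finset.mem_biUnion.2 ⟨a, ha, h⟩
  · rw [hidle a ha] at h
    simp [Agent.idle, Agent.qnames] at h

/-- Agents outside the list are idle and introduce nothing, so the condition on the sum becomes a
pairwise one over all agents, the form preserved by steps. -/
lemma Network.nodup_iff (hidle : ∀ a, a ∉ N.names → N.agent a = Agent.idle) :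
    (∑ a ∈ N.names, (N.agent a).introduced).Nodup ↔
      (∀ a, (N.agent a).introduced.Nodup) ∧
        ∀ a b q, a ≠ b → q ∈ (N.agent a).introduced → q ∉ (N.agent b).introduced := by
  have hi : ∀ a q, q ∈ (N.agent a).introduced → a ∈ N.names := by
    intro a q hq
    by_contra ha
    rw [hidle a ha] at hq
    simp [Agent.idle, Agent.introduced] at hq
  simp only [Multiset.nodup_iff_count_le_one, Multiset.count_sum']
  constructor
  · intro h
    have h1 : ∀ a q, (N.agent a).introduced.count q ≤ 1 := by
      intro a q
      by_cases hq : q ∈ (N.agent a).introduced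
      · exact (Finset.single_le_sum (f := fun a => (N.agent a).introduced.count q)
          (fun _ _ => Nat.zero_le _) (hi a q hq)).trans (h q)
      · simp [Multiset.count_eq_zero_of_notMem hq]
    refine ⟨h1, fun a b q hab ha hb => ?_⟩
    have h2 : ∑ c ∈ {a, b}, (N.agent c).introduced.count q ≤
        ∑ c ∈ N.names, (N.agent c).introduced.count q :=
      Finset.sum_le_sum_of_subset (by
        intro c hc
        rcases Finset.mem_insert.1 hc with rfl | hc
        · exact hi _ q ha
        · rw [Finset.mem_singleton.1 hc]; exact hi _ q hb)
    rw [Finset.sum_pair hab] at h2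
    have h3 := Multiset.count_pos.2 ha
    have h4 := Multiset.count_pos.2 hb
    have := h q
    omega
  · rintro ⟨h1, h2⟩ q
    by_cases h : ∃ a ∈ N.names, q ∈ (N.agent a).introduced
    · obtain ⟨a, ha, hq⟩ := h
      rw [Finset.sum_eq_single a]
      · exact h1 a q
      · exact fun b _ hb => Multiset.count_eq_zero_of_notMem (h2 a b q (Ne.symm hb) hq)
      · exact fun h => absurd ha h
    · push Not at h
      rw [Finset.sum_eq_zero fun a ha => Multiset.count_eq_zero_of_notMem (h a ha)]
      exact Nat.zero_le _

lemma Network.Definite.unique (hN : N.Definite) (u : Val Q X A) : Unique (N.sys u) :=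
  (Network.nodup_iff hN.idle).1 hN.nodup

lemma Network.Definite.mem_qnames (hN : N.Definite) {a : A} {q : Q}
    (h : q ∈ (N.agent a).qnames) : q ∈ N.qnames := Network.mem_qnames hN.idle h

lemma Network.Definite.res_subset_qnames (hN : N.Definite) : N.res ⊆ N.qnames := by
  intro q hq
  obtain ⟨a, -, h⟩ := Finset.mem_biUnion.1 (hN.res_subset hq)
  exact hN.mem_qnames ((N.agent a).own_subset_qnames h)

lemma Network.Definite.mem_inputs (hN : N.Definite) {q : Q} :
    q ∈ N.inputs ↔ ∃ a, q ∈ N.qin a := by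
  refine ⟨fun h => ?_, fun ⟨a, h⟩ => ?_⟩
  · obtain ⟨a, -, h⟩ := Finset.mem_biUnion.1 h
    exact ⟨a, h⟩
  · by_cases ha : a ∈ N.names
    · exact Finset.mem_biUnion.2 ⟨a, ha, h⟩
    · simp [Network.qin, hN.idle a ha, Agent.idle] at h

lemma Network.Definite.mem_outputs (hN : N.Definite) {q : Q} :
    q ∈ N.outputs ↔ ∃ a, q ∈ N.qout a := by
  refine ⟨fun h => ?_, fun ⟨a, h⟩ => ?_⟩
  · obtain ⟨a, -, h⟩ := Finset.mem_biUnion.1 h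
    exact ⟨a, h⟩
  · by_cases ha : a ∈ N.names
    · exact Finset.mem_biUnion.2 ⟨a, ha, h⟩
    · simp [Network.qout, hN.idle a ha, Agent.idle, Agent.out] at h

lemma Network.Definite.inputs_subset_qnames (hN : N.Definite) : N.inputs ⊆ N.qnames := by
  intro q hq
  obtain ⟨a, h⟩ := hN.mem_inputs.1 hq
  exact hN.mem_qnames ((N.agent a).own_subset_qnames (Finset.mem_sdiff.1 h).1)

lemma Network.Definite.outputs_subset_qnames (hN : N.Definite) : N.outputs ⊆ N.qnames := by
  intro q hq
  obtain ⟨a, h⟩ := hN.mem_outputs.1 hq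
  exact hN.mem_qnames ((N.agent a).out_subset_qnames h)

/-! ### Semantics -/

lemma Network.Definite.compl_schedule (hN : N.Definite) {u : Val Q X A} (hu : N.IsInput u) :
    Compl N.Final N.schedule (N.sys u) := by
  have h : N.IsSchedule N.schedule := by
    unfold Network.schedule
    rw [dif_pos hN.schedulable]
    exact hN.schedulable.choose_spec
  exact (N.isSchedule_iff _).1 h u hu

/-- The classical outputs found in the final state of the agents. -/
def Network.readout (N : Network Q X K A) (g : Sys Q X K A) : Val Q X A :=
  fun a x => if x ∈ (N.agent a).cout then (g a).mem x else none

lemma sum_map_filter {α M : Type*} [AddCommMonoid M] (l : List α) (p : α → Prop) [DecidablePred p]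
    (f : α → M) : ((l.filter fun x => decide (p x)).map f).sum =
      (l.map fun x => if p x then f x else 0).sum := by
  induction l with
  | nil => rfl
  | cons a l ih => by_cases h : p a <;> simp [h, ih]

open Classical in
-- The weight `f` is arbitrary because this serves both the denotation (the state itself) and the
-- transition probabilities (the trace).
lemma Network.sum_paths {M : Type*} [AddCommMonoid M] (N : Network Q X K A) (u w : Val Q X A)
    (ρ : State Q) (f : State Q → M) :
    ((N.paths u ρ w).map fun p => f p.2.state).sum = ((branches N.schedule (N.sys u)).map fun b =>
      if N.readout b.1 = w then f (b.2 (tensor ρ N.res N.σ)) else 0).sum := by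
  rw [Network.paths, sum_map_filter]
  have h := congrArg (fun s : Multiset (Config Q X K A) =>
    (s.map fun c => if N.result c = w then f c.state else 0).sum)
    (map_run N.schedule (N.init u ρ))
  simp only [Multiset.map_coe, List.map_map, Multiset.sum_coe, Multiset.map_map] at h
  exact h

open Classical in
-- Confluence removes the arbitrary choice of a schedule. For composite networks `l` will be the
-- concatenation of the schedules of the components.
lemma Network.Definite.den_eq (hN : N.Definite) {u : Val Q X A} (hu : N.IsInput u)
    {l : List (Action A)} (hl : Compl N.Final l (N.sys u)) (w : Val Q X A) (ρ : State Q) :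
    N.den u w ρ = ((branches l (N.sys u)).map fun b =>
      if N.readout b.1 = w then b.2 (tensor ρ N.res N.σ) else 0).sum := by
  rw [Network.den, N.sum_paths u w ρ fun τ => τ,
    branches_eq (fun _ h a => (h a).1) (hN.unique u) (hN.compl_schedule hu) hl]

lemma multiset_sum_apply {α : Type*} (s : Multiset α) (f : α → Module.End ℂ (State Q))
    (ρ : State Q) : (s.map f).sum ρ = (s.map fun a => f a ρ).sum := by
  induction s using Multiset.induction with
  | empty => simp
  | cons a s ih => simp [ih]

open Classical in
/-- The denotation as a linear map. -/
noncomputable def Network.denL (N : Network Q X K A) (u w : Val Q X A) :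
    Module.End ℂ (State Q) :=
  ((branches N.schedule (N.sys u)).map fun b =>
    if N.readout b.1 = w then b.2 * tensorL N.res N.σ else 0).sum

lemma Network.denL_apply (N : Network Q X K A) (u w : Val Q X A) (ρ : State Q) :
    N.denL u w ρ = N.den u w ρ := by
  classical
  rw [Network.denL, multiset_sum_apply, Network.den, N.sum_paths u w ρ fun τ => τ]
  congr 2
  ext1 b
  split_ifs <;> rfl

lemma Network.Definite.branches_localOn (hN : N.Definite) {u : Val Q X A}
    {fin : Sys Q X K A → Prop} {l : List (Action A)} (hl : Compl fin l (N.sys u))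
    {b : Sys Q X K A × Module.End ℂ (State Q)} (hb : b ∈ branches l (N.sys u)) :
    LocalOn N.qnames b.2 := by
  have := hl.invariant (L := 1) (fun g L => LocalOn N.qnames L ∧
      ∀ a, (g a).prog ⊆ (N.agent a).prog) ?_ ⟨LocalOn.one _, fun a => List.Subset.refl _⟩ hb
  · simpa using this.1
  · rintro g L α hα ⟨h1, h2⟩ p hp
    refine ⟨?_, fun a => List.Subset.trans (steps_prog hα hp a) (h2 a)⟩
    obtain ⟨V, hV, hV'⟩ := steps_localOn hα hp
    refine (hV.mono fun q hq => ?_).mul h1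
    obtain ⟨a, -, -, e, he, hqe⟩ := hV' q hq
    exact hN.mem_qnames ((N.agent a).event_subset_qnames (h2 a he) hqe)

lemma Network.compl_final {l : List (Action A)} {u : Val Q X A}
    (hl : Compl N.Final l (N.sys u)) :
    Compl (fun g => N.Final g ∧ ∀ a, (g a).own = N.qout a) l (N.sys u) := by
  refine (hl.and_invariant (I := fun g => ∀ a, finalOwn (g a) = N.qout a) ?_ ?_).mono ?_
  · intro g α hα h b hb a
    rw [steps_finalOwn hα hb, h]
  · intro a
    rfl
  · rintro g ⟨h1, h2⟩
    refine ⟨h1, fun a => ?_⟩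
    have := h2 a
    rwa [finalOwn, (h1 a).1] at this

lemma Network.Definite.inputs_union_res (hN : N.Definite) (u : Val Q X A) :
    ((N.inputs ∪ N.res : Finset Q) : Set Q) ⊆ owned (N.sys u) := by
  intro q hq
  rcases Finset.mem_union.1 (Finset.mem_coe.1 hq) with hq | hq
  · obtain ⟨a, h⟩ := hN.mem_inputs.1 hq
    exact ⟨a, (Finset.mem_sdiff.1 h).1⟩
  · obtain ⟨a, -, h⟩ := Finset.mem_biUnion.1 (hN.res_subset hq)
    exact ⟨a, h⟩

/-- The state is always supported on owned qubits, and those owned at the end are the outputs. As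
this holds path by path, each path of one network delivers a legitimate input for its successor. -/
lemma Network.Definite.branches_supportedOn (hN : N.Definite) {u : Val Q X A}
    {l : List (Action A)} (hl : Compl N.Final l (N.sys u))
    {b : Sys Q X K A × Module.End ℂ (State Q)} (hb : b ∈ branches l (N.sys u)) {ρ : State Q}
    (hρ : SupportedOn N.inputs ρ) : SupportedOn N.outputs (b.2 (tensor ρ N.res N.σ)) := by
  have h1 := hl.invariant (L := 1)
    (fun g L => SupportedIn (owned g) (L (tensor ρ N.res N.σ))) ?_ ?_ hb
  · rw [supportedOn_iff]
    rw [mul_one] at h1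
    refine h1.mono ?_
    rintro q ⟨a, ha⟩
    rw [((Network.compl_final hl).final hb).2 a] at ha
    exact Finset.mem_coe.2 (hN.mem_outputs.2 ⟨a, ha⟩)
  · intro g L α hα h p hp
    exact steps_supportedIn hα hp h
  · exact (supportedOn_iff.1 (hρ.tensor N.σ)).mono (hN.inputs_union_res u)

lemma Network.Definite.den_induction (hN : N.Definite) {u : Val Q X A} (hu : N.IsInput u)
    (w : Val Q X A) (ρ : State Q) (p : State Q → Prop) (h0 : p 0)
    (hadd : ∀ ρ τ, p ρ → p τ → p (ρ + τ))
    (hb : ∀ b ∈ branches N.schedule (N.sys u), p (b.2 (tensor ρ N.res N.σ))) :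
    p (N.den u w ρ) := by
  classical
  rw [hN.den_eq hu (hN.compl_schedule hu)]
  refine Multiset.sum_induction p _ hadd h0 fun τ hτ => ?_
  obtain ⟨b, hb', rfl⟩ := Multiset.mem_map.1 hτ
  split_ifs
  · exact hb b hb'
  · exact h0

lemma Network.Definite.den_supportedOn (hN : N.Definite) {u : Val Q X A} (hu : N.IsInput u)
    (w : Val Q X A) {ρ : State Q} (hρ : SupportedOn N.inputs ρ) :
    SupportedOn N.outputs (N.den u w ρ) := by
  refine hN.den_induction hu w ρ _ (supportedOn_iff.2 (SupportedIn.zero _)) ?_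
    fun b hb => hN.branches_supportedOn (hN.compl_schedule hu) hb hρ
  intro ρ τ h h'
  rw [supportedOn_iff] at *
  exact h.add h'

lemma Network.Definite.den_posSemidef (hN : N.Definite) {u : Val Q X A} (hu : N.IsInput u)
    (w : Val Q X A) {ρ : State Q} (hρ : ρ.PosSemidef) : (N.den u w ρ).PosSemidef :=
  hN.den_induction hu w ρ _ Matrix.PosSemidef.zero (fun _ _ h h' => h.add h') fun _ hb =>
    (hN.branches_localOn (hN.compl_schedule hu) hb).posSemidef
      (posSemidef_tensor hρ hN.density.posSemidef _)

/-- `slice` as a linear map. -/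
def sliceL (T x y : Finset Q) : Module.End ℂ (State Q) where
  toFun := slice T x y
  map_add' ρ τ := by ext a b; simp only [slice, Matrix.add_apply]; ring
  map_smul' c ρ := by
    ext a b; simp only [slice, Matrix.smul_apply, smul_eq_mul, RingHom.id_apply]; ring

/-- Every path acts by an operator on the qubits of the network. A linear `Φ` that commutes with all
such operators and with adding the resource therefore commutes with the sum over paths. -/
lemma Network.Definite.den_commute (hN : N.Definite) {u : Val Q X A} (hu : N.IsInput u)
    (w : Val Q X A) (Φ : Module.End ℂ (State Q))
    (hΦ : ∀ L, LocalOn N.qnames L → ∀ ρ, L (Φ ρ) = Φ (L ρ))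
    (hσ : ∀ ρ, tensor (Φ ρ) N.res N.σ = Φ (tensor ρ N.res N.σ)) (ρ : State Q) :
    N.den u w (Φ ρ) = Φ (N.den u w ρ) := by
  classical
  have hl := hN.compl_schedule hu
  rw [hN.den_eq hu hl, hN.den_eq hu hl, map_multiset_sum, Multiset.map_map]
  congr 1
  refine Multiset.map_congr rfl fun b hb => ?_
  simp only [Function.comp_apply, hσ, hΦ _ (hN.branches_localOn hl hb), apply_ite Φ, map_zero]

lemma Network.Definite.den_slice (hN : N.Definite) {u : Val Q X A} (hu : N.IsInput u)
    (w : Val Q X A) {T x y : Finset Q} (hT : Disjoint N.qnames T) (hx : x ⊆ T) (hy : y ⊆ T)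
    (ρ : State Q) : N.den u w (slice T x y ρ) = slice T x y (N.den u w ρ) :=
  hN.den_commute hu w (sliceL T x y) (fun _ hL ρ => hL.slice hT hx hy ρ)
    (fun ρ => (slice_tensor (hT.symm.mono_right hN.res_subset_qnames) hx hy ρ N.σ).symm) ρ

/-- Each block with respect to the spectators `T` is an operator on the inputs alone, where the
support is already known. -/
lemma Network.Definite.den_supportedOn_union (hN : N.Definite) {u : Val Q X A}
    (hu : N.IsInput u) (w : Val Q X A) {T : Finset Q} (hT : Disjoint N.qnames T) {ρ : State Q}
    (hρ : SupportedOn (N.inputs ∪ T) ρ) : SupportedOn (N.outputs ∪ T) (N.den u w ρ) := by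
  refine supportedOn_of_slice fun x y hx hy => ?_
  rw [← hN.den_slice hu w hT hx hy]
  exact hN.den_supportedOn hu w hρ.slice

lemma Network.SameType.isInput {N₁ N₂ : Network Q X K A} (h : N₁.SameType N₂) {u : Val Q X A} :
    N₁.IsInput u ↔ N₂.IsInput u := by
  simp only [Network.IsInput, h.cin]

lemma Network.SameType.inputs {N₁ N₂ : Network Q X K A} (h : N₁.SameType N₂) :
    N₁.inputs = N₂.inputs := by
  rw [Network.inputs, Network.inputs, h.names, funext h.qin]

lemma Network.SameType.outputs {N₁ N₂ : Network Q X K A} (h : N₁.SameType N₂) :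
    N₁.outputs = N₂.outputs := by
  rw [Network.outputs, Network.outputs, h.names, funext h.qout]

/-- Denotationally equivalent networks agree on inputs that are entangled with other qubits. -/
lemma Network.DenEquiv.den_eq {N₁ N₂ : Network Q X K A} (h : N₁.DenEquiv N₂) (h₁ : N₁.Definite)
    (h₂ : N₂.Definite) {T : Finset Q} (hT₁ : Disjoint N₁.qnames T) (hT₂ : Disjoint N₂.qnames T)
    {u : Val Q X A} (hu : N₁.IsInput u) (w : Val Q X A) {ρ : State Q}
    (hρ : SupportedOn (N₁.inputs ∪ T) ρ) : N₁.den u w ρ = N₂.den u w ρ := by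
  have hu₂ := h.1.isInput.1 hu
  ext a b
  rw [eq_slice T (N₁.den u w ρ) a b, eq_slice T (N₂.den u w ρ) a b,
    ← h₁.den_slice hu w hT₁ Finset.inter_subset_right Finset.inter_subset_right,
    ← h₂.den_slice hu₂ w hT₂ Finset.inter_subset_right Finset.inter_subset_right,
    h.2 u w _ hu hρ.slice]

end Networks

end DMC

/-! ### Denotations of parallel and sequential compositions -/

namespace DMC

section Composition

variable {Q X K A : Type*} [DecidableEq Q] [DecidableEq X] [DecidableEq A]

/-- A run of `h` that consists of a run of `g₁` and, depending on its end `p`, one of `g₂ p`. -/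
lemma two_stage {β M : Type*} [AddCommMonoid M] {T : A → List (Event Q X K A)}
    {E : A → Finset Q} {Y : A → Set (CName Q X)} {F : A → Mem Q X} {g₁ h : Sys Q X K A}
    (hf : Frame T E Y F g₁ h) {l₁ l₂ : List (Action A)} {fin₁ fin₂ fin : Sys Q X K A → Prop}
    (hc : Compl fin₁ l₁ g₁) {g₂ : Sys Q X K A → Sys Q X K A} {r : Sys Q X K A → β}
    {r' : Sys Q X K A → Sys Q X K A → β}
    (hnext : ∀ p h', Frame T E Y F p h' → fin₁ p → ∃ T' E' Y' F',
      Frame T' E' Y' F' (g₂ p) h' ∧ Compl fin₂ l₂ (g₂ p) ∧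
      ∀ d h'', Frame T' E' Y' F' d h'' → fin₂ d → fin h'' ∧ r h'' = r' p d) :
    Compl fin (l₁ ++ l₂) h ∧ ∀ φ : β → Module.End ℂ (State Q) → M,
      ((branches (l₁ ++ l₂) h).map fun b => φ (r b.1) b.2).sum =
        ((branches l₁ g₁).map fun p => ((branches l₂ (g₂ p.1)).map fun d =>
          φ (r' p.1 d.1) (d.2 * p.2)).sum).sum := by
  constructor
  · rw [compl_append]
    refine (hf.compl hc).mono ?_
    rintro h' ⟨p, hp, hfp⟩
    obtain ⟨T', E', Y', F', h1, h2, h3⟩ := hnext p h' hfp hp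
    refine (h1.compl h2).mono ?_
    rintro h'' ⟨d, hd, hfd⟩
    exact (h3 d h'' hfd hd).1
  · intro φ
    rw [branches_append, Multiset.map_bind, Multiset.sum_bind]
    refine (sum_map_eq_of_rel (hf.branches hc) ?_).symm
    rintro ⟨p, L⟩ - ⟨h', L'⟩ - ⟨hfp, hL, hp⟩
    dsimp only at hfp hL hp ⊢
    subst hL
    obtain ⟨T', E', Y', F', h1, h2, h3⟩ := hnext p h' hfp hp
    rw [Multiset.map_map]
    refine sum_map_eq_of_rel (h1.branches h2) ?_
    rintro ⟨d, L₂⟩ - ⟨h'', L₂'⟩ - ⟨hfd, hL₂, hd⟩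
    dsimp only at hfd hL₂ hd
    subst hL₂
    simp only [Function.comp_apply, (h3 d h'' hfd hd).2]

/-- Events that never mention `E` leave it untouched; this computes the quantum outputs of
concatenated event sequences. -/
lemma foldl_own_union (l : List (Event Q X K A)) (S E : Finset Q)
    (h : ∀ e ∈ l, Disjoint e.qnames E) :
    l.foldl (fun S e => e.own S) (S ∪ E) = l.foldl (fun S e => e.own S) S ∪ E := by
  induction l generalizing S with
  | nil => rfl
  | cons e l ih =>
    have h1 : e.own (S ∪ E) = e.own S ∪ E := by
      have hd := Finset.disjoint_left.1 (h e List.mem_cons_self)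
      ext q
      have := @hd q
      cases e <;> simp only [Event.own, Event.qnames, Finset.mem_union, Finset.mem_sdiff,
        Finset.mem_singleton] at this ⊢ <;> tauto
    rw [List.foldl_cons, h1, ih _ fun e' he' => h e' (List.mem_cons_of_mem _ he'), List.foldl_cons]

/-- The restriction of an assignment to the given names. -/
def restrictTo (S : A → Finset (CName Q X)) (u : Val Q X A) : Val Q X A :=
  fun a x => if x ∈ S a then u a x else none

lemma bound_restrictTo {S : A → Finset (CName Q X)} {u : Val Q X A} {a : A}
    (h : ↑(S a) ⊆ bound (u a)) : bound (restrictTo S u a) = ↑(S a) := by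
  ext x
  by_cases hx : x ∈ S a
  · have : x ∈ bound (u a) := h (Finset.mem_coe.2 hx)
    simpa [bound, restrictTo, hx] using this
  · simp [bound, restrictTo, hx]

lemma extends_restrictTo (S : A → Finset (CName Q X)) (u : Val Q X A) (a : A) :
    Extends (restrictTo S u a) (u a) := by
  intro x v hx
  by_cases h : x ∈ S a
  · simpa only [restrictTo, h, if_true] using hx
  · simp [restrictTo, h] at hx

lemma Network.readout_eq (N : Network Q X K A) (g : Sys Q X K A) :
    N.readout g = restrictTo (fun a => (N.agent a).cout) fun a => (g a).mem := rfl

/-- Here `S` is what the second network adds to the initial ownership: everything it owns in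
parallel composition, only its share of the resource in sequential composition. -/
lemma introduced_append {g₁ g₂ : Agent Q X K A} {S : Finset Q}
    (hd : ∀ q ∈ g₁.introduced, q ∉ S.val + (g₂.prog.map Event.working).sum)
    {cin cout : Finset (CName Q X)} :
    (Agent.mk cin cout (g₁.own ∪ S) (g₁.prog ++ g₂.prog)).introduced =
      g₁.introduced + (S.val + (g₂.prog.map Event.working).sum) := by
  have hS : Disjoint g₁.own S := Finset.disjoint_left.2 fun q hq hq' =>
    hd q (Multiset.mem_add.2 (Or.inl hq)) (Multiset.mem_add.2 (Or.inl hq'))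
  simp only [Agent.introduced, List.map_append, List.sum_append]
  rw [← Finset.disjUnion_eq_union _ _ hS, Finset.disjUnion_val]
  abel

/-- Merging agents with disjoint introduced qubits. -/
lemma unique_add {f₁ f₂ : A → Multiset Q}
    (h₁ : (∀ a, (f₁ a).Nodup) ∧ ∀ a b q, a ≠ b → q ∈ f₁ a → q ∉ f₁ b)
    (h₂ : (∀ a, (f₂ a).Nodup) ∧ ∀ a b q, a ≠ b → q ∈ f₂ a → q ∉ f₂ b)
    (hd : ∀ a b q, q ∈ f₁ a → q ∉ f₂ b) :
    (∀ a, (f₁ a + f₂ a).Nodup) ∧ ∀ a b q, a ≠ b → q ∈ f₁ a + f₂ a → q ∉ f₁ b + f₂ b := by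
  refine ⟨fun a => Multiset.nodup_add.2 ⟨h₁.1 a, h₂.1 a,
    Multiset.disjoint_left.2 fun hq => hd a a _ hq⟩, fun a b q hab ha hb => ?_⟩
  rw [Multiset.mem_add] at ha hb
  rcases ha with ha | ha <;> rcases hb with hb | hb
  · exact h₁.2 a b q hab ha hb
  · exact hd a b q ha hb
  · exact hd b a q hb ha
  · exact h₂.2 a b q hab ha hb

/-! ### Parallel composition -/

section Par

variable {N₁ N₂ : Network Q X K A}

lemma Network.par_input_left {u : Val Q X A} (hu : (N₁.par N₂).IsInput u) :
    N₁.IsInput (restrictTo (fun a => (N₁.agent a).cin) u) := fun a =>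
  bound_restrictTo (by
    rw [hu a]
    exact Finset.coe_subset.2 (Finset.subset_union_left (s₁ := (N₁.agent a).cin)))

lemma Network.par_input_right {u : Val Q X A} (hu : (N₁.par N₂).IsInput u) :
    N₂.IsInput (restrictTo (fun a => (N₂.agent a).cin) u) := fun a =>
  bound_restrictTo (S := fun a => (N₂.agent a).cin) (by
    rw [hu a]
    exact Finset.coe_subset.2 (Finset.subset_union_right (s₂ := (N₂.agent a).cin)))

lemma Network.ParApart.qdisjoint (h : N₁.ParApart N₂) (h₁ : N₁.Definite) (h₂ : N₂.Definite)
    {a b : A} : Disjoint (N₁.agent a).qnames (N₂.agent b).qnames :=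
  Finset.disjoint_left.2 fun _ hq hq' =>
    Finset.disjoint_left.1 h.1 (h₁.mem_qnames hq) (h₂.mem_qnames hq')

lemma Network.par_two_stage {M : Type*} [AddCommMonoid M] (h₁ : N₁.Definite) (h₂ : N₂.Definite)
    (hap : N₁.ParApart N₂) {u : Val Q X A} (hu : (N₁.par N₂).IsInput u) :
    Compl (N₁.par N₂).Final (N₁.schedule ++ N₂.schedule) ((N₁.par N₂).sys u) ∧
    ∀ φ : Val Q X A → Module.End ℂ (State Q) → M,
      ((branches (N₁.schedule ++ N₂.schedule) ((N₁.par N₂).sys u)).map fun b =>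
          φ ((N₁.par N₂).readout b.1) b.2).sum =
        ((branches N₁.schedule (N₁.sys (restrictTo (fun a => (N₁.agent a).cin) u))).map fun p =>
          ((branches N₂.schedule (N₂.sys (restrictTo (fun a => (N₂.agent a).cin) u))).map fun d =>
            φ (fun a x => if x ∈ (N₁.agent a).cout then N₁.readout p.1 a x
              else N₂.readout d.1 a x) (d.2 * p.2)).sum).sum := by
  have hu₁ := Network.par_input_left hu
  have hu₂ := Network.par_input_right hu
  have hcn := fun a => Finset.disjoint_left.1 (hap.2 a)
  -- During the first stage the frame protects the qubits of `N₂` and the values of `u` at all its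
  -- names, so that its classical inputs are intact when it starts.
  refine two_stage (T := fun a => (N₂.agent a).prog) (E := fun a => (N₂.agent a).own)
    (Y := fun a => ↑(N₂.agent a).cnames) (F := u) (fun a => ?_)
    (Network.compl_final (h₁.compl_schedule hu₁))
    (g₂ := fun _ => N₂.sys (restrictTo (fun a => (N₂.agent a).cin) u))
    (r' := fun p d => fun a x => if x ∈ (N₁.agent a).cout then N₁.readout p a x
              else N₂.readout d a x) (fin₂ := N₂.Final) ?_
  · refine ⟨rfl, rfl, extends_restrictTo (fun a => (N₁.agent a).cin) u a,
      fun _ _ => rfl, fun e he => ?_, fun e he x hx hx' => ?_⟩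
    · exact (hap.qdisjoint h₁ h₂ (a := a) (b := a)).mono
        ((N₁.agent a).event_subset_qnames he) (N₂.agent a).own_subset_qnames
    · exact hcn a ((N₁.agent a).event_subset_cnames he hx) hx'
  · rintro p h' hfp ⟨hp, hpo⟩
    -- During the second stage the roles are exchanged: the frame keeps the output qubits of `N₁`
    -- and its memory, so that its results can still be read at the end.
    refine ⟨fun _ => [], N₁.qout, fun a => ↑(N₁.agent a).cnames, fun a => (h' a).mem,
      fun a => ?_, h₂.compl_schedule hu₂, fun d h'' hfd hd => ⟨fun a => ⟨?_, ?_⟩, ?_⟩⟩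
    · have hmem : ∀ x ∈ (N₂.agent a).cnames, (h' a).mem x = u a x := (hfp a).keep
      refine ⟨?_, ?_, fun x v hx => ?_, fun _ _ => rfl, fun e he => ?_, fun e he x hx hx' => ?_⟩
      · rw [(hfp a).prog, (hp a).1]
        simp [Network.sys]
      · rw [(hfp a).own, hpo a, Finset.union_comm]
        rfl
      · have hxc : x ∈ (N₂.agent a).cin := by
          by_contra hxc
          simp [Network.sys, restrictTo, hxc] at hx
        rw [hmem x ((N₂.agent a).cin_cout_subset_cnames (Finset.mem_union_left _ hxc))]
        exact extends_restrictTo (fun a => (N₂.agent a).cin) u a x v hx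
      · exact (hap.qdisjoint h₁ h₂ (a := a) (b := a)).symm.mono
          ((N₂.agent a).event_subset_qnames he) (N₁.agent a).out_subset_qnames
      · exact hcn a hx' ((N₂.agent a).event_subset_cnames he hx)
    · rw [(hfd a).prog, (hd a).1]
      rfl
    · intro x hx
      rcases Finset.mem_union.1 (Finset.mem_coe.1 hx) with hx | hx
      · have h3 : (h'' a).mem x = (h' a).mem x := (hfd a).keep x (Finset.mem_coe.2
          ((N₁.agent a).cin_cout_subset_cnames (Finset.mem_union_right _ hx)))
        have h4 := (hfp a).mem.bound_subset ((hp a).2 hx)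
        simpa only [bound, Set.mem_ofPred_eq, h3] using h4
      · exact (hfd a).mem.bound_subset ((hd a).2 hx)
    · funext a x
      by_cases hx : x ∈ (N₁.agent a).cout
      · have h3 : (h'' a).mem x = (h' a).mem x := (hfd a).keep x (Finset.mem_coe.2
          ((N₁.agent a).cin_cout_subset_cnames (Finset.mem_union_right _ hx)))
        have h4 := (hfp a).mem.eq_of_mem ((hp a).2 hx)
        simp [Network.readout, Network.par, hx, h3, h4]
      · by_cases hx' : x ∈ (N₂.agent a).cout
        · have h4 := (hfd a).mem.eq_of_mem ((hd a).2 hx')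
          simp [Network.readout, Network.par, hx, hx', h4]
        · simp [Network.readout, Network.par, hx, hx']

lemma Network.Definite.par (h₁ : N₁.Definite) (h₂ : N₂.Definite) (hap : N₁.ParApart N₂) :
    (N₁.par N₂).Definite := by
  have hidle : ∀ a, a ∉ (N₁.par N₂).names → (N₁.par N₂).agent a = Agent.idle := by
    intro a ha
    have ha' : a ∉ N₁.names ∧ a ∉ N₂.names := by
      simpa [Network.par, Finset.mem_union, not_or] using ha
    simp [Network.par, h₁.idle a ha'.1, h₂.idle a ha'.2, Agent.idle]
  have u₁ := (Network.nodup_iff h₁.idle).1 h₁.nodup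
  have u₂ := (Network.nodup_iff h₂.idle).1 h₂.nodup
  have hd : ∀ a b q, q ∈ (N₁.agent a).introduced → q ∉ (N₂.agent b).introduced :=
    fun a b q hq hq' => Finset.disjoint_left.1 (hap.qdisjoint h₁ h₂)
      (Agent.mem_qnames_of_introduced hq) (Agent.mem_qnames_of_introduced hq')
  refine ⟨hidle, ?_, ?_, ?_, N₁.schedule ++ N₂.schedule, ?_⟩
  · rw [Network.nodup_iff hidle]
    have e : ∀ a, ((N₁.par N₂).agent a).introduced =
        (N₁.agent a).introduced + (N₂.agent a).introduced :=
      fun a => introduced_append (hd a a)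
    simp only [e]
    exact unique_add u₁ u₂ hd
  · intro q hq
    rcases Finset.mem_union.1 hq with hq | hq
    · obtain ⟨a, ha, h⟩ := Finset.mem_biUnion.1 (h₁.res_subset hq)
      exact Finset.mem_biUnion.2 ⟨a, Finset.mem_union_left _ ha, Finset.mem_union_left _ h⟩
    · obtain ⟨a, ha, h⟩ := Finset.mem_biUnion.1 (h₂.res_subset hq)
      exact Finset.mem_biUnion.2 ⟨a, Finset.mem_union_right _ ha, Finset.mem_union_right _ h⟩
  · exact h₁.density.tensor (hap.1.mono h₁.res_subset_qnames h₂.res_subset_qnames) h₂.density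
  · rw [Network.isSchedule_iff]
    exact fun u hu => (Network.par_two_stage (M := ℕ) h₁ h₂ hap hu).1

/-- Disjointness of the classical names lets a joint output split into two independent ones. The
first condition is needed because the restrictions ignore bits of `w` at names that are not outputs.
-/
lemma merge_eq_iff (N₁ N₂ : Network Q X K A) (p d : Sys Q X K A) (w : Val Q X A) (hap : N₁.ParApart N₂) :
    (fun a x => if x ∈ (N₁.agent a).cout then N₁.readout p a x else N₂.readout d a x) = w ↔
      restrictTo (fun a => (N₁.agent a).cout ∪ (N₂.agent a).cout) w = w ∧
        N₁.readout p = restrictTo (fun a => (N₁.agent a).cout) w ∧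
        N₂.readout d = restrictTo (fun a => (N₂.agent a).cout) w := by
  constructor
  · rintro rfl
    refine ⟨?_, ?_, ?_⟩ <;> funext a x
    · by_cases h1 : x ∈ (N₁.agent a).cout <;> by_cases h2 : x ∈ (N₂.agent a).cout <;>
        simp [restrictTo, Network.readout, h1, h2]
    · by_cases h1 : x ∈ (N₁.agent a).cout <;> simp [restrictTo, Network.readout, h1]
    · by_cases h2 : x ∈ (N₂.agent a).cout
      · have h1 : x ∉ (N₁.agent a).cout := fun h1 => Finset.disjoint_left.1 (hap.2 a)
          ((N₁.agent a).cin_cout_subset_cnames (Finset.mem_union_right _ h1))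
          ((N₂.agent a).cin_cout_subset_cnames (Finset.mem_union_right _ h2))
        simp [restrictTo, Network.readout, h1, h2]
      · simp [restrictTo, Network.readout, h2]
  · rintro ⟨h0, h1, h2⟩
    rw [← h0, h1, h2]
    funext a x
    by_cases h1 : x ∈ (N₁.agent a).cout <;> by_cases h2 : x ∈ (N₂.agent a).cout <;>
      simp [restrictTo, h1, h2]

open Classical in
/-- The denotation of a parallel composition: the first network acts, then the second. -/
lemma Network.den_par (h₁ : N₁.Definite) (h₂ : N₂.Definite) (hap : N₁.ParApart N₂)
    {u : Val Q X A} (hu : (N₁.par N₂).IsInput u) (w : Val Q X A) (ρ : State Q) :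
    (N₁.par N₂).den u w ρ =
      if restrictTo (fun a => (N₁.agent a).cout ∪ (N₂.agent a).cout) w = w then
        N₂.den (restrictTo (fun a => (N₂.agent a).cin) u)
          (restrictTo (fun a => (N₂.agent a).cout) w)
          (N₁.den (restrictTo (fun a => (N₁.agent a).cin) u)
            (restrictTo (fun a => (N₁.agent a).cout) w) ρ)
      else 0 := by
  have hu₁ := Network.par_input_left hu
  have hu₂ := Network.par_input_right hu
  have hc := Network.par_two_stage (M := State Q) h₁ h₂ hap hu
  have hτ : tensor ρ (N₁.par N₂).res (N₁.par N₂).σ =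
      tensor (tensor ρ N₁.res N₁.σ) N₂.res N₂.σ :=
    tensor_assoc (hap.1.mono h₁.res_subset_qnames h₂.res_subset_qnames) _ _ _
  rw [(h₁.par h₂ hap).den_eq hu hc.1, hτ,
    hc.2 fun v L => if v = w then L (tensor (tensor ρ N₁.res N₁.σ) N₂.res N₂.σ) else 0]
  simp only [merge_eq_iff N₁ N₂ _ _ w hap]
  split_ifs with h0
  · rw [h₁.den_eq hu₁ (h₁.compl_schedule hu₁), ← Network.denL_apply, map_multiset_sum,
      Multiset.map_map]
    congr 1
    refine Multiset.map_congr rfl fun p hp => ?_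
    -- The paths of `N₁` commute with adding the resource of `N₂`, so this resource may be added
    -- after `N₁` has finished.
    have hloc := h₁.branches_localOn (h₁.compl_schedule hu₁) hp
    simp only [Function.comp_apply, h0, true_and, Module.End.mul_apply,
      hloc.tensor (hap.1.mono_right h₂.res_subset_qnames)]
    by_cases h : N₁.readout p.1 = restrictTo (fun a => (N₁.agent a).cout) w
    · simp only [h, true_and, if_true]
      rw [Network.denL_apply, h₂.den_eq hu₂ (h₂.compl_schedule hu₂)]
    · simp [h]
  · simp [h0]

lemma Network.qin_par (h₁ : N₁.Definite) (h₂ : N₂.Definite) (hap : N₁.ParApart N₂) (a : A) :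
    (N₁.par N₂).qin a = N₁.qin a ∪ N₂.qin a := by
  have hd := Finset.disjoint_left.1 hap.1
  ext q
  have e1 := fun h : q ∈ (N₁.agent a).own => h₁.mem_qnames ((N₁.agent a).own_subset_qnames h)
  have e2 := fun h : q ∈ (N₂.agent a).own => h₂.mem_qnames ((N₂.agent a).own_subset_qnames h)
  have e3 := fun h : q ∈ N₁.res => h₁.res_subset_qnames h
  have e4 := fun h : q ∈ N₂.res => h₂.res_subset_qnames h
  have e5 := @hd q
  simp only [Network.qin, Network.par, Finset.mem_sdiff, Finset.mem_union]
  tauto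

lemma Network.qout_par (h₁ : N₁.Definite) (h₂ : N₂.Definite) (hap : N₁.ParApart N₂) (a : A) :
    (N₁.par N₂).qout a = N₁.qout a ∪ N₂.qout a := by
  simp only [Network.qout, Network.par, Agent.out, List.foldl_append]
  rw [foldl_own_union, Finset.union_comm, foldl_own_union, Finset.union_comm]
  · intro e he
    exact (hap.qdisjoint h₁ h₂ (a := a) (b := a)).symm.mono
      ((N₂.agent a).event_subset_qnames he) (N₁.agent a).out_subset_qnames
  · intro e he
    exact (hap.qdisjoint h₁ h₂ (a := a) (b := a)).mono
      ((N₁.agent a).event_subset_qnames he) (N₂.agent a).own_subset_qnames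

end Par

/-! ### Sequential composition -/

section Comp

variable {N₁ N₂ : Network Q X K A}

/-- A shared qubit is an output of `N₁`, hence a quantum input of `N₂`, and quantum inputs exclude
the resource. -/
lemma Network.SeqApart.res_disjoint (hap : N₁.SeqApart N₂) (h₁ : N₁.Definite)
    (h₂ : N₂.Definite) (hcon : N₁.Connects N₂) : Disjoint N₁.qnames N₂.res := by
  rw [Finset.disjoint_left]
  intro q hq hq'
  obtain ⟨a, ha⟩ := h₁.mem_outputs.1
    (hap (Finset.mem_inter.2 ⟨hq, h₂.res_subset_qnames hq'⟩))
  rw [(hcon a).1] at ha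
  exact (Finset.mem_sdiff.1 ha).2 hq'

/-- A shared qubit is an input of `N₂`, so it is owned from the start and cannot also be introduced
as a working qubit. -/
lemma Network.SeqApart.working_disjoint (hap : N₁.SeqApart N₂) (h₁ : N₁.Definite)
    (h₂ : N₂.Definite) (hcon : N₁.Connects N₂) {q : Q} (hq : q ∈ N₁.qnames) {b : A} :
    q ∉ ((N₂.agent b).prog.map Event.working).sum := by
  intro hb
  have hb' : q ∈ (N₂.agent b).introduced := Multiset.mem_add.2 (Or.inr hb)
  obtain ⟨a, ha⟩ := h₁.mem_outputs.1 (hap (Finset.mem_inter.2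
    ⟨hq, h₂.mem_qnames (Agent.mem_qnames_of_introduced hb')⟩))
  rw [(hcon a).1] at ha
  have ha' := (Finset.mem_sdiff.1 ha).1
  have hu := (Network.nodup_iff h₂.idle).1 h₂.nodup
  by_cases hab : a = b
  · subst hab
    exact Multiset.disjoint_left.1 (Multiset.nodup_add.1 (hu.1 a)).2.2 ha' hb
  · exact hu.2 a b q hab (Multiset.mem_add.2 (Or.inl ha')) hb'

lemma Network.comp_two_stage {M : Type*} [AddCommMonoid M] (h₁ : N₁.Definite)
    (h₂ : N₂.Definite) (hcon : N₁.Connects N₂) (hap : N₁.SeqApart N₂) {u : Val Q X A}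
    (hu : N₁.IsInput u) :
    Compl (N₂.comp N₁).Final (N₁.schedule ++ N₂.schedule) ((N₂.comp N₁).sys u) ∧
    ∀ φ : Val Q X A → Module.End ℂ (State Q) → M,
      ((branches (N₁.schedule ++ N₂.schedule) ((N₂.comp N₁).sys u)).map fun b =>
          φ ((N₂.comp N₁).readout b.1) b.2).sum =
        ((branches N₁.schedule (N₁.sys u)).map fun p =>
          ((branches N₂.schedule (N₂.sys (N₁.readout p.1))).map fun d =>
            φ (N₂.readout d.1) (d.2 * p.2)).sum).sum := by
  refine two_stage (T := fun a => (N₂.agent a).prog)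
    (E := fun a => (N₂.agent a).own ∩ N₂.res) (Y := fun _ => ∅) (F := u) (fun a => ?_)
    (Network.compl_final (h₁.compl_schedule hu)) (g₂ := fun p => N₂.sys (N₁.readout p))
    (r' := fun _ d => N₂.readout d) (fin₂ := N₂.Final) ?_
  · refine ⟨rfl, rfl, fun _ _ h => h, fun _ h => h.elim, fun e he => ?_, fun _ _ _ _ h => h⟩
    refine (hap.res_disjoint h₁ h₂ hcon).mono (fun q hq => ?_) Finset.inter_subset_right
    exact h₁.mem_qnames ((N₁.agent a).event_subset_qnames he hq)
  · rintro p h' hfp ⟨hp, hpo⟩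
    have hv : N₂.IsInput (N₁.readout p) := by
      intro a
      rw [Network.readout_eq, bound_restrictTo (hp a).2, (hcon a).2]
    refine ⟨fun _ => [], fun _ => ∅, fun _ => ∅, fun _ _ => none, fun a => ?_,
      h₂.compl_schedule hv, fun d h'' hfd hd => ⟨fun a => ⟨?_, ?_⟩, ?_⟩⟩
    · refine ⟨?_, ?_, fun x v hx => ?_, fun _ h => h.elim, fun _ _ => Finset.disjoint_empty_right _,
        fun _ _ _ _ h => h⟩
      · rw [(hfp a).prog, (hp a).1]
        simp [Network.sys]
      · rw [(hfp a).own, hpo a, (hcon a).1, Finset.union_empty]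
        exact Finset.sdiff_union_inter _ _
      · exact (hfp a).mem x v 
          (extends_restrictTo (fun a => (N₁.agent a).cout) (fun a => (p a).mem) a x v hx)
    · rw [(hfd a).prog, (hd a).1]
      rfl
    · exact (hd a).2.trans (hfd a).mem.bound_subset
    · funext a x
      by_cases hx : x ∈ (N₂.agent a).cout
      · simp [Network.readout, Network.comp, hx, (hfd a).mem.eq_of_mem ((hd a).2 hx)]
      · simp [Network.readout, Network.comp, hx]

lemma Network.Definite.comp (h₁ : N₁.Definite) (h₂ : N₂.Definite) (hcon : N₁.Connects N₂)
    (hap : N₁.SeqApart N₂) : (N₂.comp N₁).Definite := by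
  have hidle : ∀ a, a ∉ (N₂.comp N₁).names → (N₂.comp N₁).agent a = Agent.idle := by
    intro a ha
    have ha' : a ∉ N₁.names ∧ a ∉ N₂.names := by
      simpa [Network.comp, Finset.mem_union, not_or] using ha
    simp [Network.comp, h₁.idle a ha'.1, h₂.idle a ha'.2, Agent.idle]
  have hres := hap.res_disjoint h₁ h₂ hcon
  have u₁ := (Network.nodup_iff h₁.idle).1 h₁.nodup
  have u₂ := (Network.nodup_iff h₂.idle).1 h₂.nodup
  -- The quantum inputs of `N₂` were already introduced by `N₁`, so only its resource share and
  -- working qubits count as new.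
  let f₂ : A → Multiset Q := fun a =>
    ((N₂.agent a).own ∩ N₂.res).val + ((N₂.agent a).prog.map Event.working).sum
  have hle : ∀ a, f₂ a ≤ (N₂.agent a).introduced := fun a =>
    add_le_add_left (Finset.val_le_iff.2 Finset.inter_subset_left) _
  have u₂' : (∀ a, (f₂ a).Nodup) ∧ ∀ a b q, a ≠ b → q ∈ f₂ a → q ∉ f₂ b :=
    ⟨fun a => Multiset.nodup_of_le (hle a) (u₂.1 a), fun a b q hab ha hb =>
      u₂.2 a b q hab (Multiset.mem_of_le (hle a) ha) (Multiset.mem_of_le (hle b) hb)⟩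
  have hd : ∀ a b q, q ∈ (N₁.agent a).introduced → q ∉ f₂ b := by
    intro a b q hq hq'
    have hq1 := h₁.mem_qnames (Agent.mem_qnames_of_introduced hq)
    rcases Multiset.mem_add.1 hq' with hq' | hq'
    · exact Finset.disjoint_left.1 hres hq1 (Finset.mem_inter.1 hq').2
    · exact hap.working_disjoint h₁ h₂ hcon hq1 hq'
  refine ⟨hidle, ?_, ?_, ?_, N₁.schedule ++ N₂.schedule, ?_⟩
  · rw [Network.nodup_iff hidle]
    have e : ∀ a, ((N₂.comp N₁).agent a).introduced = (N₁.agent a).introduced + f₂ a :=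
      fun a => introduced_append (hd a a)
    simp only [e]
    exact unique_add u₁ u₂' hd
  · intro q hq
    rcases Finset.mem_union.1 hq with hq | hq
    · obtain ⟨a, ha, h⟩ := Finset.mem_biUnion.1 (h₁.res_subset hq)
      exact Finset.mem_biUnion.2 ⟨a, Finset.mem_union_left _ ha, Finset.mem_union_left _ h⟩
    · obtain ⟨a, ha, h⟩ := Finset.mem_biUnion.1 (h₂.res_subset hq)
      exact Finset.mem_biUnion.2 ⟨a, Finset.mem_union_right _ ha,
        Finset.mem_union_right _ (Finset.mem_inter.2 ⟨h, hq⟩)⟩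
  · exact h₁.density.tensor (hres.mono_left h₁.res_subset_qnames) h₂.density
  · rw [Network.isSchedule_iff]
    exact fun u hu => (Network.comp_two_stage (M := ℕ) h₁ h₂ hcon hap hu).1

/-- The denotation of a sequential composition. -/
lemma Network.den_comp (h₁ : N₁.Definite) (h₂ : N₂.Definite) (hcon : N₁.Connects N₂)
    (hap : N₁.SeqApart N₂) {u : Val Q X A} (hu : N₁.IsInput u) (w : Val Q X A) (ρ : State Q) :
    (N₂.comp N₁).den u w ρ = ((branches N₁.schedule (N₁.sys u)).map fun p =>
      N₂.denL (N₁.readout p.1) w (p.2 (tensor ρ N₁.res N₁.σ))).sum := by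
  classical
  have hres := hap.res_disjoint h₁ h₂ hcon
  have hc := Network.comp_two_stage (M := State Q) h₁ h₂ hcon hap hu
  have hτ : tensor ρ (N₂.comp N₁).res (N₂.comp N₁).σ =
      tensor (tensor ρ N₁.res N₁.σ) N₂.res N₂.σ :=
    tensor_assoc (hres.mono_left h₁.res_subset_qnames) _ _ _
  rw [(h₁.comp h₂ hcon hap).den_eq hu hc.1, hτ,
    hc.2 fun v L => if v = w then L (tensor (tensor ρ N₁.res N₁.σ) N₂.res N₂.σ) else 0]
  congr 1
  refine Multiset.map_congr rfl fun p hp => ?_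
  have hv : N₂.IsInput (N₁.readout p.1) := by
    intro a
    rw [Network.readout_eq, bound_restrictTo (((h₁.compl_schedule hu).final hp) a).2, (hcon a).2]
  rw [Network.denL_apply, h₂.den_eq hv (h₂.compl_schedule hv)]
  simp only [Module.End.mul_apply,
    (h₁.branches_localOn (h₁.compl_schedule hu) hp).tensor hres]

lemma Network.qin_comp (h₁ : N₁.Definite) (h₂ : N₂.Definite) (hcon : N₁.Connects N₂)
    (hap : N₁.SeqApart N₂) (a : A) : (N₂.comp N₁).qin a = N₁.qin a := by
  have hd := Finset.disjoint_left.1 (hap.res_disjoint h₁ h₂ hcon)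
  ext q
  have e1 := fun h : q ∈ (N₁.agent a).own => h₁.mem_qnames ((N₁.agent a).own_subset_qnames h)
  have e5 := @hd q
  simp only [Network.qin, Network.comp, Finset.mem_sdiff, Finset.mem_union, Finset.mem_inter]
  tauto

lemma Network.qout_comp (h₁ : N₁.Definite) (h₂ : N₂.Definite) (hcon : N₁.Connects N₂)
    (hap : N₁.SeqApart N₂) (a : A) : (N₂.comp N₁).qout a = N₂.qout a := by
  simp only [Network.qout, Network.comp, Agent.out, List.foldl_append]
  rw [foldl_own_union]
  · have h := (hcon a).1
    simp only [Network.qout, Network.qin, Agent.out] at h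
    rw [h, Finset.sdiff_union_inter]
  · intro e he
    refine (hap.res_disjoint h₁ h₂ hcon).mono (fun q hq => ?_) Finset.inter_subset_right
    exact h₁.mem_qnames ((N₁.agent a).event_subset_qnames he hq)

end Comp

end Composition

end DMC

/-! ### Congruence, probabilities, and contexts -/

namespace DMC

section Congruence

variable {Q X K A : Type*} [DecidableEq Q] [DecidableEq X] [DecidableEq A]

/-! ### Denotational equivalence is a congruence -/

lemma Network.DenEquiv.refl (N : Network Q X K A) : N.DenEquiv N :=
  ⟨⟨rfl, fun _ => rfl, fun _ => rfl, fun _ => rfl, fun _ => rfl⟩, fun _ _ _ _ _ => rfl⟩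

variable {N₁ N₂ M₁ M₂ : Network Q X K A}

lemma Network.inputs_par (h₁ : N₁.Definite) (h₂ : N₂.Definite) (hap : N₁.ParApart N₂) :
    (N₁.par N₂).inputs = N₁.inputs ∪ N₂.inputs := by
  ext q
  rw [(h₁.par h₂ hap).mem_inputs, Finset.mem_union, h₁.mem_inputs, h₂.mem_inputs, ← exists_or]
  simp only [Network.qin_par h₁ h₂ hap, Finset.mem_union]

lemma Network.DenEquiv.par (h : N₁.DenEquiv M₁) (h' : N₂.DenEquiv M₂) (h₁ : N₁.Definite)
    (h₂ : N₂.Definite) (h₁' : M₁.Definite) (h₂' : M₂.Definite) (hap : N₁.ParApart N₂)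
    (hap' : M₁.ParApart M₂) : (N₁.par N₂).DenEquiv (M₁.par M₂) := by
  refine ⟨⟨?_, fun a => ?_, fun a => ?_, fun a => ?_, fun a => ?_⟩, fun u w ρ hu hρ => ?_⟩
  · simp only [Network.par, h.1.names, h'.1.names]
  · simp only [Network.par, h.1.cin, h'.1.cin]
  · simp only [Network.par, h.1.cout, h'.1.cout]
  · rw [Network.qin_par h₁ h₂ hap, Network.qin_par h₁' h₂' hap', h.1.qin, h'.1.qin]
  · rw [Network.qout_par h₁ h₂ hap, Network.qout_par h₁' h₂' hap', h.1.qout, h'.1.qout]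
  · have hu' : (M₁.par M₂).IsInput u := by
      intro a
      rw [hu a]
      simp only [Network.par, h.1.cin, h'.1.cin]
    have hu₁ := Network.par_input_left hu
    have hu₂ := Network.par_input_right hu
    rw [Network.inputs_par h₁ h₂ hap] at hρ
    -- While `N₁` acts the inputs of `N₂` are spectators, and while `N₂` acts the outputs of `N₁`
    -- are. The two groups may be entangled, so equivalence is needed in its version with an
    -- ancilla.
    have hT : Disjoint N₁.qnames N₂.inputs := hap.1.mono_right h₂.inputs_subset_qnames
    have hT' : Disjoint M₁.qnames N₂.inputs := by
      rw [h'.1.inputs]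
      exact hap'.1.mono_right h₂'.inputs_subset_qnames
    have hU : Disjoint N₂.qnames N₁.outputs := (hap.1.mono_left h₁.outputs_subset_qnames).symm
    have hU' : Disjoint M₂.qnames N₁.outputs := by
      rw [h.1.outputs]
      exact (hap'.1.mono_left h₁'.outputs_subset_qnames).symm
    rw [Network.den_par h₁ h₂ hap hu, Network.den_par h₁' h₂' hap' hu']
    have e := h₁.den_supportedOn_union hu₁ (restrictTo (fun a => (N₁.agent a).cout) w) hT hρ
    rw [Finset.union_comm] at e
    rw [h'.den_eq h₂ h₂' hU hU' hu₂ _ e, h.den_eq h₁ h₁' hT hT' hu₁ _ hρ]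
    have c : (fun a => (N₁.agent a).cout ∪ (N₂.agent a).cout) =
        fun a => (M₁.agent a).cout ∪ (M₂.agent a).cout := by
      funext a
      rw [h.1.cout, h'.1.cout]
    rw [c]
    simp only [h.1.cin, h.1.cout, h'.1.cin, h'.1.cout]

/-- In `Network.den_comp` the second map depends on the path through the classical outputs only.
Collecting the paths with equal outputs turns their states into the denotation of the first network.
-/
lemma sum_map_by_label {α β : Type*} [DecidableEq β] (s : Multiset α) (f : α → β)
    (x : α → State Q) (F : β → Module.End ℂ (State Q)) (V : Finset β) (hV : ∀ a ∈ s, f a ∈ V) :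
    (s.map fun a => F (f a) (x a)).sum =
      ∑ v ∈ V, F v (s.map fun a => if f a = v then x a else 0).sum := by
  induction s using Multiset.induction with
  | empty => simp
  | cons a s ih =>
    simp only [Multiset.map_cons, Multiset.sum_cons, map_add, Finset.sum_add_distrib]
    have h1 : ∑ v ∈ V, F v (if f a = v then x a else 0) = F (f a) (x a) := by
      rw [Finset.sum_eq_single_of_mem (f a) (hV a (Multiset.mem_cons_self a s)) fun v _ hv => by
        rw [if_neg hv.symm, map_zero], if_pos rfl]
    rw [ih fun b hb => hV b (Multiset.mem_cons_of_mem hb), h1]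

lemma Network.DenEquiv.comp (h : N₁.DenEquiv M₁) (h' : N₂.DenEquiv M₂) (h₁ : N₁.Definite)
    (h₂ : N₂.Definite) (h₁' : M₁.Definite) (h₂' : M₂.Definite) (hcon : N₁.Connects N₂)
    (hcon' : M₁.Connects M₂) (hap : N₁.SeqApart N₂) (hap' : M₁.SeqApart M₂) :
    (N₂.comp N₁).DenEquiv (M₂.comp M₁) := by
  classical
  have hqin : ∀ a, (N₂.comp N₁).qin a = N₁.qin a := Network.qin_comp h₁ h₂ hcon hap
  refine ⟨⟨?_, fun a => h.1.cin a, fun a => h'.1.cout a, fun a => ?_, fun a => ?_⟩,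
    fun u w ρ hu hρ => ?_⟩
  · simp only [Network.comp, h.1.names, h'.1.names]
  · rw [hqin, Network.qin_comp h₁' h₂' hcon' hap', h.1.qin]
  · rw [Network.qout_comp h₁ h₂ hcon hap, Network.qout_comp h₁' h₂' hcon' hap', h'.1.qout]
  · have hu₁ : N₁.IsInput u := hu
    have hu₁' : M₁.IsInput u := h.1.isInput.1 hu₁
    have hin : (N₂.comp N₁).inputs = N₁.inputs := by
      ext q
      simp only [(h₁.comp h₂ hcon hap).mem_inputs, h₁.mem_inputs, hqin]
    rw [hin] at hρ
    have hio : N₁.outputs = N₂.inputs := by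
      ext q
      simp only [h₁.mem_outputs, h₂.mem_inputs, (hcon _).1]
    rw [Network.den_comp h₁ h₂ hcon hap hu₁, Network.den_comp h₁' h₂' hcon' hap' hu₁']
    -- The second network can be replaced path by path. The first cannot, since the paths of
    -- equivalent networks need not correspond; it is replaced after grouping.
    have e : ∀ p ∈ branches N₁.schedule (N₁.sys u),
        N₂.denL (N₁.readout p.1) w (p.2 (tensor ρ N₁.res N₁.σ)) =
          M₂.denL (N₁.readout p.1) w (p.2 (tensor ρ N₁.res N₁.σ)) := by
      intro p hp
      have hv : N₂.IsInput (N₁.readout p.1) := by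
        intro a
        rw [Network.readout_eq,
          bound_restrictTo (((h₁.compl_schedule hu₁).final hp) a).2, (hcon a).2]
      rw [Network.denL_apply, Network.denL_apply]
      refine h'.2 _ w _ hv ?_
      rw [← hio]
      exact h₁.branches_supportedOn (h₁.compl_schedule hu₁) hp hρ
    rw [Multiset.map_congr rfl e]
    -- The labels of both networks are collected so that the two sums have the same index set;
    -- labels that are not attained contribute zero.
    let V : Finset (Val Q X A) :=
      ((branches N₁.schedule (N₁.sys u)).map fun p => N₁.readout p.1).toFinset ∪
        ((branches M₁.schedule (M₁.sys u)).map fun p => M₁.readout p.1).toFinset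
    rw [sum_map_by_label _ (fun p => N₁.readout p.1) (fun p => p.2 (tensor ρ N₁.res N₁.σ))
        (fun v => M₂.denL v w) V fun p hp => Finset.mem_union_left _
          (Multiset.mem_toFinset.2 (Multiset.mem_map.2 ⟨p, hp, rfl⟩)),
      sum_map_by_label _ (fun p => M₁.readout p.1) (fun p => p.2 (tensor ρ M₁.res M₁.σ))
        (fun v => M₂.denL v w) V fun p hp => Finset.mem_union_right _
          (Multiset.mem_toFinset.2 (Multiset.mem_map.2 ⟨p, hp, rfl⟩))]
    refine Finset.sum_congr rfl fun v _ => ?_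
    have e1 := h₁.den_eq hu₁ (h₁.compl_schedule hu₁) v ρ
    have e2 := h₁'.den_eq hu₁' (h₁'.compl_schedule hu₁') v ρ
    have e3 := h.2 u v ρ hu₁ hρ
    rw [← e1, ← e2, e3]

/-! ### Probabilities -/

/-- `ρ` is positive semidefinite and lives on finitely many qubits. -/
def Positive (ρ : State Q) : Prop := ρ.PosSemidef ∧ ∃ S, SupportedOn S ρ

lemma Cmd.exec_prob (C : Cmd Q X) (Γ : Mem Q X) {ρ : State Q} (hρ : Positive ρ)
    {b : ℝ × (Mem Q X × State Q)} (hb : b ∈ C.exec (Γ, ρ)) :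
    Positive b.2.2 ∧ (tr b.2.2).re = b.1 * (tr ρ).re := by
  obtain ⟨hp, S, hS⟩ := hρ
  have hS' := supportedOn_iff.1 hS
  cases C with
  | entangle i j =>
    rw [Cmd.exec, List.mem_singleton] at hb
    subst hb
    exact ⟨⟨(localOn_czL i j).posSemidef hp, S, supportedOn_iff.2 (hS'.applyCZ i j)⟩,
      by simp [tr_applyCZ]⟩
  | corrX i s =>
    rw [Cmd.exec, List.mem_singleton] at hb
    subst hb
    dsimp only
    split_ifs
    -- Definiteness is not assumed here, so `i` may lie outside `S`.
    · refine ⟨⟨(localOn_pauliXL i).posSemidef hp, insert i S, supportedOn_iff.2 ?_⟩,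
        by simp [tr_applyX]⟩
      exact SupportedIn.applyX (hS'.mono (by simp)) (by simp)
    · exact ⟨⟨hp, S, hS⟩, by simp⟩
  | corrZ i s =>
    rw [Cmd.exec, List.mem_singleton] at hb
    subst hb
    dsimp only
    split_ifs
    · exact ⟨⟨(localOn_pauliZL i).posSemidef hp, S, supportedOn_iff.2 (hS'.applyZ i)⟩,
        by simp [tr_applyZ]⟩
    · exact ⟨⟨hp, S, hS⟩, by simp⟩
  | measure i α s t =>
    simp only [Cmd.exec, List.mem_map] at hb
    obtain ⟨v, _, rfl⟩ := hb
    refine ⟨⟨(localOn_projectL i _ v).posSemidef hp, S, supportedOn_iff.2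
      ((hS'.project i _ v).mono Set.sdiff_subset)⟩, ?_⟩
    dsimp only
    -- The probability is then a division by zero, with value 0. This does no harm, as a positive
    -- operator of trace zero vanishes and so does its projection.
    by_cases h0 : (tr ρ).re = 0
    · have h1 : tr ρ = 0 := by
        have h2 := (Complex.nonneg_iff.1 (tr_nonneg hp)).2
        exact Complex.ext h0 h2.symm
      have h2 : project i (angle α (s.eval Γ) (t.eval Γ)) v ρ = 0 := by
        rw [eq_zero_of_tr hS hp h1]
        exact map_zero (projectL i _ v)
      rw [h2, tr_zero, h0]
      simp
    · rw [div_mul_cancel₀ _ h0]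

lemma execCmds_prob (cs : List (Cmd Q X)) (Γ : Mem Q X) {ρ : State Q} (hρ : Positive ρ)
    {b : ℝ × (Mem Q X × State Q)} (hb : b ∈ execCmds cs (Γ, ρ)) :
    Positive b.2.2 ∧ (tr b.2.2).re = b.1 * (tr ρ).re := by
  induction cs generalizing Γ ρ b with
  | nil =>
    rw [execCmds, List.mem_singleton] at hb
    subst hb
    exact ⟨hρ, by simp⟩
  | cons C cs ih =>
    simp only [execCmds, List.mem_flatMap, List.mem_map] at hb
    obtain ⟨c, hc, d, hd, rfl⟩ := hb
    obtain ⟨h1, h2⟩ := C.exec_prob Γ hρ hc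
    obtain ⟨h3, h4⟩ := ih c.2.1 h1 hd
    exact ⟨h3, by rw [h4, h2]; ring⟩

/-- The delicate case is preparation, which preserves the trace when the working qubits are new to
the register. They are: the state is supported on owned qubits, and by `Unique` no working qubit is
owned yet. -/
lemma fire_prob {c : Config Q X K A} {α : Action A} (hα : Ready c.agent α)
    (hu : Unique c.agent) (hρ : Positive c.state) (ho : SupportedIn (owned c.agent) c.state)
    {b : ℝ × Config Q X K A} (hb : b ∈ fire c α) :
    Positive b.2.state ∧ (tr b.2.state).re = b.1 * (tr c.state).re := by
  refine hα.elim ?_ ?_ ?_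
  · rintro a P r rfl h1 h2 h3 -
    simp only [fire] at hb
    rw [h1] at hb
    obtain ⟨d, hd, rfl⟩ := List.mem_map.1 hb
    obtain ⟨hp, S, hS⟩ := hρ
    have hdis : Disjoint (S \ (P.V \ P.I)) (P.V \ P.I) := Finset.sdiff_disjoint
    have hS' : SupportedOn (S \ (P.V \ P.I)) c.state := by
      have key : ∀ s : Finset Q, s ⊆ S → (s : Set Q) ⊆ owned c.agent → s ⊆ S \ (P.V \ P.I) := by
        intro s hs hs' q hq
        refine Finset.mem_sdiff.2 ⟨hs hq, fun hq' => ?_⟩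
        have hw : q ∈ ((c.agent a).prog.map Event.working).sum := by
          rw [h1, List.map_cons, List.sum_cons, Multiset.mem_add]
          exact Or.inl hq'
        obtain ⟨e, he⟩ := hs' hq
        by_cases hae : a = e
        · subst hae
          exact (nodup_ledger.1 (hu.1 a)).2 q he hw
        · exact hu.2 a e q hae (mem_ledger.2 (Or.inr hw)) (mem_ledger.2 (Or.inl he))
      intro x y hxy
      exact ⟨key x (hS x y hxy).1 (ho x y hxy).1, key y (hS x y hxy).2 (ho x y hxy).2⟩
    have hpp : Positive (prep (P.V \ P.I) c.state) := by
      refine ⟨(localOn_prepL _).posSemidef hp, S ∪ (P.V \ P.I), supportedOn_iff.2 ?_⟩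
      rw [Finset.coe_union]
      exact (supportedOn_iff.1 hS).prep _
    obtain ⟨h4, h5⟩ := execCmds_prob P.cmds _ hpp hd
    exact ⟨h4, by rw [h5, tr_prep hdis hS']⟩
  · rintro a b k s x r r' rfl - h1 h2 - -
    simp only [fire] at hb
    rw [h1, h2] at hb
    rw [List.mem_singleton.1 hb]
    exact ⟨hρ, by simp⟩
  · rintro a b k q r r' rfl - h1 h2 - -
    simp only [fire] at hb
    rw [h1, h2] at hb
    rw [List.mem_singleton.1 hb]
    exact ⟨hρ, by simp⟩

/-- The probability of a path is the relative trace of its final state. -/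
lemma run_prob {fin : Sys Q X K A → Prop} {l : List (Action A)} {c : Config Q X K A}
    (hl : Compl fin l c.agent) (hu : Unique c.agent) (hρ : Positive c.state)
    (ho : SupportedIn (owned c.agent) c.state) {b : ℝ × Config Q X K A} (hb : b ∈ run l c) :
    Positive b.2.state ∧ (tr b.2.state).re = b.1 * (tr c.state).re := by
  induction l generalizing c b with
  | nil =>
    rw [run, List.mem_singleton] at hb
    subst hb
    exact ⟨hρ, by simp⟩
  | cons α l ih =>
    simp only [run, List.mem_flatMap, List.mem_map] at hb
    obtain ⟨d, hd, e, he, rfl⟩ := hb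
    obtain ⟨h1, h2⟩ := fire_prob hl.1 hu hρ ho hd
    have hm : d.2 ∈ (((fire c α).map Prod.snd : List _) : Multiset (Config Q X K A)) :=
      Multiset.mem_coe.2 (List.mem_map.2 ⟨d, hd, rfl⟩)
    rw [map_fire, Multiset.mem_map] at hm
    obtain ⟨p, hp, hpd⟩ := hm
    have ha : d.2.agent = p.1 := by rw [← hpd]
    have hs : d.2.state = p.2 c.state := by rw [← hpd]
    obtain ⟨h3, h4⟩ := ih (c := d.2) (ha ▸ hl.2 p hp) (ha ▸ hu.step hl.1 hp) h1
      (by rw [ha, hs]; exact steps_supportedIn hl.1 hp ho) he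
    exact ⟨h3, by rw [h4, h2]; ring⟩

variable {N : Network Q X K A}

lemma Network.Definite.sum_prob (hN : N.Definite) {u : Val Q X A} (hu : N.IsInput u)
    (w : Val Q X A) {ρ : State Q} (hρ : IsDensityOn N.inputs ρ) :
    ((N.paths u ρ w).map fun p => p.1).sum = (tr (N.den u w ρ)).re := by
  classical
  have hdis : Disjoint N.inputs N.res := by
    rw [Finset.disjoint_left]
    intro q hq
    obtain ⟨a, h⟩ := hN.mem_inputs.1 hq
    exact (Finset.mem_sdiff.1 h).2
  have hd := hρ.tensor hdis hN.density
  have hl := hN.compl_schedule hu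
  have h1 : ∀ p ∈ N.paths u ρ w, p.1 = (tr p.2.state).re := by
    intro p hp
    have h2 := run_prob (c := N.init u ρ) hl (hN.unique u) ⟨hd.posSemidef, _, hd.supported⟩
      ((supportedOn_iff.1 hd.supported).mono (hN.inputs_union_res u)) (List.mem_filter.1 hp).1
    rw [h2.2, show tr (N.init u ρ).state = 1 from hd.trace_one, Complex.one_re, mul_one]
  rw [List.map_congr_left h1, N.sum_paths u w ρ fun τ => (tr τ).re,
    hN.den_eq hu hl w ρ]
  -- The trace is a `finsum`, with additivity available on a common finite register, so the support
  -- is carried through the induction.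
  have key : ∀ s : Multiset (Sys Q X K A × Module.End ℂ (State Q)),
      s ≤ branches N.schedule (N.sys u) →
      SupportedOn N.outputs (s.map fun b =>
        if N.readout b.1 = w then b.2 (tensor ρ N.res N.σ) else 0).sum ∧
      (s.map fun b => if N.readout b.1 = w then (tr (b.2 (tensor ρ N.res N.σ))).re else 0).sum =
        (tr (s.map fun b => if N.readout b.1 = w then b.2 (tensor ρ N.res N.σ) else 0).sum).re := by
    intro s
    induction s using Multiset.induction with
    | empty => exact fun _ => ⟨supportedOn_iff.2 (SupportedIn.zero _), by simp [tr_zero]⟩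
    | cons b s ih =>
      intro hs
      obtain ⟨i1, i2⟩ := ih ((Multiset.le_cons_self s b).trans hs)
      have i3 : SupportedOn N.outputs (b.2 (tensor ρ N.res N.σ)) :=
        hN.branches_supportedOn hl (Multiset.mem_of_le hs (Multiset.mem_cons_self b s))
          hρ.supported
      simp only [Multiset.map_cons, Multiset.sum_cons, i2]
      split_ifs
      · exact ⟨supportedOn_iff.2 ((supportedOn_iff.1 i3).add (supportedOn_iff.1 i1)),
          by rw [tr_add i3 i1, Complex.add_re]⟩
      · simpa using i1
  exact (key _ le_rfl).2

lemma Network.Definite.bigStep_iff (hN : N.Definite) {u w : Val Q X A} {ρ ρ' : State Q} {l : ℝ} :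
    N.BigStep u ρ l w ρ' ↔ N.IsInput u ∧ IsDensityOn N.inputs ρ ∧ 0 < l ∧
      l = (tr (N.den u w ρ)).re ∧ ρ' = N.den u w ρ := by
  constructor
  · rintro ⟨h1, h2, h3, h4, h5⟩
    exact ⟨h1, h2, h3, by rw [h4, hN.sum_prob h1 w h2], h5⟩
  · rintro ⟨h1, h2, h3, h4, h5⟩
    exact ⟨h1, h2, h3, by rw [h4, hN.sum_prob h1 w h2], h5⟩

/-- For definite networks, operational and denotational equivalence coincide. -/
theorem Network.opEquiv_iff_denEquiv (h₁ : N₁.Definite) (h₂ : N₂.Definite) :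
    N₁.OpEquiv N₂ ↔ N₁.DenEquiv N₂ := by
  constructor
  · rintro ⟨ht, h⟩
    refine ⟨ht, fun u w ρ hu hρ => ?_⟩
    have hu₂ := ht.isInput.1 hu
    rw [← Network.denL_apply, ← Network.denL_apply]
    refine linearMap_eq_of_density (S := N₁.inputs) (fun ρ hρ => ?_) hρ
    rw [Network.denL_apply, Network.denL_apply]
    have hρ₂ : IsDensityOn N₂.inputs ρ := ht.inputs ▸ hρ
    have p₁ := h₁.den_posSemidef hu w hρ.posSemidef
    have p₂ := h₂.den_posSemidef hu₂ w hρ.posSemidef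
    have z : ∀ {S : Finset Q} {τ : State Q}, SupportedOn S τ → τ.PosSemidef →
        ¬ 0 < (tr τ).re → τ = 0 := by
      intro S τ hS hτ h0
      have h1 := Complex.nonneg_iff.1 (tr_nonneg hτ)
      exact eq_zero_of_tr hS hτ (Complex.ext (le_antisymm (not_lt.1 h0) h1.1) h1.2.symm)
    -- A transition of positive probability exposes the final state. If neither network has one,
    -- both final states are positive with trace zero, hence zero.
    by_cases c₁ : 0 < (tr (N₁.den u w ρ)).re
    · exact (h₂.bigStep_iff.1 ((h u ρ _ w _).1
        (h₁.bigStep_iff.2 ⟨hu, hρ, c₁, rfl, rfl⟩))).2.2.2.2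
    · by_cases c₂ : 0 < (tr (N₂.den u w ρ)).re
      · exact (h₁.bigStep_iff.1 ((h u ρ _ w _).2
          (h₂.bigStep_iff.2 ⟨hu₂, hρ₂, c₂, rfl, rfl⟩))).2.2.2.2.symm
      · rw [z (h₁.den_supportedOn hu w hρ.supported) p₁ c₁,
          z (h₂.den_supportedOn hu₂ w hρ₂.supported) p₂ c₂]
  · rintro ⟨ht, h⟩
    refine ⟨ht, fun u ρ l w ρ' => ?_⟩
    rw [h₁.bigStep_iff, h₂.bigStep_iff, ← ht.isInput, ← ht.inputs]
    constructor
    · rintro ⟨i1, i2, i3, i4, i5⟩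
      rw [h u w ρ i1 i2.supported] at i4 i5
      exact ⟨i1, i2, i3, i4, i5⟩
    · rintro ⟨i1, i2, i3, i4, i5⟩
      rw [← h u w ρ i1 i2.supported] at i4 i5
      exact ⟨i1, i2, i3, i4, i5⟩

/-! ### Contexts -/

/-- Matching of interfaces is a property of the type signature, so it transfers from `N₁` to `N₂`.
Clashes of names involve internal names as well, so their absence is required for both fillings. -/
lemma Context.fill_denEquiv (C : Context Q X K A) (h₁ : N₁.Definite) (h₂ : N₂.Definite)
    (hC : C.Connects N₁) (hC₁ : C.NamesApart N₁) (hC₂ : C.NamesApart N₂) (h : N₁.DenEquiv N₂) :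
    (C.fill N₁).Definite ∧ (C.fill N₂).Definite ∧ (C.fill N₁).DenEquiv (C.fill N₂) := by
  induction C with
  | hole => exact ⟨h₁, h₂, h⟩
  | parLeft C M ih =>
    obtain ⟨i1, i2, i3⟩ := ih hC.1 hC₁.1 hC₂.1
    exact ⟨i1.par hC.2 hC₁.2, i2.par hC.2 hC₂.2,
      i3.par (.refl M) i1 hC.2 i2 hC.2 hC₁.2 hC₂.2⟩
  | parRight M C ih =>
    obtain ⟨i1, i2, i3⟩ := ih hC.1 hC₁.1 hC₂.1
    exact ⟨hC.2.par i1 hC₁.2, hC.2.par i2 hC₂.2,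
      Network.DenEquiv.par (.refl M) i3 hC.2 i1 hC.2 i2 hC₁.2 hC₂.2⟩
  | before M C ih =>
    obtain ⟨i1, i2, i3⟩ := ih hC.1 hC₁.1 hC₂.1
    obtain ⟨-, hM, hcon⟩ := hC
    have hcon' : (C.fill N₂).Connects M := fun a => by
      rw [← i3.1.qout, ← i3.1.cout]
      exact hcon a
    exact ⟨i1.comp hM hcon hC₁.2, i2.comp hM hcon' hC₂.2,
      i3.comp (.refl M) i1 hM i2 hM hcon hcon' hC₁.2 hC₂.2⟩
  | after C M ih =>
    obtain ⟨i1, i2, i3⟩ := ih hC.1 hC₁.1 hC₂.1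
    obtain ⟨-, hM, hcon⟩ := hC
    have hcon' : M.Connects (C.fill N₂) := fun a => by
      rw [← i3.1.qin, ← i3.1.cin]
      exact hcon a
    exact ⟨hM.comp i1 hcon hC₁.2, hM.comp i2 hcon' hC₂.2,
      Network.DenEquiv.comp (.refl M) i3 hM i1 hM i2 hcon hcon' hC₁.2 hC₂.2⟩

end Congruence

end DMC

theorem mainTheorem4 {Q X K A : Type*} [DecidableEq Q] [DecidableEq X] [DecidableEq A]
    (N₁ N₂ : DMC.Network Q X K A) (C : DMC.Context Q X K A)
    (hN₁ : N₁.Definite) (hN₂ : N₂.Definite)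
    (hC : C.Connects N₁) (hC₁ : C.NamesApart N₁) (hC₂ : C.NamesApart N₂) :
    (N₁.DenEquiv N₂ →
      (C.fill N₁).Definite ∧ (C.fill N₂).Definite ∧ (C.fill N₁).DenEquiv (C.fill N₂)) ∧
    (N₁.OpEquiv N₂ →
      (C.fill N₁).Definite ∧ (C.fill N₂).Definite ∧ (C.fill N₁).OpEquiv (C.fill N₂)) := by
  refine ⟨C.fill_denEquiv hN₁ hN₂ hC hC₁ hC₂, fun h => ?_⟩
  obtain ⟨h₁, h₂, h₃⟩ := C.fill_denEquiv hN₁ hN₂ hC hC₁ hC₂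
    ((DMC.Network.opEquiv_iff_denEquiv hN₁ hN₂).1 h)
  exact ⟨h₁, h₂, (DMC.Network.opEquiv_iff_denEquiv h₁ h₂).2 h₃⟩
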